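/- Let $G=(V,E)$ be a finite connected graph with at least one edge (loops and multiple edges are allowed), each edge being identified with $[0,1]$. A metric on $G$ is a vector $g\in\mathbb{R}_{>0}^{E}$; it gives the edge $e$ the length $\sqrt{g_e}$ and the line element $dx_g=\sqrt{g_e}\,dx$. A density is a function $\rho$ on the edges that is positive and $C^\infty$ on each closed edge (no condition is imposed at the vertices). Let $$0=\lambda_0(g,\rho)<\lambda_1(g,\rho)\le\lambda_2(g,\rho)\le\cdots$$ be the eigenvalues, repeated according to multiplicity, of the problem $$-\frac{d^2f}{dx_g^2}=\lambda\rho f\ \text{ on edges},\qquad f \text{ continuous on } G,\qquad \sum_{e\in E_v}f_e'(v)=0\ \text{ for all } v\in V,$$ where the sum runs over the edge ends at $v$ and $f_e'(v)$ is the derivative, with respect to arc length, in the direction pointing out of $v$ into $e$. Write $\lambda_k(g)=\lambda_k(g,1)$ and $L(g)=\sum_{e}\sqrt{g_e}$, and put $$\overline{\lambda_k}(g)=\lambda_k(g)L(g)^2,\qquad \overline{\lambda_k}(g,\rho)=\lambda_k(g,\rho)\,L(g)\int_{(G,g)}\rho\,dx_g .$$ A metric $g_*$ is extremal for a functional $F$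 of metrics if for every smooth one-parameter family of metrics $g(t)$, $|t|<\delta$, with $g(0)=g_*$, one has either $F(g(t))\le F(g_*)+o(t)$ or $F(g(t))\ge F(g_*)+o(t)$ as $t\to0$. A pair $(g_*,\rho_*)$ of a metric and a density is extremal for a functional $F$ of such pairs if for every smooth one-parameter family of pairs $(g(t),\rho(t))$, $|t|<\delta$, with $g(0)=g_*$ and $\rho(0)=\rho_*$ (where $\rho(t)(x)$ is $C^\infty$ in $(t,x)$ on each closed edge), one has either $F(g(t),\rho(t))\le F(g_*,\rho_*)+o(t)$ or $F(g(t),\rho(t))\ge F(g_*,\rho_*)+o(t)$ as $t\to0$. Let $k\ge 0$ and suppose that $g_*$ is extremal for the functional $g\mapsto\overline{\lambda_k}(g)$, that $4\lambda_k(g_*)$ is not an eigenvalue of the above problem with $g=g_*$ and $\rho\equiv1$, and that $\lambda_k(g_*)>\lambda_{k-1}(g_*)$ (with $k\ge1$) or $\lambda_k(g_*)<\lambda_{k+1}(g_*)$. Then the pair $(g_*,1)$ is extremal for the functional $(g,\rho)\mapsto\overline{\lambda_k}(g,\rho)$. -/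

import Mathlib

open scoped ContDiff Topology

namespace QuantumGraph

/-- A multigraph with vertices `V` and edges `E`; loops and multiple edges are allowed.
Every edge `e` comes with an identification with the unit interval, the point `0` being glued to
`src e` and the point `1` to `tgt e`. -/
structure DiscreteGraph (V E : Type*) where
  src : E → V
  tgt : E → V

/-- Connectedness of the graph (loops and the direction of the edges are irrelevant for it). -/
def DiscreteGraph.Connected {V E : Type*} (G : DiscreteGraph V E) : Prop :=
  (SimpleGraph.fromRel fun v w : V => ∃ e : E, G.src e = v ∧ G.tgt e = w).Connected

/-- A metric on the graph is a vector `g : E → ℝ` with positive entries; the edge `e` has length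
`√(g e)` and line element `dx_g = √(g e) dx`, where `x ∈ [0, 1]` is the coordinate on the edge. -/
def IsMetric {E : Type*} (g : E → ℝ) : Prop :=
  ∀ e, 0 < g e

/-- Functions on the graph are given edgewise in the coordinate `x ∈ [0, 1]`, as
`f : E → ℝ → ℝ`; values outside `[0, 1]` never matter. This says that `f` is not identically zero
on the graph. -/
def IsNonzero {E : Type*} (f : E → ℝ → ℝ) : Prop :=
  ∃ e, ∃ x ∈ Set.Icc (0 : ℝ) 1, f e x ≠ 0

/-- The Laplacian `Δ_g f = - d²f/dx_g² = - (1 / g_e) d²f/dx²`. -/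
noncomputable def laplacian {E : Type*} (g : E → ℝ) (f : E → ℝ → ℝ) (e : E) (x : ℝ) : ℝ :=
  -((g e)⁻¹ * iteratedDerivWithin 2 (f e) (Set.Icc 0 1) x)

/-- The derivative `df/dx_g = (1 / √g_e) df/dx` with respect to arc length, one-sided at the ends
of the edge. -/
noncomputable def arcDeriv {E : Type*} (g : E → ℝ) (f : E → ℝ → ℝ) (e : E) (x : ℝ) : ℝ :=
  (√(g e))⁻¹ * derivWithin (f e) (Set.Icc 0 1) x

open Classical in
/-- The sum over all edge ends at `v` of the derivatives in the direction pointing out of `v` into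
the edge; a loop at `v` contributes both of its ends. -/
noncomputable def outwardFlux {V E : Type*} [Fintype E] (G : DiscreteGraph V E) (g : E → ℝ)
    (f : E → ℝ → ℝ) (v : V) : ℝ :=
  (∑ e : E, if G.src e = v then arcDeriv g f e 0 else 0) +
    ∑ e : E, if G.tgt e = v then -arcDeriv g f e 1 else 0

/-- `f` solves the eigenvalue problem `Δ_g f = μ ρ f` on the edges, `f` continuous on the graph,
with Neumann (Kirchhoff) conditions at the vertices. The zero solution is included. -/
structure SolvesEigenproblem {V E : Type*} [Fintype E] (G : DiscreteGraph V E) (g : E → ℝ)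
    (ρ : E → ℝ → ℝ) (μ : ℝ) (f : E → ℝ → ℝ) : Prop where
  regular : ∀ e, ContDiffOn ℝ 2 (f e) (Set.Icc 0 1)
  equation : ∀ e, ∀ x ∈ Set.Ioo (0 : ℝ) 1, laplacian g f e x = μ * ρ e x * f e x
  continuous_at_vertices : ∃ a : V → ℝ, ∀ e, f e 0 = a (G.src e) ∧ f e 1 = a (G.tgt e)
  neumann : ∀ v, outwardFlux G g f v = 0

/-- `μ` is an eigenvalue of the problem with metric `g` and density `ρ`. -/
def IsEigenvalue {V E : Type*} [Fintype E] (G : DiscreteGraph V E) (g : E → ℝ)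
    (ρ : E → ℝ → ℝ) (μ : ℝ) : Prop :=
  ∃ f, SolvesEigenproblem G g ρ μ f ∧ IsNonzero f

/-- The `k`-th eigenvalue `λ_k(g, ρ)` (`k = 0, 1, 2, …`) in the increasing sequence of all
eigenvalues repeated according to multiplicity: the least `c` such that there are `k + 1` functions
on the graph which are linearly independent and are solutions of the eigenvalue problem for
eigenvalues `≤ c`. -/
noncomputable def eigenvalue {V E : Type*} [Fintype E] (G : DiscreteGraph V E) (k : ℕ)
    (g : E → ℝ) (ρ : E → ℝ → ℝ) : ℝ :=
  sInf {c : ℝ | ∃ f : Fin (k + 1) → E → ℝ → ℝ,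
    LinearIndependent ℝ (fun (i : Fin (k + 1)) (p : E × Set.Icc (0 : ℝ) 1) => f i p.1 p.2) ∧
    ∀ i, ∃ μ ≤ c, SolvesEigenproblem G g ρ μ (f i)}

/-- The density identically equal to one; with it the problem is `Δ_g f = μ f`. -/
def unitDensity {E : Type*} : E → ℝ → ℝ := fun _ _ => 1

/-- The total length `L(g)`. -/
noncomputable def totalLength {E : Type*} [Fintype E] (g : E → ℝ) : ℝ :=
  ∑ e, √(g e)

/-- The total mass `∫_{(G, g)} ρ dx_g`. -/
noncomputable def totalMass {E : Type*} [Fintype E] (g : E → ℝ) (ρ : E → ℝ → ℝ) : ℝ :=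
  ∑ e, √(g e) * ∫ x in (0 : ℝ)..1, ρ e x

/-- The normalised eigenvalue `λ_k(g) L(g)²`. -/
noncomputable def normalisedEigenvalue {V E : Type*} [Fintype E] (G : DiscreteGraph V E) (k : ℕ)
    (g : E → ℝ) : ℝ :=
  eigenvalue G k g unitDensity * totalLength g ^ 2

/-- The naturally normalised eigenvalue with density, `λ_k(g, ρ) L(g) ∫_{(G, g)} ρ dx_g`. -/
noncomputable def normalisedEigenvalueWithDensity {V E : Type*} [Fintype E]
    (G : DiscreteGraph V E) (k : ℕ) (g : E → ℝ) (ρ : E → ℝ → ℝ) : ℝ :=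
  eigenvalue G k g ρ * totalLength g * totalMass g ρ

/-- `φ(t) ≤ a + o(t)` as `t → 0`. -/
def LeUpToLittleO (φ : ℝ → ℝ) (a : ℝ) : Prop :=
  ∃ r : ℝ → ℝ, r =o[𝓝 0] (fun t : ℝ => t) ∧ ∀ᶠ t in 𝓝 (0 : ℝ), φ t ≤ a + r t

/-- `φ(t) ≥ a + o(t)` as `t → 0`. -/
def GeUpToLittleO (φ : ℝ → ℝ) (a : ℝ) : Prop :=
  ∃ r : ℝ → ℝ, r =o[𝓝 0] (fun t : ℝ => t) ∧ ∀ᶠ t in 𝓝 (0 : ℝ), a + r t ≤ φ t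

/-- `g(t)`, `|t| < δ`, is a smooth one-parameter family of metrics with `g(0) = g₀`. -/
structure IsSmoothMetricFamily {E : Type*} [Fintype E] (δ : ℝ) (g : ℝ → E → ℝ) (g₀ : E → ℝ) :
    Prop where
  pos : 0 < δ
  isMetric : ∀ t ∈ Set.Ioo (-δ) δ, IsMetric (g t)
  smooth : ContDiffOn ℝ ∞ g (Set.Ioo (-δ) δ)
  initial : g 0 = g₀

/-- `ρ(t)`, `|t| < δ`, is a smooth one-parameter family of positive densities with `ρ(0) = ρ₀`:
on each closed edge, `ρ(t)(x)` is smooth in `(t, x)`. No condition is imposed at the vertices. -/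
structure IsSmoothDensityFamily {E : Type*} (δ : ℝ) (ρ : ℝ → E → ℝ → ℝ) (ρ₀ : E → ℝ → ℝ) :
    Prop where
  pos : 0 < δ
  density_pos : ∀ t ∈ Set.Ioo (-δ) δ, ∀ e, ∀ x ∈ Set.Icc (0 : ℝ) 1, 0 < ρ t e x
  smooth : ∀ e, ContDiffOn ℝ ∞ (fun p : ℝ × ℝ => ρ p.1 e p.2)
    (Set.Ioo (-δ) δ ×ˢ Set.Icc (0 : ℝ) 1)
  initial : ∀ e, ∀ x ∈ Set.Icc (0 : ℝ) 1, ρ 0 e x = ρ₀ e x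

/-- The metric `g₀` is extremal for the functional `F` on metrics. -/
def IsExtremalMetric {E : Type*} [Fintype E] (F : (E → ℝ) → ℝ) (g₀ : E → ℝ) : Prop :=
  ∀ (δ : ℝ) (g : ℝ → E → ℝ), IsSmoothMetricFamily δ g g₀ →
    LeUpToLittleO (fun t => F (g t)) (F g₀) ∨ GeUpToLittleO (fun t => F (g t)) (F g₀)

/-- The pair `(g₀, ρ₀)` is extremal for the functional `F` on metrics and densities. -/
def IsExtremalPair {E : Type*} [Fintype E] (F : (E → ℝ) → (E → ℝ → ℝ) → ℝ) (g₀ : E → ℝ)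
    (ρ₀ : E → ℝ → ℝ) : Prop :=
  ∀ (δ : ℝ) (g : ℝ → E → ℝ) (ρ : ℝ → E → ℝ → ℝ),
    IsSmoothMetricFamily δ g g₀ → IsSmoothDensityFamily δ ρ ρ₀ →
    LeUpToLittleO (fun t => F (g t) (ρ t)) (F g₀ ρ₀) ∨
      GeUpToLittleO (fun t => F (g t) (ρ t)) (F g₀ ρ₀)

end QuantumGraph

/-! Write the eigenvalue problem weakly as `D f h = λ M f h` with `D = ∑ ∫ f' h' / √g` and `M = ∑ ∫
√g ρ f h`. To first order, the motion of a possibly multiple eigenvalue `λ = λ_k` is governed by the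
quadratic form `D' - λ M'` on its eigenspace. For an eigenfunction `y` the energy density `|y'|² + λ
y²` is constant along each edge, and the response of the Rayleigh quotient to a change of edge
lengths sees `y` only through these constants (`variation_apply`).

If no nonnegative combination of eigenfunctions had the same energy density on all edges, a
separating hyperplane would give a linear change of the lengths along which the normalised variation
is strictly positive on the whole eigenspace. The normalised eigenvalue would then increase through
`g` at a definite rate, contradicting extremality. Hence there are `c i ≥ 0` and eigenfunctions `y
i` with `∑ c i (|y i'|² + λ (y i)²) = 2 λ / L` on every edge (`exists_energyDensity_combination`,
`exists_combination_of_isExtremalMetric`).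

The identity `-(y²)'' = 4 λ y² - 2 (|y'|² + λ y²)` now shows that `∑ c i (y i)² - 1 / L` satisfies
the eigenvalue equation for `4 λ`, so it vanishes when `4 λ` is not an eigenvalue
(`sum_sq_eq_const`). This is exactly the condition that cancels the density part of the variation.
For every family of pairs the weighted first variations therefore add up to zero, so one is
nonpositive and another nonnegative.

A gap next to `λ_k` makes a single eigenfunction enough for a one-sided bound: with a gap below, any
eigenfunction serves as a test function for an upper bound, and with a gap above each one gives a
lower bound (`eigenvalue_le_of_lt`, `le_eigenvalue_of_lt` in `Pencil.IsPerturbation`). Using one of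
the two eigenfunctions for `t ≥ 0` and the other for `t ≤ 0` gives extremality. The only spectral
input is the gap property `Pencil.IsSpectral`, which follows from compactness of the Poisson
solution operator. -/

/-! ### Maximisers of the Rayleigh quotient of a compact-type operator. -/

open Filter in
/-- A bounded nonnegative symmetric operator on a real inner product space whose square is
sequentially compact attains the maximum of its Rayleigh quotient at an eigenvector. -/
theorem exists_eigenvector_isMaxRayleigh {H : Type*} [NormedAddCommGroup H]
    [InnerProductSpace ℝ H] (T : H →ₗ[ℝ] H) (symm : ∀ x y, inner ℝ (T x) y = inner ℝ x (T y))
    (nonneg : ∀ x, 0 ≤ inner ℝ (T x) x) (C : ℝ) (bound : ∀ x, ‖T x‖ ≤ C * ‖x‖)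
    (compact : ∀ f : ℕ → H, (∀ n, ‖f n‖ ≤ 1) →
      ∃ (h : H) (φ : ℕ → ℕ), StrictMono φ ∧ Tendsto (fun n => T (T (f (φ n)))) atTop (𝓝 h)) :
    (∀ x, inner ℝ (T x) x = 0) ∨
      ∃ μ > 0, (∃ z ≠ 0, T z = μ • z) ∧ ∀ x, inner ℝ (T x) x ≤ μ * ‖x‖ ^ 2 := by
  have hcont : Continuous T := AddMonoidHomClass.continuous_of_bound T C bound
  set S : Set ℝ := {r | ∃ x : H, ‖x‖ ≤ 1 ∧ inner ℝ (T x) x = r} with hS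
  have hne : S.Nonempty := ⟨0, 0, by simp, by simp⟩
  have hbdd : BddAbove S := by
    refine ⟨|C|, ?_⟩
    rintro _ ⟨x, hx, rfl⟩
    calc inner ℝ (T x) x ≤ ‖T x‖ * ‖x‖ := real_inner_le_norm _ _
      _ ≤ (|C| * 1) * 1 := by
          gcongr
          exact (bound x).trans (by gcongr; exact le_abs_self C)
      _ = |C| := by ring
  set μ := sSup S with hμ
  have hray : ∀ x, inner ℝ (T x) x ≤ μ * ‖x‖ ^ 2 := by
    intro x
    by_cases hx : x = 0
    · simp [hx]
    have hx' : 0 < ‖x‖ := norm_pos_iff.mpr hx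
    have : inner ℝ (T (‖x‖⁻¹ • x)) (‖x‖⁻¹ • x) ≤ μ :=
      le_csSup hbdd ⟨_, by rw [norm_smul, norm_inv, norm_norm, inv_mul_cancel₀ hx'.ne'], rfl⟩
    rw [map_smul, real_inner_smul_left, real_inner_smul_right] at this
    field_simp at this
    linarith
  have hμ0 : 0 ≤ μ := le_csSup hbdd ⟨0, by simp, by simp⟩
  rcases hμ0.eq_or_lt with h0 | hpos
  · left
    intro x
    have := hray x
    rw [← h0, zero_mul] at this
    exact le_antisymm this (nonneg x)
  right
  refine ⟨μ, hpos, ?_, hray⟩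
  -- Cauchy–Schwarz for the form `(T x, y)`, applied to `x` and `T x`: `‖T x‖⁴ ≤ (T x, x) (T (T x),
  -- T x) ≤ (T x, x) μ ‖T x‖²`.
  have hT2 : ∀ x, ‖T x‖ ^ 2 ≤ μ * inner ℝ (T x) x := by
    intro x
    by_cases hTx : T x = 0
    · rw [hTx]; simp
    have hTx' : 0 < ‖T x‖ ^ 2 := by positivity
    let B : LinearMap.BilinForm ℝ H := (innerₗ H).comp T
    have hB : ∀ x y, B x y = inner ℝ (T x) y := fun _ _ => rfl
    have hcs := B.apply_sq_le_of_symm nonneg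
      ⟨fun x y => by simp only [hB, RingHom.id_apply]; rw [symm, real_inner_comm]⟩ x (T x)
    rw [hB, hB, hB, real_inner_self_eq_norm_sq] at hcs
    have h2 := mul_le_mul_of_nonneg_left (hray (T x)) (nonneg x)
    nlinarith
  obtain ⟨u, -, hu, huS⟩ := exists_seq_tendsto_sSup hne hbdd
  choose f hf1 hf2 using huS
  obtain ⟨h, φ, hφ, hlim⟩ := compact f hf1
  have hμf : Tendsto (fun n => inner ℝ (T (f n)) (f n)) atTop (𝓝 μ) := by
    simpa only [hf2] using hu
  -- A maximising sequence consists of approximate eigenvectors, because `‖T f - μ f‖² ≤ μ² - μ (T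
  -- f, f)`.
  have hd : Tendsto (fun n => T (f n) - μ • f n) atTop (𝓝 0) := by
    rw [tendsto_zero_iff_norm_tendsto_zero]
    have hsq : Tendsto (fun n => ‖T (f n) - μ • f n‖ ^ 2) atTop (𝓝 0) := by
      have hup : Tendsto (fun n => μ ^ 2 - μ * inner ℝ (T (f n)) (f n)) atTop (𝓝 0) := by
        have := (tendsto_const_nhds (x := μ ^ 2)).sub (hμf.const_mul μ)
        simpa [pow_two] using this
      refine squeeze_zero (fun n => by positivity) (fun n => ?_) hup
      rw [norm_sub_sq_real, real_inner_smul_right, norm_smul, mul_pow, Real.norm_eq_abs, sq_abs]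
      have h1 := hT2 (f n)
      have h2 : ‖f n‖ ^ 2 ≤ 1 := pow_le_one₀ (norm_nonneg _) (hf1 n)
      nlinarith [sq_nonneg μ]
    have := hsq.sqrt
    simpa using this
  have hd2 : Tendsto (fun n => T (T (f n)) - (μ ^ 2) • f n) atTop (𝓝 0) := by
    have h1 : Tendsto (fun n => T (T (f n) - μ • f n)) atTop (𝓝 (T 0)) :=
      (hcont.tendsto 0).comp hd
    have := h1.add (hd.const_smul μ)
    rw [map_zero, smul_zero, add_zero] at this
    refine this.congr fun n => ?_
    rw [map_sub, map_smul, smul_sub, smul_smul, pow_two]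
    abel
  -- The space need not be complete. The limit of `f` is recovered from that of `T (T f)`, which
  -- differs from `μ² f` by a null sequence.
  have hfz : Tendsto (fun n => f (φ n)) atTop (𝓝 ((μ ^ 2)⁻¹ • h)) := by
    have := (hlim.sub (hd2.comp hφ.tendsto_atTop)).const_smul (μ ^ 2)⁻¹
    rw [sub_zero] at this
    refine this.congr fun n => ?_
    simp only [Function.comp_apply, sub_sub_cancel]
    rw [inv_smul_smul₀ (by positivity)]
  set z := (μ ^ 2)⁻¹ • h with hz
  have hTz : Tendsto (fun n => T (f (φ n))) atTop (𝓝 (T z)) := (hcont.tendsto z).comp hfz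
  have heq : T z - μ • z = 0 :=
    tendsto_nhds_unique (hTz.sub (hfz.const_smul μ)) (hd.comp hφ.tendsto_atTop)
  refine ⟨z, ?_, sub_eq_zero.mp heq⟩
  intro h0
  have h1 : Tendsto (fun n => inner ℝ (T (f (φ n))) (f (φ n))) atTop (𝓝 (inner ℝ (T z) z)) :=
    hTz.inner hfz
  have := tendsto_nhds_unique h1 (hμf.comp hφ.tendsto_atTop)
  rw [h0] at this
  simp at this
  exact hpos.ne this

/-! ### Pairs of quadratic forms and the spectral gap. -/

namespace Pencil

variable {X : Type*} [AddCommGroup X] [Module ℝ X]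

/-- The weak eigenspace of the pencil `D - μ M`. -/
def eigenspace (D M : LinearMap.BilinForm ℝ X) (μ : ℝ) : Submodule ℝ X := LinearMap.ker (D - μ • M)

theorem mem_eigenspace {D M : LinearMap.BilinForm ℝ X} {μ : ℝ} {x : X} :
    x ∈ eigenspace D M μ ↔ ∀ h, D x h = μ * M x h := by
  rw [eigenspace, LinearMap.mem_ker, LinearMap.sub_apply, sub_eq_zero, LinearMap.ext_iff]
  rfl

/-- The numbers `c` such that at least `k + 1` eigenvalues of the pencil are `≤ c`. -/
def levels (D M : LinearMap.BilinForm ℝ X) (k : ℕ) : Set ℝ :=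
  {c | ∃ x : Fin (k + 1) → X, LinearIndependent ℝ x ∧ ∀ i, ∃ μ ≤ c, x i ∈ eigenspace D M μ}

/-- The `k`-th eigenvalue of the pencil. -/
noncomputable def eigenvalue (D M : LinearMap.BilinForm ℝ X) (k : ℕ) : ℝ := sInf (levels D M k)

/-- The orthogonal complement of all eigenvectors with eigenvalue at most `c`. -/
def upperSpace (D M : LinearMap.BilinForm ℝ X) (c : ℝ) : Submodule ℝ X where
  carrier := {v | ∀ μ ≤ c, ∀ s ∈ eigenspace D M μ, M v s = 0}
  add_mem' ha hb μ hμ s hs := by simp [ha μ hμ s hs, hb μ hμ s hs]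
  zero_mem' := by simp
  smul_mem' a v hv μ hμ s hs := by simp [hv μ hμ s hs]

/-- Symmetric forms, `D` nonnegative and `M` positive, such that the Rayleigh quotient `D / M` has a
gap above `c` on the orthogonal complement of the eigenvectors with eigenvalue at most `c`. -/
structure IsSpectral (D M : LinearMap.BilinForm ℝ X) : Prop where
  symmD : ∀ x y, D x y = D y x
  symmM : ∀ x y, M x y = M y x
  nonneg : ∀ x, 0 ≤ D x x
  posM : ∀ x, x ≠ 0 → 0 < M x x
  gap : ∀ c, 0 ≤ c → ∃ γ > 0, ∀ v ∈ upperSpace D M c, (c + γ) * M v v ≤ D v v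

theorem sq_le {B : LinearMap.BilinForm ℝ X} (symm : ∀ x y, B x y = B y x)
    (nonneg : ∀ x, 0 ≤ B x x) (x y : X) : B x y ^ 2 ≤ B x x * B y y :=
  B.apply_sq_le_of_symm nonneg ⟨fun x y => by simpa using symm x y⟩ x y

open Filter in
/-- The spectral gap property follows from solvability of the Poisson problem, a Poincaré
inequality, and compactness of the twofold solution operator. -/
theorem IsSpectral.of_compact (D M : LinearMap.BilinForm ℝ X) (symmD : ∀ x y, D x y = D y x)
    (symmM : ∀ x y, M x y = M y x) (nonneg : ∀ x, 0 ≤ D x x) (posM : ∀ x, x ≠ 0 → 0 < M x x)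
    (one : X) (hone : one ≠ 0) (D_one : ∀ h, D one h = 0) (C : ℝ)
    (poincare : ∀ u, M u one = 0 → M u u ≤ C * D u u)
    (solve : ∀ f, M f one = 0 → ∃ u, ∀ h, D u h = M f h)
    (compact : ∀ (K : ℝ) (u v : ℕ → X), (∀ n, M (u n) one = 0) → (∀ n, M (v n) one = 0) →
      (∀ n, D (u n) (u n) ≤ K) → (∀ n h, D (v n) h = M (u n) h) →
      ∃ (w : X) (φ : ℕ → ℕ), StrictMono φ ∧
        Tendsto (fun n => M (v (φ n) - w) (v (φ n) - w)) atTop (𝓝 0)) :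
    IsSpectral D M := by
  refine ⟨symmD, symmM, nonneg, posM, fun c hc => ?_⟩
  set Z := upperSpace D M c with hZ
  have nonnegM : ∀ x, 0 ≤ M x x := fun x => by
    by_cases h : x = 0
    · simp [h]
    · exact (posM x h).le
  have h1pos := posM one hone
  -- `one` is an eigenvector for the eigenvalue `0 ≤ c`, so everything in `Z` has mean zero and the
  -- Poisson problem is solvable.
  have hZone : ∀ z ∈ Z, M z one = 0 := fun z hz =>
    hz 0 hc one (mem_eigenspace.2 fun h => by rw [D_one, zero_mul])
  have uniq : ∀ x, M x one = 0 → D x x ≤ 0 → x = 0 := by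
    intro x h1 h2
    by_contra hx
    have := posM x hx
    have h3 := poincare x h1
    have h4 : D x x = 0 := le_antisymm h2 (nonneg x)
    rw [h4, mul_zero] at h3
    linarith
  have solveZ : ∀ z : Z, ∃ u : Z, ∀ h, D u h = M z h := by
    rintro ⟨z, hz⟩
    obtain ⟨u, hu⟩ := solve z (hZone z hz)
    have hu' : ∀ h, D (u - (M u one / M one one) • one) h = M z h := fun h => by
      simp [hu, D_one]
    have hm : M (u - (M u one / M one one) • one) one = 0 := by
      simp [h1pos.ne']
    refine ⟨⟨u - (M u one / M one one) • one, ?_⟩, hu'⟩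
    set w := u - (M u one / M one one) • one
    intro μ hμ s hs
    have hse := mem_eigenspace.1 hs
    have hzs := hz μ hμ s hs
    -- The mean-zero solution stays in `Z`: if `μ ≠ 0` then `μ M w s = D w s = M z s = 0`, and for
    -- `μ = 0` the Poincaré inequality forces `s` to be a multiple of `one`.
    by_cases h0 : μ = 0
    · set s' := s - (M s one / M one one) • one with hs'
      have : s' = 0 := by
        apply uniq
        · simp [hs', h1pos.ne']
        · have : D s' s' = 0 := by
            simp [hs', D_one, hse, h0]
          exact this.le
      rw [sub_eq_zero.1 this]
      simp [hm]
    · have h1 : D w s = 0 := by rw [hu', hzs]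
      rw [symmD, hse, symmM] at h1
      exact (mul_eq_zero.1 h1).resolve_left h0
  have uniqZ : ∀ u v : Z, (∀ h, D u h = D v h) → u = v := by
    intro u v h
    have : (u - v : Z) = 0 := by
      apply Subtype.ext
      apply uniq
      · exact hZone _ (u - v).2
      · simp [h]
    exact sub_eq_zero.1 this
  choose T₀ hT₀ using solveZ
  let T : Z →ₗ[ℝ] Z :=
    { toFun := T₀
      map_add' := fun x y => uniqZ _ _ fun h => by simp [hT₀]
      map_smul' := fun a x => uniqZ _ _ fun h => by simp [hT₀] }
  have hT : ∀ (z : Z) h, D (T z) h = M z h := hT₀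
  let core : InnerProductSpace.Core ℝ Z :=
    { inner := fun x y => M x y
      conj_inner_symm := fun x y => by simpa using symmM y x
      re_inner_nonneg := fun x => by simpa using nonnegM x
      add_left := fun x y z => by simp
      smul_left := fun x y r => by simp
      definite := fun x hx => by
        by_contra h
        exact (posM x (by simpa using h)).ne' hx }
  let : NormedAddCommGroup Z := core.toNormedAddCommGroup
  let : InnerProductSpace ℝ Z := InnerProductSpace.ofCore core.toCore
  have hin : ∀ x y : Z, inner ℝ x y = M x y := fun _ _ => rfl
  have hnorm : ∀ x : Z, ‖x‖ ^ 2 = M x x := fun x => by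
    rw [← hin, real_inner_self_eq_norm_sq]
  have hDT : ∀ x : Z, D (T x) (T x) = M (T x) x := fun x => by rw [hT, symmM]
  have hTC : ∀ x : Z, M (T x) (T x) ≤ C * M (T x) x := fun x => by
    rw [← hDT]; exact poincare _ (hZone _ (T x).2)
  -- `M v v = D (T v) v`, so Cauchy–Schwarz for `D` converts an upper bound for the Rayleigh
  -- quotient of `T` into a lower bound for `D / M`.
  have hkey : ∀ v : Z, M v v * M v v ≤ M (T v) v * D v v := fun v => by
    rw [← hDT, ← hT v v, ← pow_two]
    exact sq_le symmD nonneg _ _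
  have hbd : ∀ x : Z, ‖T x‖ ≤ |C| * ‖x‖ := by
    intro x
    have h1 : ‖T x‖ ^ 2 ≤ C * inner ℝ (T x) x := by rw [hnorm, hin]; exact hTC x
    have h2 : inner ℝ (T x) x ≤ ‖T x‖ * ‖x‖ := real_inner_le_norm _ _
    have h3 : 0 ≤ inner ℝ (T x) x := by rw [hin, ← hDT]; exact nonneg _
    rcases (norm_nonneg (T x)).eq_or_lt with h0 | h0
    · rw [← h0]; positivity
    have h4 : ‖T x‖ ^ 2 ≤ |C| * (‖T x‖ * ‖x‖) := by
      refine h1.trans ((mul_le_mul_of_nonneg_right (le_abs_self C) h3).trans ?_)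
      gcongr
    nlinarith
  have hmax := exists_eigenvector_isMaxRayleigh T
    (fun x y => by rw [hin, hin, symmM, ← hT, symmD, hT]) (fun x => by rw [hin, ← hDT]; exact nonneg _)
    |C| hbd ?_
  · rcases hmax with h0 | ⟨μ, hμ, ⟨z, hz0, hz⟩, hmax⟩
    -- If the Rayleigh quotient of `T` vanishes, then `M` vanishes on `Z` and any `γ` will do.
    · refine ⟨1, one_pos, fun v hv => ?_⟩
      have h1 := hkey ⟨v, hv⟩
      have h2 := h0 ⟨v, hv⟩
      rw [hin] at h2
      rw [h2, zero_mul] at h1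
      have h3 : M v v = 0 := mul_self_eq_zero.1 (le_antisymm h1 (mul_self_nonneg _))
      rw [h3, mul_zero]
      exact nonneg v
    · have hzE : (z : X) ∈ eigenspace D M μ⁻¹ := by
        rw [mem_eigenspace]
        intro h
        have := hT z h
        rw [hz] at this
        simp at this
        rw [← this]
        field_simp
      -- Were `μ⁻¹ ≤ c`, the eigenvector `z ∈ Z` would be orthogonal to itself.
      have hlt : c < μ⁻¹ := by
        by_contra hle
        have := z.2 μ⁻¹ (not_lt.1 hle) z hzE
        exact (posM z (by simpa using hz0)).ne' this
      refine ⟨μ⁻¹ - c, sub_pos.2 hlt, fun v hv => ?_⟩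
      rw [add_sub_cancel]
      have h1 := hkey ⟨v, hv⟩
      have h2 := hmax ⟨v, hv⟩
      rw [hin, hnorm] at h2
      simp only at h1 h2
      rcases (nonnegM v).eq_or_lt with h3 | h3
      · rw [← h3, mul_zero]; exact nonneg v
      · have h4 := mul_le_mul_of_nonneg_right h2 (nonneg v)
        have h5 : M v v ≤ μ * D v v := by nlinarith
        rw [inv_mul_le_iff₀ hμ]
        exact h5
  · intro f hf
    have hf' : ∀ n, M (f n) (f n) ≤ 1 := fun n => by
      rw [← hnorm]; exact pow_le_one₀ (norm_nonneg _) (hf n)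
    -- The second application of `T` is needed because `compact` wants sources of bounded energy. An
    -- arbitrary bounded `f` has none, but `D (T f) (T f) = M (T f) f ≤ |C|`.
    obtain ⟨w, φ, hφ, hlim⟩ := compact |C| (fun n => T (f n)) (fun n => T (T (f n)))
      (fun n => hZone _ (T (f n)).2) (fun n => hZone _ (T (T (f n))).2)
      (fun n => by
        have h1 : M (T (f n)) (f n) ≤ ‖T (f n)‖ * ‖f n‖ := by
          rw [← hin]; exact real_inner_le_norm _ _
        rw [hDT]
        refine h1.trans ?_
        calc ‖T (f n)‖ * ‖f n‖ ≤ (|C| * 1) * 1 := by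
              gcongr
              · exact (hbd _).trans (by gcongr; exact hf n)
              · exact hf n
          _ = |C| := by ring) (fun n h => hT _ h)
    have hwZ : w ∈ Z := by
      intro μ hμ s hs
      have h1 : Tendsto (fun _ : ℕ => (M w s) ^ 2) atTop (𝓝 0) := by
        refine squeeze_zero (fun n => by positivity) (fun n => ?_)
          (by simpa using hlim.mul_const (M s s))
        have h2 : M (T (T (f (φ n)))) s = 0 := (T (T (f (φ n)))).2 μ hμ s hs
        have h3 := sq_le symmM nonnegM (T (T (f (φ n))) - w : X) s
        rw [map_sub, LinearMap.sub_apply, h2, zero_sub, neg_sq] at h3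
        simpa using h3
      have := tendsto_nhds_unique h1 tendsto_const_nhds
      exact pow_eq_zero_iff (two_ne_zero) |>.1 this.symm
    refine ⟨⟨w, hwZ⟩, φ, hφ, ?_⟩
    rw [tendsto_iff_norm_sub_tendsto_zero]
    have := hlim.sqrt
    rw [Real.sqrt_zero] at this
    refine this.congr fun n => ?_
    have h1 := hnorm (T (T (f (φ n))) - ⟨w, hwZ⟩)
    simp only [Submodule.coe_sub] at h1
    rw [← h1]
    exact Real.sqrt_sq (norm_nonneg _)

end Pencil

/-! ### Counting eigenvalues and the variational principle. -/

namespace Pencil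

variable {X : Type*} [AddCommGroup X] [Module ℝ X]

/-- The span of all eigenvectors with eigenvalue in `P`. -/
def lowerSpace (D M : LinearMap.BilinForm ℝ X) (P : Set ℝ) : Submodule ℝ X :=
  Submodule.span ℝ {x | ∃ μ ∈ P, x ∈ eigenspace D M μ}

theorem eigenspace_le_lowerSpace (D M : LinearMap.BilinForm ℝ X) {P : Set ℝ} {μ : ℝ} (hμ : μ ∈ P) :
    eigenspace D M μ ≤ lowerSpace D M P := fun _ hx => Submodule.subset_span ⟨μ, hμ, hx⟩

/-- A maximal independent set of eigenvectors either has `n + 1` members or spans with at most `n`.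
This trades eigenvalue counts for dimension bounds without listing the spectrum. -/
theorem exists_linearIndependent_or_finrank_le (D M : LinearMap.BilinForm ℝ X) (P : Set ℝ) (n : ℕ) :
    (∃ x : Fin (n + 1) → X, LinearIndependent ℝ x ∧ ∀ i, ∃ μ ∈ P, x i ∈ eigenspace D M μ) ∨
      (FiniteDimensional ℝ (lowerSpace D M P) ∧
        Module.finrank ℝ (lowerSpace D M P) ≤ n) := by
  obtain ⟨b, hbs, hspan, hli⟩ :=
    exists_linearIndependent ℝ {x : X | ∃ μ ∈ P, x ∈ eigenspace D M μ}
  by_cases h : Nonempty (Fin (n + 1) ↪ b)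
  · obtain ⟨f⟩ := h
    exact Or.inl ⟨fun i => f i, hli.comp f f.injective, fun i => hbs (f i).2⟩
  · right
    have hfin : Finite b := by
      by_contra hinf
      rw [not_finite_iff_infinite] at hinf
      exact h ⟨(Fin.valEmbedding).trans (Infinite.natEmbedding b)⟩
    have := Fintype.ofFinite b
    have hcard : Fintype.card b ≤ n := by
      by_contra hlt
      exact h (Function.Embedding.nonempty_of_card_le (by simpa using hlt))
    rw [lowerSpace, ← hspan]
    refine ⟨FiniteDimensional.span_of_finite ℝ b.toFinite, ?_⟩
    have := finrank_span_le_card (R := ℝ) b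
    rw [Set.toFinset_card] at this
    exact this.trans hcard

theorem levels_anti (D M : LinearMap.BilinForm ℝ X) (k : ℕ) :
    levels D M (k + 1) ⊆ levels D M k := by
  rintro c ⟨x, hx, h⟩
  exact ⟨fun i => x i.castSucc, hx.comp _ (Fin.castSucc_injective _), fun i => h _⟩

/-- Orthogonality to `S` imposes at most `n` linear conditions on `n + 1` coefficients. -/
theorem exists_ne_zero_orthogonal (M : LinearMap.BilinForm ℝ X) (S : Submodule ℝ X)
    [FiniteDimensional ℝ S] {n : ℕ} (hS : Module.finrank ℝ S ≤ n) (w : Fin (n + 1) → X) :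
    ∃ a : Fin (n + 1) → ℝ, a ≠ 0 ∧ ∀ s ∈ S, M (∑ i, a i • w i) s = 0 := by
  let L : (Fin (n + 1) → ℝ) →ₗ[ℝ] Module.Dual ℝ S :=
    (M.compl₂ S.subtype).comp (Fintype.linearCombination ℝ w)
  have hker : LinearMap.ker L ≠ ⊥ := by
    apply LinearMap.ker_ne_bot_of_finrank_lt
    rw [Subspace.dual_finrank_eq, Module.finrank_fin_fun]
    omega
  obtain ⟨a, ha, ha0⟩ := (Submodule.ne_bot_iff _).1 hker
  refine ⟨a, ha0, fun s hs => ?_⟩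
  have := LinearMap.congr_fun (LinearMap.mem_ker.1 ha) ⟨s, hs⟩
  simpa [L, Fintype.linearCombination_apply] using this

theorem lowerSpace_Iic_le_sup (D M : LinearMap.BilinForm ℝ X) (c : ℝ) :
    lowerSpace D M (Set.Iic c) ≤ lowerSpace D M (Set.Iio c) ⊔ eigenspace D M c := by
  refine Submodule.span_le.2 ?_
  rintro x ⟨μ, hμ, hx⟩
  rcases (Set.mem_Iic.1 hμ).eq_or_lt with rfl | h
  · exact Submodule.mem_sup_right hx
  · exact Submodule.mem_sup_left (eigenspace_le_lowerSpace D M (Set.mem_Iio.2 h) hx)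

theorem mem_upperSpace_iff {D M : LinearMap.BilinForm ℝ X} {c : ℝ} {v : X} :
    v ∈ upperSpace D M c ↔ ∀ s ∈ lowerSpace D M (Set.Iic c), M v s = 0 := by
  refine ⟨fun h s hsl => ?_, fun h μ hμ s hse => h s (eigenspace_le_lowerSpace D M (Set.mem_Iic.2 hμ) hse)⟩
  induction hsl using Submodule.span_induction with
  | mem x hx => obtain ⟨μ, hμ, hx⟩ := hx; exact h μ hμ x hx
  | zero => simp
  | add x y _ _ hx hy => simp [hx, hy]
  | smul a x _ hx => simp [hx]

namespace IsSpectral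

variable {D M : LinearMap.BilinForm ℝ X} (hs : IsSpectral D M)
include hs

theorem nonnegM (x : X) : 0 ≤ M x x := by
  by_cases h : x = 0
  · simp [h]
  · exact (hs.posM x h).le

theorem orthogonal {μ ν : ℝ} (h : μ ≠ ν) {x y : X} (hx : x ∈ eigenspace D M μ)
    (hy : y ∈ eigenspace D M ν) : M x y = 0 := by
  have h1 := mem_eigenspace.1 hx y
  have h2 := mem_eigenspace.1 hy x
  rw [hs.symmD, hs.symmM, h1] at h2
  have : (μ - ν) * M x y = 0 := by linarith [hs.symmM x y]
  exact (mul_eq_zero.1 this).resolve_left (sub_ne_zero.2 h)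

theorem nonneg_of_mem_eigenspace {μ : ℝ} {x : X} (hx : x ∈ eigenspace D M μ) (h0 : x ≠ 0) :
    0 ≤ μ := by
  have h1 := mem_eigenspace.1 hx x
  have h2 := hs.nonneg x
  have h3 := hs.posM x h0
  rw [h1] at h2
  exact nonneg_of_mul_nonneg_left h2 h3

/-- Scaling each eigenvector by `√(c - μ)` turns `c M - D` into a value of `M`: cross terms between
different eigenvalues vanish on both sides, and between equal ones the two roots multiply to `c -
μ`. No orthogonal basis is needed. -/
theorem rayleigh_le {P : Set ℝ} {c : ℝ} (hP : ∀ μ ∈ P, μ ≤ c) {w : X}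
    (hw : w ∈ lowerSpace D M P) : D w w ≤ c * M w w := by
  obtain ⟨n, a, g, rfl⟩ := Submodule.mem_span_set'.1 hw
  choose μ hμ hg using fun i => (g i).2
  have key : c * M (∑ i, a i • (g i : X)) (∑ i, a i • (g i : X))
      - D (∑ i, a i • (g i : X)) (∑ i, a i • (g i : X))
      = M (∑ i, (a i * √(c - μ i)) • (g i : X)) (∑ i, (a i * √(c - μ i)) • (g i : X)) := by
    simp only [map_sum, map_smul, LinearMap.sum_apply, LinearMap.smul_apply, smul_eq_mul,
      Finset.mul_sum, ← Finset.sum_sub_distrib]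
    refine Finset.sum_congr rfl fun i _ => Finset.sum_congr rfl fun j _ => ?_
    rw [mem_eigenspace.1 (hg _)]
    by_cases h : μ i = μ j
    · have := Real.mul_self_sqrt (sub_nonneg.2 (hP _ (hμ j)))
      rw [h]
      linear_combination (-a j * a i * M (g j) (g i)) * this
    · rw [hs.orthogonal (Ne.symm h) (hg _) (hg _)]; ring
  have := hs.nonnegM (∑ i, (a i * √(c - μ i)) • (g i : X))
  linarith

theorem bddBelow_levels (k : ℕ) : 0 ∈ lowerBounds (levels D M k) := by
  rintro c ⟨x, hx, h⟩
  obtain ⟨μ, hμ, hm⟩ := h 0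
  exact (hs.nonneg_of_mem_eigenspace hm (hx.ne_zero 0)).trans hμ

theorem eigenvalue_le {k : ℕ} {c : ℝ} (hc : c ∈ levels D M k) : eigenvalue D M k ≤ c :=
  csInf_le ⟨0, hs.bddBelow_levels k⟩ hc

theorem eigenvalue_nonneg (k : ℕ) : 0 ≤ eigenvalue D M k :=
  Real.sInf_nonneg (hs.bddBelow_levels k)

/-- The variational upper bound for the `k`-th eigenvalue. -/
theorem mem_levels_of_rayleigh_le {k : ℕ} {c : ℝ} (w : Fin (k + 1) → X)
    (hw : LinearIndependent ℝ w)
    (hc : ∀ a : Fin (k + 1) → ℝ, D (∑ i, a i • w i) (∑ i, a i • w i) ≤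
      c * M (∑ i, a i • w i) (∑ i, a i • w i)) : c ∈ levels D M k := by
  have hpos : ∀ a : Fin (k + 1) → ℝ, a ≠ 0 → 0 < M (∑ i, a i • w i) (∑ i, a i • w i) := by
    intro a ha
    apply hs.posM
    intro h0
    exact ha (funext (Fintype.linearIndependent_iff.1 hw a h0))
  have hc0 : 0 ≤ c := by
    have h1 := hpos 1 one_ne_zero
    exact nonneg_of_mul_nonneg_left ((hs.nonneg _).trans (hc 1)) h1
  rcases exists_linearIndependent_or_finrank_le D M (Set.Iic c) k with h | ⟨hfd, hfr⟩
  · exact h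
  · exfalso
    -- With fewer than `k + 1` eigenvalues up to `c`, some nonzero combination of the `w i` is
    -- orthogonal to all their eigenvectors, and the gap contradicts `hc`.
    obtain ⟨a, ha, horth⟩ := exists_ne_zero_orthogonal M (lowerSpace D M (Set.Iic c)) hfr w
    obtain ⟨γ, hγ, hgap⟩ := hs.gap c hc0
    have h1 := hgap (∑ i, a i • w i) fun μ hμ s hse =>
      horth s (eigenspace_le_lowerSpace D M (Set.mem_Iic.2 hμ) hse)
    have h2 := hc a
    have h3 := hpos a ha
    nlinarith

/-- The infimum is attained because there are no eigenvalues just above it: an eigenvector with `l <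
μ < l + γ` would lie in `upperSpace D M l` and violate the gap. Nonemptiness matters, as the infimum
of the empty set is `0` by convention. -/
theorem eigenvalue_mem_levels {k : ℕ} (hne : (levels D M k).Nonempty) :
    eigenvalue D M k ∈ levels D M k := by
  set l := eigenvalue D M k with hl
  obtain ⟨γ, hγ, hgap⟩ := hs.gap l (hs.eigenvalue_nonneg k)
  obtain ⟨c, ⟨x, hx, h⟩, hc⟩ := exists_lt_of_csInf_lt hne (lt_add_of_pos_right l hγ)
  refine ⟨x, hx, fun i => ?_⟩
  obtain ⟨μ, hμ, hm⟩ := h i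
  refine ⟨μ, ?_, hm⟩
  by_contra hlt
  have h1 := hgap (x i) fun ν hν s hse => hs.orthogonal (by rintro rfl; exact hlt hν) hm hse
  rw [mem_eigenspace.1 hm] at h1
  have h2 := hs.posM _ (hx.ne_zero i)
  nlinarith

/-- Given `k + 1` independent eigenvectors with eigenvalues below `λ_k`, the largest of these
eigenvalues would be a level smaller than `λ_k`. -/
theorem finrank_lowerSpace_Iio_le (k : ℕ) :
    FiniteDimensional ℝ (lowerSpace D M (Set.Iio (eigenvalue D M k))) ∧
      Module.finrank ℝ (lowerSpace D M (Set.Iio (eigenvalue D M k))) ≤ k := by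
  refine (exists_linearIndependent_or_finrank_le D M _ k).resolve_left ?_
  rintro ⟨x, hx, h⟩
  choose μ hμ hm using h
  obtain ⟨j, hj⟩ := Finite.exists_max μ
  have := hs.eigenvalue_le (k := k) (c := μ j) ⟨x, hx, fun i => ⟨μ i, hj i, hm i⟩⟩
  exact absurd (hμ j) (not_lt.2 this)

/-- Positivity makes the Gram map from `S` to its dual injective, hence bijective by dimension;
completeness plays no role. -/
theorem exists_projection (S : Submodule ℝ X) [FiniteDimensional ℝ S] (w : X) :
    ∃ p ∈ S, ∀ s ∈ S, M (w - p) s = 0 := by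
  let L : S →ₗ[ℝ] Module.Dual ℝ S := (M.compl₂ S.subtype).comp S.subtype
  have hinj : Function.Injective L := by
    rw [← LinearMap.ker_eq_bot, Submodule.eq_bot_iff]
    intro s hsk
    have h1 : M s s = 0 := LinearMap.congr_fun (LinearMap.mem_ker.1 hsk) s
    by_contra h
    exact (hs.posM s (by simpa using h)).ne' h1
  have hsurj : Function.Surjective L :=
    (LinearMap.injective_iff_surjective_of_finrank_eq_finrank
      (Subspace.dual_finrank_eq (K := ℝ) (V := S)).symm).1 hinj
  obtain ⟨p, hp⟩ := hsurj ((M w).comp S.subtype)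
  refine ⟨p, p.2, fun s hsS => ?_⟩
  have : M p s = M w s := LinearMap.congr_fun hp ⟨s, hsS⟩
  rw [map_sub, LinearMap.sub_apply, this, sub_self]

theorem orthogonal_lowerSpace_Iio {c : ℝ} {s y : X} (hsl : s ∈ lowerSpace D M (Set.Iio c))
    (hy : y ∈ eigenspace D M c) : M y s = 0 := by
  induction hsl using Submodule.span_induction with
  | mem x hx => obtain ⟨μ, hμ, hx⟩ := hx; exact hs.orthogonal (ne_of_gt hμ) hy hx
  | zero => simp
  | add x y _ _ hx hy => simp [hx, hy]
  | smul a x _ hx => simp [hx]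

theorem eq_zero_of_self {x : X} (h : M x x = 0) : x = 0 := by
  by_contra h0
  exact (hs.posM x h0).ne' h

/-- The projection of `w` onto all eigenvectors up to `c` has no component below `c`. This serves
lower bounds that test the whole eigenspace. -/
theorem decompose_eigenspace {c : ℝ} [FiniteDimensional ℝ (lowerSpace D M (Set.Iio c))]
    [FiniteDimensional ℝ (eigenspace D M c)] {w : X}
    (hw : ∀ n ∈ lowerSpace D M (Set.Iio c), M w n = 0) :
    ∃ y ∈ eigenspace D M c, w - y ∈ upperSpace D M c := by
  obtain ⟨p, hp, hpo⟩ := hs.exists_projection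
    (lowerSpace D M (Set.Iio c) ⊔ eigenspace D M c) w
  obtain ⟨n, hn, y, hy, rfl⟩ := Submodule.mem_sup.1 hp
  have h1 := hpo n (Submodule.mem_sup_left hn)
  rw [map_sub, LinearMap.sub_apply, hw n hn, map_add, LinearMap.add_apply,
    hs.orthogonal_lowerSpace_Iio hn hy] at h1
  have h2 : n = 0 := hs.eq_zero_of_self (by linarith)
  rw [h2, zero_add] at hpo
  exact ⟨y, hy, mem_upperSpace_iff.2 fun s hsl => hpo s (lowerSpace_Iic_le_sup D M c hsl)⟩

/-- Here a single vector `y` replaces the eigenspace: the part `s` of the projection orthogonal to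
`y` satisfies `M s s = M w s = 0`. It is what makes one eigenfunction sufficient when there is a gap
above. -/
theorem decompose_of_orthogonal {c : ℝ} [FiniteDimensional ℝ (lowerSpace D M (Set.Iic c))]
    {y w : X} (hy : y ∈ lowerSpace D M (Set.Iic c)) (hy0 : y ≠ 0)
    (hw : ∀ n ∈ lowerSpace D M (Set.Iic c), M y n = 0 → M w n = 0) :
    ∃ x ∈ Submodule.span ℝ {y}, w - x ∈ upperSpace D M c := by
  obtain ⟨p, hp, hpo⟩ := hs.exists_projection (lowerSpace D M (Set.Iic c)) w
  have hpos := hs.posM y hy0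
  obtain ⟨s, hsdef⟩ : ∃ s, s = p - (M p y / M y y) • y := ⟨_, rfl⟩
  have hsl : s ∈ lowerSpace D M (Set.Iic c) := hsdef ▸ Submodule.sub_mem _ hp (Submodule.smul_mem _ _ hy)
  have hys : M y s = 0 := by
    simp only [hsdef, map_sub, map_smul, smul_eq_mul]
    rw [hs.symmM y p]
    field_simp
    ring
  have h1 := hpo s hsl
  rw [map_sub, LinearMap.sub_apply, hw s hsl hys] at h1
  have h2 : M s s = 0 := by
    have : M s s = M p s - (M p y / M y y) * M y s := by
      have : M s s = M (p - (M p y / M y y) • y) s := by rw [← hsdef]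
      rw [this]
      simp only [map_sub, map_smul, LinearMap.sub_apply, LinearMap.smul_apply, smul_eq_mul]
    rw [this, hys]; linarith
  have h3 := hs.eq_zero_of_self h2
  rw [hsdef, sub_eq_zero] at h3
  refine ⟨p, ?_, mem_upperSpace_iff.2 hpo⟩
  rw [h3]
  exact Submodule.smul_mem _ _ (Submodule.mem_span_singleton_self y)

end IsSpectral

end Pencil

/-! ### First-order perturbation of eigenvalues. -/

namespace Pencil

variable {X : Type*} [AddCommGroup X] [Module ℝ X]

theorem apply_add_self {B : LinearMap.BilinForm ℝ X} (symm : ∀ x y, B x y = B y x) (x y : X) :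
    B (x + y) (x + y) = B x x + 2 * B x y + B y y := by
  simp only [map_add, LinearMap.add_apply, symm y x]
  ring

/-- A quadratic bound for a symmetric form controls its cross terms. -/
theorem cross_le {B N : LinearMap.BilinForm ℝ X} (symmB : ∀ x y, B x y = B y x)
    (symmN : ∀ x y, N x y = N y x) {C : ℝ} (bound : ∀ x, |B x x| ≤ C * N x x) {η : ℝ} (hη : 0 < η)
    (x y : X) : |2 * B x y| ≤ C * (η * N x x + η⁻¹ * N y y) := by
  -- Polarisation: the difference of the bounds at `η x + y` and `η x - y` leaves only the cross
  -- term.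
  have h1 := bound (η • x + y)
  have h2 := bound (η • x + -y)
  rw [apply_add_self symmB, apply_add_self symmN] at h1 h2
  simp only [map_smul, map_neg, LinearMap.smul_apply, LinearMap.neg_apply, smul_eq_mul] at h1 h2
  rw [abs_le] at h1 h2 ⊢
  have h3 : η * (C * (η * N x x + η⁻¹ * N y y)) = C * (η * (η * N x x) + N y y) := by
    field_simp
  constructor
  · refine le_of_mul_le_mul_left ?_ hη
    rw [mul_neg, h3]
    nlinarith
  · refine le_of_mul_le_mul_left ?_ hη
    rw [h3]
    nlinarith

/-- A first-order perturbation of a form stays almost nonpositive where the unperturbed form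
vanishes with nonpositive derivative, up to a part on which the form is strictly negative. -/
theorem eventually_le_of_first_order {B B' N : LinearMap.BilinForm ℝ X} (F : ℝ → X → ℝ)
    (symmB : ∀ x y, B x y = B y x) (symmB' : ∀ x y, B' x y = B' y x)
    (symmN : ∀ x y, N x y = N y x) (nonneg : ∀ x, 0 ≤ N x x) {C : ℝ}
    (bound : ∀ x, |B' x x| ≤ C * N x x)
    (expand : ∀ ε > 0, ∀ᶠ t in 𝓝 (0 : ℝ), ∀ x, F t x ≤ B x x + t * B' x x + ε * |t| * N x x)
    {γ ε : ℝ} (hγ : 0 < γ) (hε : 0 < ε) :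
    ∀ᶠ t in 𝓝 (0 : ℝ), ∀ y u, B y y = 0 → B y u = 0 → N y u = 0 → B u u ≤ -γ * N u u →
      t * B' y y ≤ 0 → F t (y + u) ≤ ε * |t| * N (y + u) (y + u) := by
  set K := |C| + 1 with hK
  have hKpos : 0 < K := by positivity
  have hboundK : ∀ x, |B' x x| ≤ K * N x x := fun x =>
    (bound x).trans (mul_le_mul_of_nonneg_right ((le_abs_self C).trans (by linarith)) (nonneg x))
  -- Then `K η = ε / 2`, so the cross term costs the other half of `ε` on `y`. Its large share `K /
  -- η` on `u` carries a factor `|t|` and is absorbed by `-γ N u u`.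
  set η := ε / (2 * K) with hη
  have hηpos : 0 < η := by positivity
  have hsmall : ∀ᶠ t in 𝓝 (0 : ℝ), |t| * (K * η⁻¹ + K) < γ := by
    have : Filter.Tendsto (fun t : ℝ => |t| * (K * η⁻¹ + K)) (𝓝 0) (𝓝 (|0| * (K * η⁻¹ + K))) :=
      (continuous_abs.tendsto 0).mul_const _
    rw [abs_zero, zero_mul] at this
    exact this.eventually_lt_const hγ
  filter_upwards [expand (ε / 2) (half_pos hε), hsmall] with t ht hts y u h1 h2 h3 h4 h5
  have h6 := ht (y + u)
  rw [apply_add_self symmB, apply_add_self symmB', apply_add_self symmN, h1, h2, h3] at h6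
  rw [apply_add_self symmN, h3]
  have hNy := nonneg y
  have hNu := nonneg u
  have h7 : t * (2 * B' y u) ≤ |t| * (K * (η * N y y + η⁻¹ * N u u)) :=
    (le_abs_self _).trans (by
      rw [abs_mul]
      exact mul_le_mul_of_nonneg_left (cross_le symmB' symmN hboundK hηpos y u) (abs_nonneg t))
  have h8 : t * B' u u ≤ |t| * (K * N u u) :=
    (le_abs_self _).trans (by
      rw [abs_mul]; exact mul_le_mul_of_nonneg_left (hboundK u) (abs_nonneg t))
  have h9 : K * η = ε / 2 := by rw [hη]; field_simp
  have h10 : |t| * (K * η⁻¹ + K) * N u u ≤ γ * N u u :=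
    mul_le_mul_of_nonneg_right hts.le hNu
  have h11 : |t| * (K * (η * N y y + η⁻¹ * N u u)) =
      |t| * (ε / 2) * N y y + |t| * (K * η⁻¹) * N u u := by
    rw [← h9]; ring
  have h12 : 0 ≤ |t| * ε * N u u := by positivity
  nlinarith

/-- Families of forms `Dt`, `Mt` through `D`, `M` with first-order derivatives `D'`, `M'` at `0`,
the remainders being uniformly small relative to `D` and `M`. -/
structure IsPerturbation (D M D' M' : LinearMap.BilinForm ℝ X)
    (Dt Mt : ℝ → LinearMap.BilinForm ℝ X) : Prop where
  symmD' : ∀ x y, D' x y = D' y x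
  symmM' : ∀ x y, M' x y = M' y x
  boundD' : ∃ C, ∀ x, |D' x x| ≤ C * D x x
  boundM' : ∃ C, ∀ x, |M' x x| ≤ C * M x x
  expandD : ∀ ε > 0, ∀ᶠ t in 𝓝 (0 : ℝ), ∀ x,
    |Dt t x x - D x x - t * D' x x| ≤ ε * |t| * D x x
  expandM : ∀ ε > 0, ∀ᶠ t in 𝓝 (0 : ℝ), ∀ x,
    |Mt t x x - M x x - t * M' x x| ≤ ε * |t| * M x x
  spectral : ∀ᶠ t in 𝓝 (0 : ℝ), IsSpectral (Dt t) (Mt t)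

theorem eventually_comparable {B B' : LinearMap.BilinForm ℝ X} {Bt : ℝ → LinearMap.BilinForm ℝ X}
    (nonneg : ∀ x, 0 ≤ B x x) (bound : ∃ C, ∀ x, |B' x x| ≤ C * B x x)
    (expand : ∀ ε > 0, ∀ᶠ t in 𝓝 (0 : ℝ), ∀ x,
      |Bt t x x - B x x - t * B' x x| ≤ ε * |t| * B x x) :
    ∀ᶠ t in 𝓝 (0 : ℝ), ∀ x, B x x ≤ 2 * Bt t x x ∧ Bt t x x ≤ 2 * B x x := by
  obtain ⟨C, hC⟩ := bound
  have hsmall : ∀ᶠ t in 𝓝 (0 : ℝ), |t| * (|C| + 1) < 1 / 2 := by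
    have : Filter.Tendsto (fun t : ℝ => |t| * (|C| + 1)) (𝓝 0) (𝓝 (|0| * (|C| + 1))) :=
      (continuous_abs.tendsto 0).mul_const _
    rw [abs_zero, zero_mul] at this
    exact this.eventually_lt_const (by norm_num)
  filter_upwards [expand 1 one_pos, hsmall] with t ht hts x
  have h1 := abs_le.1 (ht x)
  have hB := nonneg x
  have h2 : |t * B' x x| ≤ |t| * (|C| * B x x) := by
    rw [abs_mul]
    exact mul_le_mul_of_nonneg_left
      ((hC x).trans (mul_le_mul_of_nonneg_right (le_abs_self C) hB)) (abs_nonneg t)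
  have h3 := abs_le.1 h2
  have h4 : |t| * (|C| + 1) * B x x ≤ 1 / 2 * B x x := mul_le_mul_of_nonneg_right hts.le hB
  constructor <;> nlinarith

namespace IsPerturbation

variable {D M D' M' : LinearMap.BilinForm ℝ X} {Dt Mt : ℝ → LinearMap.BilinForm ℝ X}

/-- Product rule for `D_t - c(t) M_t`. Here `c` is a comparison curve through the eigenvalue, and
the sign of this form decides on which side of `c` the perturbed eigenvalue lies. -/
theorem expand_sub (hp : IsPerturbation D M D' M' Dt Mt) (hs : IsSpectral D M) {c : ℝ → ℝ}
    {c' : ℝ} (hc : HasDerivAt c c' 0) :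
    (∃ C, ∀ x, |(D' - c 0 • M' - c' • M) x x| ≤ C * (D + M) x x) ∧
    ∀ ε > 0, ∀ᶠ t in 𝓝 (0 : ℝ), ∀ x,
      |Dt t x x - c t * Mt t x x - ((D - c 0 • M) x x + t * (D' - c 0 • M' - c' • M) x x)| ≤
        ε * |t| * (D + M) x x := by
  obtain ⟨C₁, h₁⟩ := hp.boundD'
  obtain ⟨C₂, h₂⟩ := hp.boundM'
  have hD := hs.nonneg
  have hM := hs.nonnegM
  simp only [LinearMap.sub_apply, LinearMap.smul_apply, LinearMap.add_apply, smul_eq_mul]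
  constructor
  · refine ⟨|C₁| + |c 0| * |C₂| + |c'|, fun x => ?_⟩
    have e1 : |D' x x| ≤ |C₁| * D x x :=
      (h₁ x).trans (mul_le_mul_of_nonneg_right (le_abs_self _) (hD x))
    have e2 : |c 0 * M' x x| ≤ |c 0| * (|C₂| * M x x) := by
      rw [abs_mul]
      exact mul_le_mul_of_nonneg_left
        ((h₂ x).trans (mul_le_mul_of_nonneg_right (le_abs_self _) (hM x))) (abs_nonneg _)
    have e3 : |c' * M x x| ≤ |c'| * M x x := by rw [abs_mul, abs_of_nonneg (hM x)]
    have e4 := abs_sub (D' x x - c 0 * M' x x) (c' * M x x)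
    have e5 := abs_sub (D' x x) (c 0 * M' x x)
    have p1 : 0 ≤ |C₁| * M x x := mul_nonneg (abs_nonneg _) (hM x)
    have p2 : 0 ≤ (|c 0| * |C₂|) * D x x := mul_nonneg (by positivity) (hD x)
    have p3 : 0 ≤ |c'| * D x x := mul_nonneg (abs_nonneg _) (hD x)
    nlinarith
  · intro ε hε
    -- `K` dominates the sum of the coefficients of the four error terms `e1`–`e4`, each of which is
    -- controlled with `δ = ε / K`.
    set K := 2 * |c 0| + |c'| + 3 + |C₂| with hK
    have hKpos : 0 < K := by positivity
    set δ := ε / K with hδ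
    have hδpos : 0 < δ := by positivity
    have hδK : δ * K = ε := by rw [hδ]; field_simp
    have hc1 : ∀ᶠ t in 𝓝 (0 : ℝ), |c t - c 0 - t * c'| ≤ δ * |t| := by
      have := (hasDerivAt_iff_isLittleO.1 hc).def hδpos
      filter_upwards [this] with t ht
      simpa using ht
    have hc2 : ∀ᶠ t in 𝓝 (0 : ℝ), |c t - c 0| < min δ 1 := by
      have := hc.continuousAt.tendsto.sub_const (c 0)
      rw [sub_self] at this
      have := this.abs
      rw [abs_zero] at this
      exact this.eventually_lt_const (lt_min hδpos one_pos)
    filter_upwards [hp.expandD δ hδpos, hp.expandM δ hδpos, hc1, hc2] with t tD tM tc tc2 x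
    have hDx := hD x
    have hMx := hM x
    have e1 := tD x
    have e2 : |c t * (Mt t x x - M x x - t * M' x x)| ≤ (|c 0| + 1) * (δ * |t| * M x x) := by
      rw [abs_mul]
      have : |c t| ≤ |c 0| + 1 := by
        have h := abs_add_le (c t - c 0) (c 0)
        rw [sub_add_cancel] at h
        linarith [min_le_right δ 1]
      exact mul_le_mul this (tM x) (abs_nonneg _) (by positivity)
    have e3 : |(c t - c 0 - t * c') * M x x| ≤ δ * |t| * M x x := by
      rw [abs_mul, abs_of_nonneg hMx]
      exact mul_le_mul_of_nonneg_right tc hMx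
    have e4 : |t * (c t - c 0) * M' x x| ≤ |t| * δ * (|C₂| * M x x) := by
      rw [abs_mul, abs_mul]
      refine mul_le_mul (mul_le_mul_of_nonneg_left (tc2.le.trans (min_le_left _ _)) (abs_nonneg _))
        ((h₂ x).trans (mul_le_mul_of_nonneg_right (le_abs_self _) hMx)) (abs_nonneg _)
        (by positivity)
    have key : Dt t x x - c t * Mt t x x -
        (D x x - c 0 * M x x + t * (D' x x - c 0 * M' x x - c' * M x x)) =
        (Dt t x x - D x x - t * D' x x) - c t * (Mt t x x - M x x - t * M' x x)
        - (c t - c 0 - t * c') * M x x - t * (c t - c 0) * M' x x := by ring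
    rw [key]
    have f1 := abs_sub ((Dt t x x - D x x - t * D' x x) - c t * (Mt t x x - M x x - t * M' x x)
        - (c t - c 0 - t * c') * M x x) (t * (c t - c 0) * M' x x)
    have f2 := abs_sub ((Dt t x x - D x x - t * D' x x) - c t * (Mt t x x - M x x - t * M' x x))
        ((c t - c 0 - t * c') * M x x)
    have f3 := abs_sub (Dt t x x - D x x - t * D' x x) (c t * (Mt t x x - M x x - t * M' x x))
    have g1 : ε * |t| * (D x x + M x x) = (δ * |t|) * K * D x x + (δ * |t|) * K * M x x := by
      rw [← hδK]; ring
    have p1 : 0 ≤ (δ * |t|) * (2 * |c 0| + |c'| + 2 + |C₂|) * D x x := by positivity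
    have p2 : 0 ≤ (δ * |t|) * (|c 0| + |c'| + 1) * M x x := by positivity
    have g2 : (δ * |t|) * K * D x x = δ * |t| * D x x +
      (δ * |t|) * (2 * |c 0| + |c'| + 2 + |C₂|) * D x x := by rw [hK]; ring
    have g3 : (δ * |t|) * K * M x x = (|c 0| + 1) * (δ * |t| * M x x) + δ * |t| * M x x
      + |t| * δ * (|C₂| * M x x) + (δ * |t|) * (|c 0| + |c'| + 1) * M x x := by rw [hK]; ring
    linarith

theorem symm_deriv (hp : IsPerturbation D M D' M' Dt Mt) (hs : IsSpectral D M) (a b : ℝ) (x y : X) :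
    (D' - a • M' - b • M) x y = (D' - a • M' - b • M) y x := by
  simp only [LinearMap.sub_apply, LinearMap.smul_apply, smul_eq_mul]
  rw [hp.symmD', hp.symmM', hs.symmM]

theorem symm_add (hs : IsSpectral D M) (x y : X) : (D + M) x y = (D + M) y x := by
  rw [LinearMap.add_apply, LinearMap.add_apply, LinearMap.add_apply, LinearMap.add_apply, hs.symmD,
    hs.symmM]

theorem nonneg_add (hs : IsSpectral D M) (x : X) : 0 ≤ (D + M) x x := by
  rw [LinearMap.add_apply, LinearMap.add_apply]
  exact add_nonneg (hs.nonneg x) (hs.nonnegM x)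

/-- First-order upper bound for a perturbed eigenvalue. -/
theorem eigenvalue_le (hp : IsPerturbation D M D' M' Dt Mt) (hs : IsSpectral D M) {c : ℝ → ℝ}
    {c' l : ℝ} (hc : HasDerivAt c c' 0) (hcl : c 0 = l) (hl : 0 ≤ l) {k : ℕ} (z : Fin (k + 1) → X)
    (hz : LinearIndependent ℝ z) (μ : Fin (k + 1) → ℝ) (hμ : ∀ i, z i ∈ eigenspace D M (μ i))
    (hμl : ∀ i, μ i ≤ l) {ε : ℝ} (hε : 0 < ε) :
    ∀ᶠ t in 𝓝 (0 : ℝ), (∀ y ∈ Submodule.span ℝ (z '' {i | μ i = l}),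
      t * (D' - l • M' - c' • M) y y ≤ 0) → eigenvalue (Dt t) (Mt t) k ≤ c t + ε * |t| := by
  obtain ⟨⟨C, hC⟩, hexp⟩ := hp.expand_sub hs hc
  rw [hcl] at hC hexp
  -- `l'` is the largest `μ i` below `l`. The entry `l - 1` only keeps the set nonempty when there
  -- are none.
  obtain ⟨l', hl', hμl'⟩ : ∃ l' < l, ∀ i, μ i < l → μ i ≤ l' := by
    have hne : (insert (l - 1) ((Finset.univ.filter fun i => μ i < l).image μ)).Nonempty :=
      Finset.insert_nonempty _ _
    refine ⟨Finset.max' _ hne, ?_, fun i hi => Finset.le_max' _ _ (Finset.mem_insert_of_mem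
      (Finset.mem_image_of_mem μ (Finset.mem_filter.2 ⟨Finset.mem_univ i, hi⟩)))⟩
    rw [Finset.max'_lt_iff]
    intro y hy
    simp only [Finset.mem_insert, Finset.mem_image, Finset.mem_filter, Finset.mem_univ,
      true_and] at hy
    rcases hy with rfl | ⟨i, hi, rfl⟩
    · linarith
    · exact hi
  -- The gap `l - l'` is relative to `M`; dividing by `1 + l` makes it relative to `D + M`, since `D
  -- ≤ l M` on the span of the `z i`. The `2` in the next constant comes from `M ≤ 2 M_t`.
  have hγ : 0 < (l - l') / (1 + l) := div_pos (by linarith) (by linarith)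
  have hε' : 0 < ε / (2 * (1 + l)) := by positivity
  have symmB : ∀ x y, (D - l • M) x y = (D - l • M) y x := fun x y => by
    simp only [LinearMap.sub_apply, LinearMap.smul_apply, smul_eq_mul]
    rw [hs.symmD, hs.symmM]
  have main := eventually_le_of_first_order (B := D - l • M) (B' := D' - l • M' - c' • M)
    (N := D + M) (fun t x => Dt t x x - c t * Mt t x x) symmB (hp.symm_deriv hs l c')
    (symm_add hs) (nonneg_add hs) hC
    (fun δ hδ => (hexp δ hδ).mono fun t ht x => by linarith [(abs_le.1 (ht x)).2]) hγ hε'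
  filter_upwards [main, hp.spectral, eventually_comparable hs.nonnegM hp.boundM' hp.expandM]
    with t ht hst hcomp hder
  refine hst.eigenvalue_le (hst.mem_levels_of_rayleigh_le z hz fun a => ?_)
  set y := ∑ i with μ i = l, a i • z i with hy
  set u := ∑ i with ¬ μ i = l, a i • z i with hu
  have hsum : ∑ i, a i • z i = y + u := (Finset.sum_filter_add_sum_filter_not _ _ _).symm
  have hyE : y ∈ eigenspace D M l :=
    Submodule.sum_mem _ fun i hi => Submodule.smul_mem _ _ ((Finset.mem_filter.1 hi).2 ▸ hμ i)
  have huS : u ∈ lowerSpace D M (Set.Iio l ∩ Set.Iic l') :=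
    Submodule.sum_mem _ fun i hi => Submodule.smul_mem _ _ (Submodule.subset_span
      ⟨μ i, ⟨lt_of_le_of_ne (hμl i) (Finset.mem_filter.1 hi).2,
        hμl' i (lt_of_le_of_ne (hμl i) (Finset.mem_filter.1 hi).2)⟩, hμ i⟩)
  have huR := hs.rayleigh_le (fun ν hν => hν.2) huS
  have huL : u ∈ lowerSpace D M (Set.Iio l) := by
    refine Submodule.span_mono ?_ huS
    rintro x ⟨ν, hν, hx⟩
    exact ⟨ν, hν.1, hx⟩
  have hMyu := hs.orthogonal_lowerSpace_Iio huL hyE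
  have hE := mem_eigenspace.1 hyE
  have hMy := hs.nonnegM y
  have hMu := hs.nonnegM u
  have hDu := hs.nonneg u
  have h1 := ht y u (by simp [hE]) (by simp [hE]) (by simp [hE, hMyu])
    (by
      simp only [LinearMap.sub_apply, LinearMap.smul_apply, LinearMap.add_apply, smul_eq_mul]
      have h2 : D u u + M u u ≤ (1 + l) * M u u := by nlinarith
      have h3 : (l - l') / (1 + l) * (D u u + M u u) ≤ (l - l') * M u u := by
        calc _ ≤ (l - l') / (1 + l) * ((1 + l) * M u u) := mul_le_mul_of_nonneg_left h2 hγ.le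
          _ = _ := by field_simp
      linarith)
    (hder y (Submodule.sum_mem _ fun i hi => Submodule.smul_mem _ _
      (Submodule.subset_span ⟨i, (Finset.mem_filter.1 hi).2, rfl⟩)))
  rw [hsum]
  have h4 : (D + M) (y + u) (y + u) ≤ (1 + l) * M (y + u) (y + u) := by
    rw [apply_add_self (symm_add hs), apply_add_self hs.symmM]
    simp only [LinearMap.add_apply, hE, hMyu]
    nlinarith
  have h5 := (hcomp (y + u)).1
  have h6 : ε / (2 * (1 + l)) * |t| * (D + M) (y + u) (y + u) ≤ ε * |t| * Mt t (y + u) (y + u) := by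
    calc _ ≤ ε / (2 * (1 + l)) * |t| * ((1 + l) * (2 * Mt t (y + u) (y + u))) := by
          refine mul_le_mul_of_nonneg_left (h4.trans ?_) (by positivity)
          exact mul_le_mul_of_nonneg_left h5 (by linarith)
      _ = _ := by field_simp
  linarith

theorem eventually_levels_nonempty (hp : IsPerturbation D M D' M' Dt Mt) (hs : IsSpectral D M)
    {k : ℕ} (hne : (levels D M k).Nonempty) :
    ∀ᶠ t in 𝓝 (0 : ℝ), (levels (Dt t) (Mt t) k).Nonempty := by
  obtain ⟨l, z, hz, h⟩ := hne
  have hl : 0 ≤ l := hs.bddBelow_levels k ⟨z, hz, h⟩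
  filter_upwards [hp.spectral, eventually_comparable hs.nonnegM hp.boundM' hp.expandM,
    eventually_comparable hs.nonneg hp.boundD' hp.expandD] with t hst hcM hcD
  -- One factor `2` from `D_t ≤ 2 D`, the other from `M ≤ 2 M_t`.
  refine ⟨4 * l, hst.mem_levels_of_rayleigh_le z hz fun a => ?_⟩
  have hw : ∑ i, a i • z i ∈ lowerSpace D M (Set.Iic l) :=
    Submodule.sum_mem _ fun i _ => Submodule.smul_mem _ _ (Submodule.subset_span (h i))
  have h1 := hs.rayleigh_le (fun ν hν => hν) hw
  have h2 := (hcD (∑ i, a i • z i)).2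
  have h3 := (hcM (∑ i, a i • z i)).1
  nlinarith

/-- First-order lower bound for a perturbed eigenvalue. -/
theorem le_eigenvalue (hp : IsPerturbation D M D' M' Dt Mt) (hs : IsSpectral D M) {c : ℝ → ℝ}
    {c' l : ℝ} (hc : HasDerivAt c c' 0) (hcl : c 0 = l) (hl : 0 ≤ l) {k : ℕ}
    (hne : (levels D M k).Nonempty) (S Y : Submodule ℝ X) [FiniteDimensional ℝ S]
    (hS : Module.finrank ℝ S ≤ k) (hY : Y ≤ eigenspace D M l)
    (hdec : ∀ w, (∀ n ∈ S, M w n = 0) → ∃ y ∈ Y, w - y ∈ upperSpace D M l)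
    {ε : ℝ} (hε : 0 < ε) :
    ∀ᶠ t in 𝓝 (0 : ℝ), (∀ y ∈ Y, 0 ≤ t * (D' - l • M' - c' • M) y y) →
      c t - ε * |t| ≤ eigenvalue (Dt t) (Mt t) k := by
  obtain ⟨⟨C, hC⟩, hexp⟩ := hp.expand_sub hs hc
  rw [hcl] at hC hexp
  obtain ⟨γ, hγ, hgap⟩ := hs.gap l hl
  -- `D ≥ (l + γ) M` is equivalent to `D - l M ≥ γ / (1 + l + γ) (D + M)`.
  have hγ' : 0 < γ / (1 + l + γ) := by positivity
  -- On the test vector `D + M ≤ 2 (l + 2) M_t`, which leaves an error of `ε |t| / 2` and room for a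
  -- strict contradiction.
  have hε' : 0 < ε / (4 * (l + 2)) := by positivity
  have symmB : ∀ x y, (-(D - l • M)) x y = (-(D - l • M)) y x := fun x y => by
    simp only [LinearMap.neg_apply, LinearMap.sub_apply, LinearMap.smul_apply, smul_eq_mul]
    rw [hs.symmD, hs.symmM]
  have main := eventually_le_of_first_order (B := -(D - l • M)) (B' := -(D' - l • M' - c' • M))
    (N := D + M) (fun t x => -(Dt t x x - c t * Mt t x x)) symmB
    (fun x y => by
      rw [LinearMap.neg_apply, LinearMap.neg_apply, LinearMap.neg_apply, LinearMap.neg_apply,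
        hp.symm_deriv hs])
    (symm_add hs) (nonneg_add hs) (C := C)
    (fun x => by rw [LinearMap.neg_apply, LinearMap.neg_apply, abs_neg]; exact hC x)
    (fun δ hδ => (hexp δ hδ).mono fun t ht x => by
      have := (abs_le.1 (ht x)).1
      rw [LinearMap.neg_apply, LinearMap.neg_apply, LinearMap.neg_apply, LinearMap.neg_apply]
      linarith) hγ' hε'
  have hcb : ∀ᶠ t in 𝓝 (0 : ℝ), c t < l + 1 :=
    hc.continuousAt.tendsto.eventually_lt_const (by linarith)
  filter_upwards [main, hp.spectral, eventually_comparable hs.nonnegM hp.boundM' hp.expandM,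
    eventually_comparable hs.nonneg hp.boundD' hp.expandD, hp.eventually_levels_nonempty hs hne,
    hcb] with t ht hst hcM hcD hnet hct hder
  -- If the perturbed eigenvalue were too small, its `k + 1` eigenvectors would contain in their
  -- span a nonzero `w` orthogonal to `S`. Then `w = y + u` with `y ∈ Y` and `u` above the gap, and
  -- the first-order bound for `D_t - c(t) M_t` contradicts the Rayleigh quotient of `w`.
  by_contra hlt
  rw [not_le] at hlt
  obtain ⟨x, hx, h⟩ := hst.eigenvalue_mem_levels hnet
  obtain ⟨a, ha, hao⟩ := exists_ne_zero_orthogonal M S hS x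
  obtain ⟨w, hw⟩ : ∃ w, w = ∑ i, a i • x i := ⟨_, rfl⟩
  have hw0 : w ≠ 0 := by
    rintro h0
    exact ha (funext (Fintype.linearIndependent_iff.1 hx a (hw ▸ h0)))
  have hwl : w ∈ lowerSpace (Dt t) (Mt t) (Set.Iic (eigenvalue (Dt t) (Mt t) k)) := hw ▸
    Submodule.sum_mem _ fun i _ => Submodule.smul_mem _ _ (Submodule.subset_span (h i))
  have hR := hst.rayleigh_le (fun ν hν => hν) hwl
  rw [← hw] at hao
  obtain ⟨y, hy, hu⟩ := hdec w hao
  obtain ⟨u, hu'⟩ : ∃ u, u = w - y := ⟨_, rfl⟩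
  rw [← hu'] at hu
  have hwyu : w = y + u := by rw [hu']; abel
  have hE := mem_eigenspace.1 (hY hy)
  have hMyu : M y u = 0 := by rw [hs.symmM]; exact hu l le_rfl y (hY hy)
  have hMu := hs.nonnegM u
  have hg := hgap u hu
  have h1 := ht y u (by simp [hE]) (by simp [hE]) (by simp [hE, hMyu])
    (by
      simp only [LinearMap.neg_apply, LinearMap.sub_apply, LinearMap.smul_apply,
        LinearMap.add_apply, smul_eq_mul]
      have e : γ / (1 + l + γ) * (D u u + M u u) ≤ D u u - l * M u u := by
        rw [div_mul_eq_mul_div, div_le_iff₀ (by positivity)]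
        nlinarith
      linarith)
    (by
      have := hder y hy
      rw [LinearMap.neg_apply, LinearMap.neg_apply]
      linarith)
  rw [← hwyu] at h1
  have hMtw := hst.posM w hw0
  have h2 : (D + M) w w ≤ 2 * (l + 2) * Mt t w w := by
    rw [LinearMap.add_apply, LinearMap.add_apply]
    have e1 := (hcM w).1
    have e2 := (hcD w).1
    have e3 : eigenvalue (Dt t) (Mt t) k ≤ l + 1 := by
      have : 0 ≤ ε * |t| := by positivity
      linarith
    nlinarith
  have h3 : ε / (4 * (l + 2)) * |t| * (D + M) w w ≤ ε * |t| / 2 * Mt t w w := by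
    calc _ ≤ ε / (4 * (l + 2)) * |t| * (2 * (l + 2) * Mt t w w) :=
          mul_le_mul_of_nonneg_left h2 (by positivity)
      _ = _ := by field_simp; norm_num
  have h4 : 0 ≤ ε * |t| * Mt t w w := by positivity
  nlinarith

section Consequences

variable (hp : IsPerturbation D M D' M' Dt Mt) (hs : IsSpectral D M) {c : ℝ → ℝ} {c' : ℝ} {k : ℕ}
  (hc : HasDerivAt c c' 0) (hcl : c 0 = eigenvalue D M k) (hne : (levels D M k).Nonempty)
  {ε : ℝ} (hε : 0 < ε)
include hp hs hc hcl hne hε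

theorem eigenvalue_le_of_forall :
    ∀ᶠ t in 𝓝 (0 : ℝ), (∀ y ∈ eigenspace D M (eigenvalue D M k),
      t * (D' - eigenvalue D M k • M' - c' • M) y y ≤ 0) →
        eigenvalue (Dt t) (Mt t) k ≤ c t + ε * |t| := by
  obtain ⟨z, hz, h⟩ := hs.eigenvalue_mem_levels hne
  choose μ hμ hm using h
  filter_upwards [hp.eigenvalue_le hs hc hcl (hs.eigenvalue_nonneg k) z hz μ hm hμ hε]
    with t ht h
  refine ht fun y hy => h y ?_
  refine (Submodule.span_le.2 ?_) hy
  rintro _ ⟨i, hi, rfl⟩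
  exact hi ▸ hm i

theorem le_eigenvalue_of_forall [FiniteDimensional ℝ (eigenspace D M (eigenvalue D M k))] :
    ∀ᶠ t in 𝓝 (0 : ℝ), (∀ y ∈ eigenspace D M (eigenvalue D M k),
      0 ≤ t * (D' - eigenvalue D M k • M' - c' • M) y y) →
        c t - ε * |t| ≤ eigenvalue (Dt t) (Mt t) k := by
  obtain ⟨h1, h2⟩ := hs.finrank_lowerSpace_Iio_le k
  exact hp.le_eigenvalue hs hc hcl (hs.eigenvalue_nonneg k) hne _ _ h2 le_rfl
    (fun w hw => hs.decompose_eigenspace hw) hε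

/-- When `λ_k` is the first of its cluster, `k` eigenvectors below it together with any one
eigenvector `y` form a test space of dimension `k + 1`. Only the sign at `y` then enters. -/
theorem eigenvalue_le_of_lt (hk : 1 ≤ k) (hlt : eigenvalue D M (k - 1) < eigenvalue D M k) {y : X}
    (hy : y ∈ eigenspace D M (eigenvalue D M k)) (hy0 : y ≠ 0) :
    ∀ᶠ t in 𝓝 (0 : ℝ), t * (D' - eigenvalue D M k • M' - c' • M) y y ≤ 0 →
      eigenvalue (Dt t) (Mt t) k ≤ c t + ε * |t| := by
  obtain ⟨j, rfl⟩ : ∃ j, k = j + 1 := ⟨k - 1, by omega⟩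
  rw [Nat.add_sub_cancel] at hlt
  obtain ⟨x, hx, h⟩ := hs.eigenvalue_mem_levels (hne.mono (levels_anti D M j))
  choose μ hμ hm using h
  have hli : LinearIndependent ℝ (Fin.cons y x : Fin (j + 1 + 1) → X) := by
    rw [linearIndependent_finCons]
    refine ⟨hx, fun hmem => hy0 (hs.eq_zero_of_self ?_)⟩
    refine hs.orthogonal_lowerSpace_Iio ((Submodule.span_le.2 ?_) hmem) hy
    rintro _ ⟨i, rfl⟩
    exact Submodule.subset_span ⟨μ i, (hμ i).trans_lt hlt, hm i⟩
  filter_upwards [hp.eigenvalue_le hs hc hcl (hs.eigenvalue_nonneg _) _ hli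
    (Fin.cons (eigenvalue D M (j + 1)) μ) (Fin.cases hy hm)
    (Fin.cases le_rfl fun i => (hμ i).trans hlt.le) hε] with t ht h
  refine ht fun v hv => ?_
  have hv' : v ∈ Submodule.span ℝ {y} := by
    refine Submodule.span_mono ?_ hv
    rintro _ ⟨i, hi, rfl⟩
    induction i using Fin.cases with
    | zero => rfl
    | succ i => exact absurd hi (((hμ i).trans_lt hlt).ne)
  obtain ⟨a, rfl⟩ := Submodule.mem_span_singleton.1 hv'
  rw [map_smul, map_smul, LinearMap.smul_apply, smul_eq_mul, smul_eq_mul]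
  nlinarith [mul_self_nonneg a]

/-- When `λ_k` is the last of its cluster, the eigenvectors up to `λ_k` span at most `k + 1`
dimensions, so those orthogonal to `y` span at most `k`. These are the constraints `S`, and `y`
alone remains to be tested. -/
theorem le_eigenvalue_of_lt (hlt : eigenvalue D M k < eigenvalue D M (k + 1)) {y : X}
    (hy : y ∈ eigenspace D M (eigenvalue D M k)) (hy0 : y ≠ 0) :
    ∀ᶠ t in 𝓝 (0 : ℝ), 0 ≤ t * (D' - eigenvalue D M k • M' - c' • M) y y →
      c t - ε * |t| ≤ eigenvalue (Dt t) (Mt t) k := by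
  set l := eigenvalue D M k with hl
  obtain ⟨hfd, hfr⟩ := (exists_linearIndependent_or_finrank_le D M (Set.Iic l) (k + 1)).resolve_left
    fun h => not_le.2 hlt (hs.eigenvalue_le h)
  have hyl : y ∈ lowerSpace D M (Set.Iic l) :=
    eigenspace_le_lowerSpace D M (Set.mem_Iic.2 le_rfl) hy
  set S : Submodule ℝ X := lowerSpace D M (Set.Iic l) ⊓ LinearMap.ker (M y) with hS
  have hlt' : S < lowerSpace D M (Set.Iic l) := by
    refine lt_of_le_of_ne inf_le_left fun he => ?_
    have : y ∈ S := he ▸ hyl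
    exact (hs.posM y hy0).ne' this.2
  have : FiniteDimensional ℝ S := Submodule.finiteDimensional_of_le hlt'.le
  have hSk : Module.finrank ℝ S ≤ k := by
    have := Submodule.finrank_lt_finrank_of_lt hlt'
    omega
  filter_upwards [hp.le_eigenvalue hs hc hcl (hs.eigenvalue_nonneg k) hne S (Submodule.span ℝ {y})
    hSk ((Submodule.span_singleton_le_iff_mem _ _).2 hy)
    (fun w hw => hs.decompose_of_orthogonal hyl hy0 fun n hn hyn => hw n ⟨hn, hyn⟩) hε] with t ht h
  refine ht fun v hv => ?_
  obtain ⟨a, rfl⟩ := Submodule.mem_span_singleton.1 hv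
  rw [map_smul, map_smul, LinearMap.smul_apply, smul_eq_mul, smul_eq_mul]
  nlinarith [mul_self_nonneg a, mul_nonneg (mul_self_nonneg a) h]

end Consequences

end IsPerturbation

end Pencil

/-! ### Function spaces and quadratic forms on the graph. -/

namespace QuantumGraph

open Set

/-- The extension of a continuous function on `[0, 1]` to the line by its boundary values. -/
noncomputable def lineExt (f : C(Icc (0 : ℝ) 1, ℝ)) : ℝ → ℝ := IccExtend zero_le_one f

@[fun_prop]
theorem continuous_lineExt (f : C(Icc (0 : ℝ) 1, ℝ)) : Continuous (lineExt f) := f.continuous.Icc_extend'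

theorem lineExt_of_mem (f : C(Icc (0 : ℝ) 1, ℝ)) {x : ℝ} (hx : x ∈ Icc (0 : ℝ) 1) :
    lineExt f x = f ⟨x, hx⟩ := IccExtend_of_mem _ _ hx

theorem lineExt_add (f h : C(Icc (0 : ℝ) 1, ℝ)) (x : ℝ) :
    lineExt (f + h) x = lineExt f x + lineExt h x := rfl

theorem lineExt_mul (f h : C(Icc (0 : ℝ) 1, ℝ)) (x : ℝ) :
    lineExt (f * h) x = lineExt f x * lineExt h x := rfl

theorem lineExt_smul (a : ℝ) (f : C(Icc (0 : ℝ) 1, ℝ)) (x : ℝ) :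
    lineExt (a • f) x = a * lineExt f x := rfl

theorem lineExt_zero (x : ℝ) : lineExt 0 x = 0 := rfl

theorem lineExt_one (x : ℝ) : lineExt 1 x = 1 := rfl

/-- The restriction of a function on the line to `[0, 1]`, zero if it is not continuous there. -/
noncomputable def unitRestrict (f : ℝ → ℝ) : C(Icc (0 : ℝ) 1, ℝ) :=
  open Classical in
  if h : ContinuousOn f (Icc 0 1) then ⟨(Icc (0 : ℝ) 1).domRestrict f, h.domRestrict⟩ else 0

theorem unitRestrict_apply {f : ℝ → ℝ} (h : ContinuousOn f (Icc 0 1)) (x : Icc (0 : ℝ) 1) :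
    unitRestrict f x = f x := by
  rw [unitRestrict, dif_pos h]; rfl

theorem lineExt_unitRestrict {f : ℝ → ℝ} (h : ContinuousOn f (Icc 0 1)) {x : ℝ}
    (hx : x ∈ Icc (0 : ℝ) 1) : lineExt (unitRestrict f) x = f x := by
  rw [lineExt_of_mem _ hx, unitRestrict_apply h]

theorem lineExt_eventuallyEq {f : ℝ → ℝ} (h : ContinuousOn f (Icc 0 1)) {x : ℝ}
    (hx : x ∈ Ioo (0 : ℝ) 1) : lineExt (unitRestrict f) =ᶠ[𝓝 x] f := by
  filter_upwards [Icc_mem_nhds hx.1 hx.2] with y hy using lineExt_unitRestrict h hy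

theorem eq_of_lineExt_eqOn_Ioo {f h : C(Icc (0 : ℝ) 1, ℝ)}
    (heq : ∀ x ∈ Ioo (0 : ℝ) 1, lineExt f x = lineExt h x) : f = h := by
  have : EqOn (lineExt f) (lineExt h) (closure (Ioo (0 : ℝ) 1)) :=
    EqOn.closure heq (continuous_lineExt f) (continuous_lineExt h)
  rw [closure_Ioo zero_ne_one] at this
  ext x
  have h1 := this x.2
  rwa [lineExt_of_mem _ x.2, lineExt_of_mem _ x.2] at h1

/-- `p` is the derivative of `f` in the interior of the unit interval. -/
def IsDerivOf (p f : C(Icc (0 : ℝ) 1, ℝ)) : Prop :=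
  ∀ x ∈ Ioo (0 : ℝ) 1, HasDerivAt (lineExt f) (lineExt p x) x

theorem IsDerivOf.integral_eq {p f : C(Icc (0 : ℝ) 1, ℝ)} (h : IsDerivOf p f) {x y : ℝ}
    (hx : x ∈ Icc (0 : ℝ) 1) (hy : y ∈ Icc (0 : ℝ) 1) (hxy : x ≤ y) :
    ∫ s in x..y, lineExt p s = lineExt f y - lineExt f x := by
  refine intervalIntegral.integral_eq_sub_of_hasDerivAt_of_le hxy
    (continuous_lineExt f).continuousOn (fun s hs => h s ⟨?_, ?_⟩)
    ((continuous_lineExt p).intervalIntegrable _ _)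
  · exact hx.1.trans_lt hs.1
  · exact hs.2.trans_le hy.2

/-- The function is the integral of `p`, whose extension is continuous, so the interior derivative
extends to one-sided derivatives at the ends. -/
theorem IsDerivOf.hasDerivWithinAt {p f : C(Icc (0 : ℝ) 1, ℝ)} (h : IsDerivOf p f) {x : ℝ}
    (hx : x ∈ Icc (0 : ℝ) 1) : HasDerivWithinAt (lineExt f) (lineExt p x) (Icc 0 1) x := by
  have h1 : HasDerivAt (fun y => lineExt f 0 + ∫ s in (0 : ℝ)..y, lineExt p s) (lineExt p x) x :=
    ((continuous_lineExt p).integral_hasStrictDerivAt 0 x).hasDerivAt.const_add _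
  refine h1.hasDerivWithinAt.congr (fun y hy => ?_) ?_
  · rw [h.integral_eq ⟨le_rfl, zero_le_one⟩ hy hy.1]; ring
  · rw [h.integral_eq ⟨le_rfl, zero_le_one⟩ hx hx.1]; ring

theorem IsDerivOf.unique {p q f : C(Icc (0 : ℝ) 1, ℝ)} (hp : IsDerivOf p f) (hq : IsDerivOf q f) :
    p = q := eq_of_lineExt_eqOn_Ioo fun x hx => (hp x hx).unique (hq x hx)

/-- Integration by parts on the unit interval. -/
theorem IsDerivOf.integral_mul {p f q h : C(Icc (0 : ℝ) 1, ℝ)} (hf : IsDerivOf p f)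
    (hh : IsDerivOf q h) :
    ∫ x in (0 : ℝ)..1, lineExt f x * lineExt q x =
      lineExt f 1 * lineExt h 1 - lineExt f 0 * lineExt h 0 -
        ∫ x in (0 : ℝ)..1, lineExt p x * lineExt h x := by
  refine intervalIntegral.integral_mul_deriv_eq_deriv_mul_of_hasDerivAt
    (continuous_lineExt f).continuousOn (continuous_lineExt h).continuousOn (fun x hx => hf x ?_)
    (fun x hx => hh x ?_) ((continuous_lineExt p).intervalIntegrable _ _)
    ((continuous_lineExt q).intervalIntegrable _ _)
  all_goals simpa using hx

/-- Continuous functions on the closed edges, with no condition at the vertices. -/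
abbrev EdgeFun (E : Type*) := E → C(Icc (0 : ℝ) 1, ℝ)

section Forms

variable {E : Type*} [Fintype E]

/-- The form `(f, h) ↦ ∑ₑ ∫ a f h`. -/
noncomputable def weightForm (a : EdgeFun E) : LinearMap.BilinForm ℝ (EdgeFun E) :=
  LinearMap.mk₂ ℝ
    (fun f h => ∑ e, ∫ x in (0 : ℝ)..1, lineExt (a e) x * lineExt (f e) x * lineExt (h e) x)
    (fun f f' h => by
      rw [← Finset.sum_add_distrib]
      refine Finset.sum_congr rfl fun e _ => ?_
      rw [← intervalIntegral.integral_add (Continuous.intervalIntegrable (by fun_prop) _ _)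
        (Continuous.intervalIntegrable (by fun_prop) _ _)]
      refine intervalIntegral.integral_congr fun x _ => ?_
      simp only [Pi.add_apply, lineExt_add]; ring)
    (fun r f h => by
      rw [smul_eq_mul, Finset.mul_sum]
      refine Finset.sum_congr rfl fun e _ => ?_
      rw [← intervalIntegral.integral_const_mul]
      refine intervalIntegral.integral_congr fun x _ => ?_
      simp only [Pi.smul_apply, lineExt_smul]; ring)
    (fun f h h' => by
      rw [← Finset.sum_add_distrib]
      refine Finset.sum_congr rfl fun e _ => ?_
      rw [← intervalIntegral.integral_add (Continuous.intervalIntegrable (by fun_prop) _ _)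
        (Continuous.intervalIntegrable (by fun_prop) _ _)]
      refine intervalIntegral.integral_congr fun x _ => ?_
      simp only [Pi.add_apply, lineExt_add]; ring)
    (fun r f h => by
      rw [smul_eq_mul, Finset.mul_sum]
      refine Finset.sum_congr rfl fun e _ => ?_
      rw [← intervalIntegral.integral_const_mul]
      refine intervalIntegral.integral_congr fun x _ => ?_
      simp only [Pi.smul_apply, lineExt_smul]; ring)

theorem weightForm_apply (a f h : EdgeFun E) : weightForm a f h =
    ∑ e, ∫ x in (0 : ℝ)..1, lineExt (a e) x * lineExt (f e) x * lineExt (h e) x := rfl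

theorem weightForm_symm (a f h : EdgeFun E) : weightForm a f h = weightForm a h f := by
  simp only [weightForm_apply]
  refine Finset.sum_congr rfl fun e _ => intervalIntegral.integral_congr fun x _ => ?_
  ring

theorem weightForm_eq_mul (a f h : EdgeFun E) : weightForm a f h = weightForm 1 (a * f) h := by
  simp only [weightForm_apply]
  refine Finset.sum_congr rfl fun e _ => intervalIntegral.integral_congr fun x _ => ?_
  simp [lineExt_one, lineExt_mul]

theorem weightForm_mul_left (a b f h : EdgeFun E) :
    weightForm (a * b) f h = weightForm a (b * f) h := by
  rw [weightForm_eq_mul, mul_assoc, ← weightForm_eq_mul]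

theorem weightForm_mul_mid (a b f h : EdgeFun E) :
    weightForm a (b * f) h = weightForm a f (b * h) := by
  simp only [weightForm_apply]
  refine Finset.sum_congr rfl fun e _ => intervalIntegral.integral_congr fun x _ => ?_
  simp only [Pi.mul_apply, lineExt_mul]; ring

theorem weightForm_add (a b f h : EdgeFun E) :
    weightForm (a + b) f h = weightForm a f h + weightForm b f h := by
  rw [weightForm_eq_mul, add_mul, map_add, LinearMap.add_apply, ← weightForm_eq_mul,
    ← weightForm_eq_mul]

theorem weightForm_sub (a b f h : EdgeFun E) :
    weightForm (a - b) f h = weightForm a f h - weightForm b f h := by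
  rw [weightForm_eq_mul, sub_mul, map_sub, LinearMap.sub_apply, ← weightForm_eq_mul,
    ← weightForm_eq_mul]

theorem weightForm_smul (r : ℝ) (a f h : EdgeFun E) :
    weightForm (r • a) f h = r * weightForm a f h := by
  rw [weightForm_eq_mul, smul_mul_assoc, map_smul, LinearMap.smul_apply, ← weightForm_eq_mul,
    smul_eq_mul]

theorem weightForm_mono {a b : EdgeFun E} (hab : ∀ e x, a e x ≤ b e x) (f : EdgeFun E) :
    weightForm a f f ≤ weightForm b f f := by
  simp only [weightForm_apply]
  refine Finset.sum_le_sum fun e _ => ?_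
  refine intervalIntegral.integral_mono_on zero_le_one
    (Continuous.intervalIntegrable (by fun_prop) _ _)
    (Continuous.intervalIntegrable (by fun_prop) _ _) fun x hx => ?_
  rw [mul_assoc, mul_assoc]
  refine mul_le_mul_of_nonneg_right ?_ (mul_self_nonneg _)
  rw [lineExt_of_mem _ hx, lineExt_of_mem _ hx]
  exact hab e _

theorem abs_weightForm_le {a b : EdgeFun E} (hab : ∀ e x, |a e x| ≤ b e x) (f : EdgeFun E) :
    |weightForm a f f| ≤ weightForm b f f := by
  rw [abs_le]
  constructor
  · have h := weightForm_mono (a := (-1 : ℝ) • b) (b := a)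
      (fun e x => by
        have := (abs_le.1 (hab e x)).1
        simpa using this) f
    rw [weightForm_smul] at h
    linarith
  · exact weightForm_mono (fun e x => (abs_le.1 (hab e x)).2) f

theorem weightForm_nonneg {a : EdgeFun E} (ha : ∀ e x, 0 ≤ a e x) (f : EdgeFun E) :
    0 ≤ weightForm a f f := by
  have := weightForm_mono (a := (0 : ℝ) • a) (b := a) (fun e x => by simpa using ha e x) f
  rwa [weightForm_smul, zero_mul] at this

theorem weightForm_pos {a : EdgeFun E} (ha : ∀ e x, 0 < a e x) {f : EdgeFun E} (hf : f ≠ 0) :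
    0 < weightForm a f f := by
  obtain ⟨e, he⟩ := Function.ne_iff.1 hf
  obtain ⟨x, hx⟩ : ∃ x, f e x ≠ 0 := by
    by_contra! h
    exact he (ContinuousMap.ext h)
  have hnn : ∀ e, ∀ y ∈ Icc (0 : ℝ) 1,
      0 ≤ lineExt (a e) y * lineExt (f e) y * lineExt (f e) y := fun e y hy => by
    rw [mul_assoc, lineExt_of_mem _ hy]
    exact mul_nonneg (ha e _).le (mul_self_nonneg _)
  rw [weightForm_apply]
  refine Finset.sum_pos' (fun e _ => intervalIntegral.integral_nonneg zero_le_one (hnn e))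
    ⟨e, Finset.mem_univ e, ?_⟩
  refine intervalIntegral.integral_pos zero_lt_one (Continuous.continuousOn (by fun_prop))
    (fun y hy => hnn e y (Ioc_subset_Icc_self hy)) ⟨x, x.2, ?_⟩
  rw [mul_assoc, lineExt_of_mem _ x.2, lineExt_of_mem _ x.2]
  exact mul_pos (ha e _) (mul_self_pos.2 hx)

theorem weightForm_eq_one_one (a f h : EdgeFun E) :
    weightForm a f h = weightForm (a * (f * h)) 1 1 := by
  simp only [weightForm_apply]
  refine Finset.sum_congr rfl fun e _ => intervalIntegral.integral_congr fun x _ => ?_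
  simp only [Pi.mul_apply, lineExt_mul, Pi.one_apply, lineExt_one]; ring

theorem weightForm_le_of_sq_le {a : EdgeFun E} (ha : ∀ e x, 0 ≤ a e x) {f : EdgeFun E} {K : ℝ}
    (hK : ∀ e x, f e x ^ 2 ≤ K) : weightForm a f f ≤ K * weightForm a 1 1 := by
  rw [weightForm_eq_one_one a f f, ← weightForm_smul]
  refine weightForm_mono (fun e x => ?_) 1
  have := mul_le_mul_of_nonneg_left (hK e x) (ha e x)
  simp only [Pi.mul_apply, Pi.smul_apply, ContinuousMap.mul_apply, ContinuousMap.smul_apply,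
    smul_eq_mul]
  nlinarith

end Forms

section TestSpace

variable {V E : Type*} (G : DiscreteGraph V E)

/-- Continuously differentiable functions on the edges, given together with their derivatives, that
are continuous on the graph. -/
noncomputable def testSpace : Submodule ℝ (EdgeFun E × EdgeFun E) where
  carrier := {w | (∀ e, IsDerivOf (w.2 e) (w.1 e)) ∧
    ∃ a : V → ℝ, ∀ e, lineExt (w.1 e) 0 = a (G.src e) ∧ lineExt (w.1 e) 1 = a (G.tgt e)}
  add_mem' := by
    rintro w w' ⟨h, a, ha⟩ ⟨h', a', ha'⟩
    exact ⟨fun e x hx => (h e x hx).add (h' e x hx), a + a', fun e =>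
      ⟨congrArg₂ (· + ·) (ha e).1 (ha' e).1, congrArg₂ (· + ·) (ha e).2 (ha' e).2⟩⟩
  zero_mem' := ⟨fun e x _ => hasDerivAt_const x (0 : ℝ), 0, fun e => ⟨rfl, rfl⟩⟩
  smul_mem' := by
    rintro r w ⟨h, a, ha⟩
    exact ⟨fun e x hx => (h e x hx).const_mul r, r • a, fun e =>
      ⟨congrArg (r * ·) (ha e).1, congrArg (r * ·) (ha e).2⟩⟩

variable {G}

/-- The function underlying an element of the test space. -/
noncomputable def valFun : testSpace G →ₗ[ℝ] EdgeFun E :=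
  (LinearMap.fst ℝ _ _).comp (testSpace G).subtype

/-- The derivative of an element of the test space. -/
noncomputable def derivFun : testSpace G →ₗ[ℝ] EdgeFun E :=
  (LinearMap.snd ℝ _ _).comp (testSpace G).subtype

theorem isDerivOf (w : testSpace G) (e : E) : IsDerivOf (derivFun w e) (valFun w e) := w.2.1 e

theorem exists_vertexValues (w : testSpace G) : ∃ a : V → ℝ, ∀ e,
    lineExt (valFun w e) 0 = a (G.src e) ∧ lineExt (valFun w e) 1 = a (G.tgt e) := w.2.2

theorem valFun_injective : Function.Injective (valFun : testSpace G →ₗ[ℝ] EdgeFun E) := by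
  intro w w' h
  refine Subtype.ext (Prod.ext h (funext fun e => ?_))
  have h' : valFun w e = valFun w' e := congrFun h e
  exact (isDerivOf w e).unique (h' ▸ isDerivOf w' e)

variable (G) in
/-- The constant function one. -/
noncomputable def oneTest : testSpace G :=
  ⟨(1, 0), fun _ x _ => hasDerivAt_const x (1 : ℝ), 1, fun _ => ⟨rfl, rfl⟩⟩

@[simp]
theorem valFun_oneTest : valFun (oneTest G) = 1 := rfl

@[simp]
theorem derivFun_oneTest : derivFun (oneTest G) = 0 := rfl

/-- The product of two elements of the test space. -/
noncomputable def mulTest (w w' : testSpace G) : testSpace G :=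
  ⟨(valFun w * valFun w', derivFun w * valFun w' + valFun w * derivFun w'),
    fun e x hx => (isDerivOf w e x hx).mul (isDerivOf w' e x hx), by
      obtain ⟨a, ha⟩ := exists_vertexValues w
      obtain ⟨a', ha'⟩ := exists_vertexValues w'
      exact ⟨a * a', fun e => ⟨congrArg₂ (· * ·) (ha e).1 (ha' e).1,
        congrArg₂ (· * ·) (ha e).2 (ha' e).2⟩⟩⟩

theorem valFun_mulTest (w w' : testSpace G) : valFun (mulTest w w') = valFun w * valFun w' := rfl

theorem derivFun_mulTest (w w' : testSpace G) :
    derivFun (mulTest w w') = derivFun w * valFun w' + valFun w * derivFun w' := rfl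

variable [Fintype E]

variable (G) in
/-- The mass form with weight `a`. -/
noncomputable def massForm (a : EdgeFun E) : LinearMap.BilinForm ℝ (testSpace G) :=
  (weightForm a).compl₁₂ valFun valFun

variable (G) in
/-- The energy form with weight `a`. -/
noncomputable def energyForm (a : EdgeFun E) : LinearMap.BilinForm ℝ (testSpace G) :=
  (weightForm a).compl₁₂ derivFun derivFun

theorem massForm_apply (a : EdgeFun E) (w w' : testSpace G) :
    massForm G a w w' = weightForm a (valFun w) (valFun w') := rfl

theorem energyForm_apply (a : EdgeFun E) (w w' : testSpace G) :
    energyForm G a w w' = weightForm a (derivFun w) (derivFun w') := rfl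

theorem massForm_pos {a : EdgeFun E} (ha : ∀ e x, 0 < a e x) {w : testSpace G} (hw : w ≠ 0) :
    0 < massForm G a w w :=
  weightForm_pos ha fun h => hw (valFun_injective (h.trans (map_zero _).symm))

/-- The constant function on each edge with the given values. -/
noncomputable def constEdge (l : E → ℝ) : EdgeFun E := fun e => ContinuousMap.const _ (l e)

omit [Fintype E] in
theorem lineExt_constEdge (l : E → ℝ) (e : E) (x : ℝ) : lineExt (constEdge l e) x = l e := rfl

open Classical in
/-- The total flux out of the vertex `v` of a quantity with values `p₀`, `p₁` at the two ends of
the edges. -/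
noncomputable def vertexFlux (G : DiscreteGraph V E) (p₀ p₁ : E → ℝ) (v : V) : ℝ :=
  (∑ e, if G.src e = v then p₀ e else 0) + ∑ e, if G.tgt e = v then -p₁ e else 0

/-- Summation by parts: after exchanging the sums, each edge contributes once at each of its ends,
loops included. -/
theorem sum_mul_vertexFlux [Fintype V] (p₀ p₁ : E → ℝ) (a : V → ℝ) :
    ∑ v, a v * vertexFlux G p₀ p₁ v = ∑ e, (a (G.src e) * p₀ e - a (G.tgt e) * p₁ e) := by
  classical
  simp only [vertexFlux, mul_add, Finset.sum_add_distrib, Finset.mul_sum, mul_ite, mul_zero,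
    Finset.sum_sub_distrib]
  rw [Finset.sum_comm, Finset.sum_comm (f := fun v e => if G.tgt e = v then _ else _)]
  simp [sub_eq_add_neg]

/-- `w` solves `-w'' = l² s` on the edges with Kirchhoff conditions at the vertices, the edge `e`
having length `l e`. -/
structure SolvesPoisson (l : E → ℝ) (s : EdgeFun E) (w : testSpace G) : Prop where
  equation : ∀ e, IsDerivOf (-(l e ^ 2) • s e) (derivFun w e)
  flux : ∀ v, vertexFlux G (fun e => (l e)⁻¹ * lineExt (derivFun w e) 0)
    (fun e => (l e)⁻¹ * lineExt (derivFun w e) 1) v = 0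

/-- Integration by parts on each edge; the boundary terms regroup into vertex fluxes, because `h` is
continuous at the vertices, and these vanish. -/
theorem SolvesPoisson.weak [Fintype V] {l : E → ℝ} (hl : ∀ e, 0 < l e) {s : EdgeFun E}
    {w : testSpace G} (hw : SolvesPoisson l s w) (h : testSpace G) :
    energyForm G (constEdge l⁻¹) w h = weightForm (constEdge l) s (valFun h) := by
  obtain ⟨a, ha⟩ := exists_vertexValues h
  have hflux := sum_mul_vertexFlux (G := G) (fun e => (l e)⁻¹ * lineExt (derivFun w e) 0)
    (fun e => (l e)⁻¹ * lineExt (derivFun w e) 1) a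
  simp only [hw.flux, mul_zero, Finset.sum_const_zero] at hflux
  suffices hsub : energyForm G (constEdge l⁻¹) w h - weightForm (constEdge l) s (valFun h) =
      -∑ e, (a (G.src e) * ((l e)⁻¹ * lineExt (derivFun w e) 0) -
        a (G.tgt e) * ((l e)⁻¹ * lineExt (derivFun w e) 1)) by
    rw [← hflux] at hsub
    linarith
  rw [energyForm_apply, weightForm_apply, weightForm_apply, ← Finset.sum_sub_distrib,
    ← Finset.sum_neg_distrib]
  refine Finset.sum_congr rfl fun e _ => ?_
  have hl' := (hl e).ne'
  have hparts := (hw.equation e).integral_mul (isDerivOf h e)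
  rw [(ha e).1, (ha e).2] at hparts
  simp only [lineExt_constEdge, Pi.inv_apply, mul_assoc]
  rw [intervalIntegral.integral_const_mul, intervalIntegral.integral_const_mul, hparts]
  simp only [lineExt_smul, mul_assoc]
  rw [intervalIntegral.integral_const_mul]
  field_simp
  ring

end TestSpace

end QuantumGraph

/-! ### Solving the Poisson problem. -/

namespace QuantumGraph

open Set

variable {V E : Type*} {G : DiscreteGraph V E}

theorem DiscreteGraph.Connected.induction (hG : G.Connected) {P : V → V → Prop} (refl : ∀ v, P v v)
    (symm : ∀ v w, P v w → P w v) (trans : ∀ u v w, P u v → P v w → P u w)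
    (edge : ∀ e, P (G.src e) (G.tgt e)) (v w : V) : P v w := by
  obtain ⟨p⟩ := hG.preconnected v w
  induction p with
  | nil => exact refl _
  | cons h _ ih =>
    refine trans _ _ _ ?_ ih
    rw [SimpleGraph.fromRel_adj] at h
    rcases h.2 with ⟨e, rfl, rfl⟩ | ⟨e, rfl, rfl⟩
    · exact edge e
    · exact symm _ _ (edge e)

theorem DiscreteGraph.Connected.eq_of_edge (hG : G.Connected) {a : V → ℝ}
    (h : ∀ e, a (G.src e) = a (G.tgt e)) (v w : V) : a v = a w :=
  hG.induction (P := fun v w => a v = a w) (fun _ => rfl) (fun _ _ => Eq.symm)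
    (fun _ _ _ => Eq.trans) h v w

variable [Fintype E]

theorem vertexFlux_add (p₀ p₁ q₀ q₁ : E → ℝ) (v : V) :
    vertexFlux G (fun e => p₀ e + q₀ e) (fun e => p₁ e + q₁ e) v =
      vertexFlux G p₀ p₁ v + vertexFlux G q₀ q₁ v := by
  classical
  unfold vertexFlux
  refine Eq.trans (congrArg₂ (· + ·) ?_ ?_) (add_add_add_comm _ _ _ _)
  all_goals
    rw [← Finset.sum_add_distrib]
    exact Finset.sum_congr rfl fun e _ => by split_ifs <;> ring

theorem vertexFlux_smul (r : ℝ) (p₀ p₁ : E → ℝ) (v : V) :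
    vertexFlux G (fun e => r * p₀ e) (fun e => r * p₁ e) v = r * vertexFlux G p₀ p₁ v := by
  classical
  unfold vertexFlux
  rw [mul_add, Finset.mul_sum, Finset.mul_sum]
  exact congrArg₂ (· + ·) (Finset.sum_congr rfl fun e _ => by split_ifs <;> ring)
    (Finset.sum_congr rfl fun e _ => by split_ifs <;> ring)

/-- Solvability of the discrete Poisson problem on a connected weighted graph. -/
theorem exists_potential [Fintype V] (hG : G.Connected) {l : E → ℝ} (hl : ∀ e, 0 < l e)
    {b : V → ℝ} (hb : ∑ v, b v = 0) : ∃ a : V → ℝ, ∀ v,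
      vertexFlux G (fun e => (l e)⁻¹ * (a (G.tgt e) - a (G.src e)))
        (fun e => (l e)⁻¹ * (a (G.tgt e) - a (G.src e))) v = b v := by
  have : Nonempty V := hG.nonempty
  let Lap : (V → ℝ) → V → ℝ := fun a => vertexFlux G
    (fun e => (l e)⁻¹ * (a (G.tgt e) - a (G.src e)))
    (fun e => (l e)⁻¹ * (a (G.tgt e) - a (G.src e)))
  -- The graph Laplacian kills constants; adding the total sum of `a` makes it injective. Laplacians
  -- have sum zero, so for `∑ b = 0` the added term vanishes at the solution.
  let L : (V → ℝ) →ₗ[ℝ] (V → ℝ) :=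
    { toFun := fun a v => Lap a v + ∑ w, a w
      map_add' := fun a a' => by
        ext v
        simp only [Lap, Pi.add_apply, Finset.sum_add_distrib]
        rw [add_add_add_comm, ← vertexFlux_add]
        congr 3 <;> ext e <;> ring
      map_smul' := fun r a => by
        ext v
        simp only [Lap, Pi.smul_apply, smul_eq_mul, RingHom.id_apply]
        rw [mul_add, ← vertexFlux_smul, Finset.mul_sum]
        congr 3 <;> ext e <;> ring }
  have hLap : ∀ a c : V → ℝ, ∑ v, c v * Lap a v =
      ∑ e, (c (G.src e) - c (G.tgt e)) * ((l e)⁻¹ * (a (G.tgt e) - a (G.src e))) := fun a c => by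
    rw [sum_mul_vertexFlux]
    exact Finset.sum_congr rfl fun e _ => by ring
  have hsum : ∀ a, ∑ v, L a v = Fintype.card V * ∑ w, a w := fun a => by
    have h1 := hLap a 1
    simp only [Pi.one_apply, one_mul, sub_self, zero_mul, Finset.sum_const_zero] at h1
    change ∑ v, (Lap a v + ∑ w, a w) = _
    rw [Finset.sum_add_distrib, h1]
    simp
  have hcard : (Fintype.card V : ℝ) ≠ 0 := by exact_mod_cast Fintype.card_ne_zero
  have hinj : Function.Injective L := by
    rw [← LinearMap.ker_eq_bot, Submodule.eq_bot_iff]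
    intro a ha
    have hLa : L a = 0 := ha
    have h0 : ∑ w, a w = 0 := by
      have := hsum a
      rw [hLa] at this
      simp only [Pi.zero_apply, Finset.sum_const_zero] at this
      exact (mul_eq_zero.1 this.symm).resolve_left hcard
    have hLap0 : ∀ v, Lap a v = 0 := fun v => by
      have h1 : Lap a v + ∑ w, a w = 0 := congrFun hLa v
      linarith
    -- Pairing `a` with its Laplacian gives minus the weighted sum of squared differences along the
    -- edges.
    have h2 := hLap a a
    simp only [hLap0, mul_zero, Finset.sum_const_zero] at h2
    have h3 : ∑ e, (l e)⁻¹ * (a (G.tgt e) - a (G.src e)) ^ 2 = 0 := by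
      rw [← neg_zero, h2, ← Finset.sum_neg_distrib]
      exact Finset.sum_congr rfl fun e _ => by ring
    rw [Finset.sum_eq_zero_iff_of_nonneg fun e _ =>
      mul_nonneg (inv_nonneg.2 (hl e).le) (sq_nonneg _)] at h3
    have h4 : ∀ e, a (G.src e) = a (G.tgt e) := fun e => by
      have := (mul_eq_zero.1 (h3 e (Finset.mem_univ e))).resolve_left (inv_ne_zero (hl e).ne')
      have := pow_eq_zero_iff two_ne_zero |>.1 this
      linarith
    ext v
    have h5 : ∑ w, a w = Fintype.card V * a v := by
      rw [Finset.sum_congr rfl fun w _ => hG.eq_of_edge h4 w v]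
      simp
    rw [h0] at h5
    exact (mul_eq_zero.1 h5.symm).resolve_left hcard
  obtain ⟨a, ha⟩ := LinearMap.injective_iff_surjective.1 hinj b
  refine ⟨a, fun v => ?_⟩
  have h0 : ∑ w, a w = 0 := by
    have := hsum a
    rw [ha, hb] at this
    exact (mul_eq_zero.1 this.symm).resolve_left hcard
  have h1 : Lap a v + ∑ w, a w = b v := congrFun ha v
  rw [h0, add_zero] at h1
  exact h1

/-- Solvability of the Poisson problem on a connected metric graph. -/
theorem exists_solvesPoisson [Fintype V] (hG : G.Connected) {l : E → ℝ} (hl : ∀ e, 0 < l e)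
    {s : EdgeFun E} (hs : weightForm (constEdge l) s 1 = 0) :
    ∃ w : testSpace G, SolvesPoisson l s w := by
  -- On each edge `-Q`, with `Q'' = l² s`, is a particular solution. The affine part is determined
  -- by vertex values `a`, which must balance the fluxes of the particular solutions.
  let P : E → ℝ → ℝ := fun e x => l e ^ 2 * ∫ y in (0 : ℝ)..x, lineExt (s e) y
  have hP : ∀ e x, HasDerivAt (P e) (l e ^ 2 * lineExt (s e) x) x := fun e x =>
    (((continuous_lineExt (s e)).integral_hasStrictDerivAt 0 x).hasDerivAt).const_mul _
  have hPc : ∀ e, Continuous (P e) := fun e =>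
    continuous_iff_continuousAt.2 fun x => (hP e x).continuousAt
  let Q : E → ℝ → ℝ := fun e x => ∫ y in (0 : ℝ)..x, P e y
  have hQ : ∀ e x, HasDerivAt (Q e) (P e x) x := fun e x =>
    ((hPc e).integral_hasStrictDerivAt 0 x).hasDerivAt
  have hP0 : ∀ e, P e 0 = 0 := fun e => by simp [P]
  have hQ0 : ∀ e, Q e 0 = 0 := fun e => by simp [Q]
  let b : V → ℝ := fun v => -vertexFlux G (fun e => (l e)⁻¹ * (Q e 1 - P e 0))
    (fun e => (l e)⁻¹ * (Q e 1 - P e 1)) v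
  -- The discrete problem is solvable since the total flux of the particular solutions is the
  -- integral of the source, zero by `hs`.
  have hb : ∑ v, b v = 0 := by
    have h1 := sum_mul_vertexFlux (G := G) (fun e => (l e)⁻¹ * (Q e 1 - P e 0))
      (fun e => (l e)⁻¹ * (Q e 1 - P e 1)) 1
    simp only [Pi.one_apply, one_mul] at h1
    simp only [b, Finset.sum_neg_distrib]
    rw [h1, neg_eq_zero]
    refine Eq.trans ?_ hs
    rw [weightForm_apply]
    refine Finset.sum_congr rfl fun e _ => ?_
    simp only [lineExt_constEdge, Pi.one_apply, lineExt_one, mul_one]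
    rw [hP0, intervalIntegral.integral_const_mul]
    simp only [P]
    have := (hl e).ne'
    field_simp
    ring
  obtain ⟨a, ha⟩ := exists_potential hG hl hb
  let d : E → ℝ := fun e => a (G.tgt e) - a (G.src e) + Q e 1
  let u' : E → ℝ → ℝ := fun e x => d e - P e x
  let u : E → ℝ → ℝ := fun e x => a (G.src e) + d e * x - Q e x
  have hu : ∀ e x, HasDerivAt (u e) (u' e x) x := fun e x => by
    have := (((hasDerivAt_id x).const_mul (d e)).const_add (a (G.src e))).sub (hQ e x)
    rw [mul_one] at this
    exact this
  have hu' : ∀ e x, HasDerivAt (u' e) (-(l e ^ 2) * lineExt (s e) x) x := fun e x => by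
    have := (hP e x).const_sub (d e)
    rw [neg_mul]
    exact this
  have huc : ∀ e, ContinuousOn (u e) (Icc 0 1) := fun e x _ => (hu e x).continuousAt.continuousWithinAt
  have huc' : ∀ e, ContinuousOn (u' e) (Icc 0 1) := fun e x _ =>
    (hu' e x).continuousAt.continuousWithinAt
  have h0 : (0 : ℝ) ∈ Icc (0 : ℝ) 1 := ⟨le_rfl, zero_le_one⟩
  have h1 : (1 : ℝ) ∈ Icc (0 : ℝ) 1 := ⟨zero_le_one, le_rfl⟩
  refine ⟨⟨(fun e => unitRestrict (u e), fun e => unitRestrict (u' e)), fun e x hx => ?_, a,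
    fun e => ⟨?_, ?_⟩⟩, fun e x hx => ?_, fun v => ?_⟩
  · rw [lineExt_unitRestrict (huc' e) (Ioo_subset_Icc_self hx)]
    exact (hu e x).congr_of_eventuallyEq (lineExt_eventuallyEq (huc e) hx)
  · rw [lineExt_unitRestrict (huc e) h0]
    simp [u, hQ0]
  · rw [lineExt_unitRestrict (huc e) h1]
    simp only [u, d]
    ring
  · exact (hu' e x).congr_of_eventuallyEq (lineExt_eventuallyEq (huc' e) hx)
  · have h2 : ∀ e, lineExt (unitRestrict (u' e)) 0 = u' e 0 := fun e =>
      lineExt_unitRestrict (huc' e) h0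
    have h3 : ∀ e, lineExt (unitRestrict (u' e)) 1 = u' e 1 := fun e =>
      lineExt_unitRestrict (huc' e) h1
    change vertexFlux G (fun e => (l e)⁻¹ * lineExt (unitRestrict (u' e)) 0)
      (fun e => (l e)⁻¹ * lineExt (unitRestrict (u' e)) 1) v = 0
    have h4 := ha v
    have h5 := vertexFlux_add (G := G) (fun e => (l e)⁻¹ * (a (G.tgt e) - a (G.src e)))
      (fun e => (l e)⁻¹ * (a (G.tgt e) - a (G.src e))) (fun e => (l e)⁻¹ * (Q e 1 - P e 0))
      (fun e => (l e)⁻¹ * (Q e 1 - P e 1)) v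
    rw [h4] at h5
    simp only [b, neg_add_cancel] at h5
    refine Eq.trans ?_ h5
    congr 1 <;> ext e
    · rw [h2]; simp only [u', d]; ring
    · rw [h3]; simp only [u', d]; ring

omit [Fintype E] in
theorem constEdge_pos {l : E → ℝ} (hl : ∀ e, 0 < l e) (e : E) (x : Icc (0 : ℝ) 1) :
    0 < constEdge l e x := hl e

omit [Fintype E] in
theorem constEdge_inv_pos {l : E → ℝ} (hl : ∀ e, 0 < l e) (e : E) (x : Icc (0 : ℝ) 1) :
    0 < constEdge l⁻¹ e x := inv_pos.2 (hl e)

theorem energyForm_nonneg {b : EdgeFun E} (hb : ∀ e x, 0 < b e x) (w : testSpace G) :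
    0 ≤ energyForm G b w w := weightForm_nonneg (fun e x => (hb e x).le) _

theorem derivFun_eq_zero_of_energy {b : EdgeFun E} (hb : ∀ e x, 0 < b e x) {w : testSpace G}
    (h : energyForm G b w w = 0) : derivFun w = 0 := by
  by_contra h0
  exact (weightForm_pos hb h0).ne' h

/-- Regularity by comparison: testing with `1` shows that the source has mean zero, so a classical
solution exists. Its difference from `w` has zero energy, and `SolvesPoisson` depends on `w` only
through its derivative. -/
theorem SolvesPoisson.of_weak [Fintype V] (hG : G.Connected) {l : E → ℝ} (hl : ∀ e, 0 < l e)
    {s : EdgeFun E} {w : testSpace G}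
    (hw : ∀ h, energyForm G (constEdge l⁻¹) w h = weightForm (constEdge l) s (valFun h)) :
    SolvesPoisson l s w := by
  have hs : weightForm (constEdge l) s 1 = 0 := by
    have := hw (oneTest G)
    rw [energyForm_apply, derivFun_oneTest, map_zero] at this
    exact this.symm
  obtain ⟨w', hw'⟩ := exists_solvesPoisson hG hl hs
  have h0 : energyForm G (constEdge l⁻¹) (w - w') (w - w') = 0 := by
    rw [map_sub (energyForm G (constEdge l⁻¹)), LinearMap.sub_apply, hw, hw'.weak hl, sub_self]
  have h1 := derivFun_eq_zero_of_energy (constEdge_inv_pos hl) h0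
  rw [map_sub, sub_eq_zero] at h1
  exact ⟨fun e => h1 ▸ hw'.equation e, fun v => h1 ▸ hw'.flux v⟩

end QuantumGraph

/-! ### Poincaré inequality, compactness and discrete spectrum. -/

namespace QuantumGraph

open Set

/-- Expand the nonnegative integral of `(p - mean)²`. -/
theorem sq_integral_le {p : ℝ → ℝ} (hp : Continuous p) {x y : ℝ} (hxy : x ≤ y) :
    (∫ s in x..y, p s) ^ 2 ≤ (y - x) * ∫ s in x..y, p s ^ 2 := by
  rcases hxy.eq_or_lt with rfl | h
  · simp
  set I := ∫ s in x..y, p s with hI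
  have hd : 0 < y - x := sub_pos.2 h
  have h1 : 0 ≤ ∫ s in x..y, (p s - I / (y - x)) ^ 2 :=
    intervalIntegral.integral_nonneg hxy fun s _ => sq_nonneg _
  have h2 : ∫ s in x..y, (p s - I / (y - x)) ^ 2 =
      (∫ s in x..y, p s ^ 2) - 2 * (I / (y - x)) * I + (y - x) * (I / (y - x)) ^ 2 := by
    have : ∀ s, (p s - I / (y - x)) ^ 2 =
        p s ^ 2 - 2 * (I / (y - x)) * p s + (I / (y - x)) ^ 2 := fun s => by ring
    simp only [this]
    rw [intervalIntegral.integral_add (Continuous.intervalIntegrable (by fun_prop) _ _)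
      (Continuous.intervalIntegrable (by fun_prop) _ _),
      intervalIntegral.integral_sub (Continuous.intervalIntegrable (by fun_prop) _ _)
      (Continuous.intervalIntegrable (by fun_prop) _ _), intervalIntegral.integral_const_mul,
      intervalIntegral.integral_const, smul_eq_mul]
  rw [h2] at h1
  have h3 : (y - x) * ((∫ s in x..y, p s ^ 2) - 2 * (I / (y - x)) * I +
      (y - x) * (I / (y - x)) ^ 2) = (y - x) * (∫ s in x..y, p s ^ 2) - I ^ 2 := by
    field_simp; ring
  have := mul_nonneg hd.le h1
  linarith

variable {V E : Type*} {G : DiscreteGraph V E} [Fintype E]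

theorem integral_sq_derivFun_le {l : E → ℝ} (hl : ∀ e, 0 < l e) (w : testSpace G) (e : E) :
    ∫ x in (0 : ℝ)..1, lineExt (derivFun w e) x ^ 2 ≤
      l e * energyForm G (constEdge l⁻¹) w w := by
  have hnn : ∀ e, 0 ≤ ∫ x in (0 : ℝ)..1, lineExt (constEdge l⁻¹ e) x * lineExt (derivFun w e) x *
      lineExt (derivFun w e) x := fun e =>
    intervalIntegral.integral_nonneg zero_le_one fun x _ => by
      rw [mul_assoc, lineExt_constEdge]
      exact mul_nonneg (inv_nonneg.2 (hl e).le) (mul_self_nonneg _)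
  have h1 := Finset.single_le_sum (fun e _ => hnn e) (Finset.mem_univ e)
  rw [energyForm_apply, weightForm_apply]
  refine le_trans (le_of_eq ?_) (mul_le_mul_of_nonneg_left h1 (hl e).le)
  rw [← intervalIntegral.integral_const_mul]
  refine intervalIntegral.integral_congr fun x _ => ?_
  simp only [lineExt_constEdge, Pi.inv_apply]
  have := (hl e).ne'
  field_simp

/-- Functions of finite energy are Hölder continuous of exponent `1 / 2`. -/
theorem abs_sub_le_sqrt_energy {l : E → ℝ} (hl : ∀ e, 0 < l e) (w : testSpace G) (e : E) {x y : ℝ}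
    (hx : x ∈ Icc (0 : ℝ) 1) (hy : y ∈ Icc (0 : ℝ) 1) :
    |lineExt (valFun w e) x - lineExt (valFun w e) y| ≤
      √(l e) * √(energyForm G (constEdge l⁻¹) w w) * √|x - y| := by
  wlog hxy : y ≤ x generalizing x y
  · rw [abs_sub_comm, abs_sub_comm x y]
    exact this hy hx (not_le.1 hxy).le
  have hp := continuous_lineExt (derivFun w e)
  rw [← Real.sqrt_mul (hl e).le, ← Real.sqrt_mul
    (mul_nonneg (hl e).le (energyForm_nonneg (constEdge_inv_pos hl) w)),
    ← (isDerivOf w e).integral_eq hy hx hxy]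
  refine Real.abs_le_sqrt ?_
  rw [abs_of_nonneg (sub_nonneg.2 hxy), mul_comm]
  refine (sq_integral_le hp hxy).trans (mul_le_mul_of_nonneg_left ?_ (sub_nonneg.2 hxy))
  refine le_trans ?_ (integral_sq_derivFun_le hl w e)
  exact intervalIntegral.integral_mono_interval hy.1 hxy hx.2
    (Filter.Eventually.of_forall fun s => sq_nonneg _) ((hp.pow 2).intervalIntegrable _ _)

/-- The Hölder bound is chained along paths of edges. Finiteness of the graph makes the constant
uniform, and `c` is the value at one fixed vertex. -/
theorem exists_oscillation_bound [Fintype V] [Nonempty E] (hG : G.Connected) {l : E → ℝ}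
    (hl : ∀ e, 0 < l e) : ∃ K, 0 ≤ K ∧ ∀ w : testSpace G, ∃ c : ℝ, ∀ e, ∀ x ∈ Icc (0 : ℝ) 1,
      |lineExt (valFun w e) x - c| ≤ K * √(energyForm G (constEdge l⁻¹) w w) := by
  have h0 : (0 : ℝ) ∈ Icc (0 : ℝ) 1 := ⟨le_rfl, zero_le_one⟩
  have h1 : (1 : ℝ) ∈ Icc (0 : ℝ) 1 := ⟨zero_le_one, le_rfl⟩
  let val : testSpace G → V → ℝ := fun w => (exists_vertexValues w).choose
  have hval : ∀ w e, lineExt (valFun w e) 0 = val w (G.src e) ∧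
      lineExt (valFun w e) 1 = val w (G.tgt e) := fun w => (exists_vertexValues w).choose_spec
  have hpath : ∀ v v', ∃ C, ∀ w, |val w v - val w v'| ≤ C * √(energyForm G (constEdge l⁻¹) w w) := by
    refine hG.induction (fun v => ⟨0, fun w => by simp⟩) ?_ ?_ ?_
    · rintro v v' ⟨C, hC⟩
      exact ⟨C, fun w => by rw [abs_sub_comm]; exact hC w⟩
    · rintro u v v' ⟨C, hC⟩ ⟨C', hC'⟩
      refine ⟨C + C', fun w => ?_⟩
      rw [add_mul]
      exact (abs_sub_le _ _ _).trans (add_le_add (hC w) (hC' w))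
    · intro e
      refine ⟨√(l e), fun w => ?_⟩
      rw [← (hval w e).1, ← (hval w e).2]
      simpa using abs_sub_le_sqrt_energy hl w e h0 h1
  obtain ⟨e₀⟩ := ‹Nonempty E›
  choose C hC using fun v => hpath v (G.src e₀)
  refine ⟨(∑ e, √(l e)) + ∑ v, |C v|, by positivity, fun w => ⟨val w (G.src e₀), fun e x hx => ?_⟩⟩
  have hD := Real.sqrt_nonneg (energyForm G (constEdge l⁻¹) w w)
  have e1 := abs_sub_le_sqrt_energy hl w e hx h0
  have e2 := hC (G.src e) w
  rw [← (hval w e).1] at e2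
  have e3 : √(l e) ≤ ∑ e, √(l e) :=
    Finset.single_le_sum (fun e _ => Real.sqrt_nonneg (l e)) (Finset.mem_univ e)
  have e4 : C (G.src e) ≤ ∑ v, |C v| := (le_abs_self _).trans
    (Finset.single_le_sum (f := fun v => |C v|) (fun v _ => abs_nonneg _) (Finset.mem_univ _))
  have e5 : √|x - 0| ≤ 1 := by
    rw [sub_zero, abs_of_nonneg hx.1]; exact Real.sqrt_le_one.2 hx.2
  calc _ ≤ |lineExt (valFun w e) x - lineExt (valFun w e) 0| +
        |lineExt (valFun w e) 0 - val w (G.src e₀)| := abs_sub_le _ _ _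
    _ ≤ √(l e) * √(energyForm G (constEdge l⁻¹) w w) * 1 +
        C (G.src e) * √(energyForm G (constEdge l⁻¹) w w) :=
        add_le_add (e1.trans (mul_le_mul_of_nonneg_left e5 (by positivity))) e2
    _ = (√(l e) + C (G.src e)) * √(energyForm G (constEdge l⁻¹) w w) := by ring
    _ ≤ _ := mul_le_mul_of_nonneg_right (add_le_add e3 e4) hD

/-- A Poincaré inequality with a uniform bound. -/
theorem exists_poincare [Fintype V] [Nonempty E] (hG : G.Connected) {l : E → ℝ}
    (hl : ∀ e, 0 < l e) {a : EdgeFun E} (ha : ∀ e x, 0 < a e x) :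
    ∃ K, 0 ≤ K ∧ ∀ w : testSpace G, massForm G a w (oneTest G) = 0 →
      massForm G a w w ≤ K * energyForm G (constEdge l⁻¹) w w ∧
      ∀ e x, |valFun w e x| ≤ K * √(energyForm G (constEdge l⁻¹) w w) := by
  obtain ⟨K, hK, hosc⟩ := exists_oscillation_bound hG hl
  have h11 : 0 < massForm G a (oneTest G) (oneTest G) := massForm_pos ha fun h => by
    have h' : valFun (oneTest G) = 0 := by rw [h, map_zero]
    have := congrArg (fun f => lineExt (f (Classical.arbitrary E)) 0) h'
    exact one_ne_zero this
  -- The first summand serves the `L²` bound, the second the uniform bound.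
  refine ⟨K ^ 2 * massForm G a (oneTest G) (oneTest G) + 2 * K, by positivity, fun w hw => ?_⟩
  obtain ⟨c, hc⟩ := hosc w
  set D := energyForm G (constEdge l⁻¹) w w with hD
  have hD0 : 0 ≤ D := energyForm_nonneg (constEdge_inv_pos hl) w
  have hsq : ∀ e x, valFun (w - c • oneTest G) e x ^ 2 ≤ K ^ 2 * D := fun e x => by
    have h1 := hc e x x.2
    rw [lineExt_of_mem _ x.2] at h1
    have h2 : valFun (w - c • oneTest G) e x = valFun w e x - c := by simp
    rw [h2, ← sq_abs]
    calc _ ≤ (K * √D) ^ 2 := pow_le_pow_left₀ (abs_nonneg _) h1 2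
      _ = K ^ 2 * D := by rw [mul_pow, Real.sq_sqrt hD0]
  have hle := weightForm_le_of_sq_le (fun e x => (ha e x).le) hsq
  rw [← massForm_apply] at hle
  have hw' : massForm G a (oneTest G) w = 0 := by
    rw [massForm_apply, weightForm_symm]; exact hw
  -- Pythagoras for `w ⟂ 1`: the bound on `w - c` controls both `w` in `L²` and the constant `c`.
  have hexp : massForm G a (w - c • oneTest G) (w - c • oneTest G) =
      massForm G a w w + c ^ 2 * massForm G a (oneTest G) (oneTest G) := by
    simp only [map_sub, map_smul, LinearMap.sub_apply, LinearMap.smul_apply, smul_eq_mul, hw, hw']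
    ring
  rw [hexp] at hle
  change _ ≤ K ^ 2 * D * massForm G a (oneTest G) (oneTest G) at hle
  have hww : 0 ≤ massForm G a w w := weightForm_nonneg (fun e x => (ha e x).le) _
  constructor
  · nlinarith [mul_nonneg (sq_nonneg c) h11.le, mul_nonneg hK hD0]
  · intro e x
    have hc2 : c ^ 2 ≤ K ^ 2 * D := by
      by_contra hlt
      have := mul_lt_mul_of_pos_right (not_le.1 hlt) h11
      linarith
    have hc3 : |c| ≤ K * √D := by
      rw [← Real.sqrt_sq_eq_abs, ← Real.sqrt_sq hK, ← Real.sqrt_mul (sq_nonneg K)]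
      exact Real.sqrt_le_sqrt hc2
    have h1 := hc e x x.2
    rw [lineExt_of_mem _ x.2] at h1
    have h2 : |valFun w e x| ≤ 2 * K * √D := by
      have := abs_add_le (valFun w e x - c) c
      rw [sub_add_cancel] at this
      change |valFun w e x - c| ≤ _ at h1
      linarith
    refine h2.trans (mul_le_mul_of_nonneg_right ?_ (Real.sqrt_nonneg _))
    have : 0 ≤ K ^ 2 * massForm G a (oneTest G) (oneTest G) := by positivity
    linarith

theorem isCompact_holder (B : ℝ) : IsCompact {f : C(Icc (0 : ℝ) 1, ℝ) |
    (∀ x, |f x| ≤ B) ∧ ∀ x y, |f x - f y| ≤ B * √|(x : ℝ) - y|} := by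
  set S := {f : C(Icc (0 : ℝ) 1, ℝ) |
    (∀ x, |f x| ≤ B) ∧ ∀ x y, |f x - f y| ≤ B * √|(x : ℝ) - y|}
  have hmod : ∀ x₀ : Icc (0 : ℝ) 1,
      Filter.Tendsto (fun x : Icc (0 : ℝ) 1 => B * √|(x₀ : ℝ) - x|) (𝓝 x₀) (𝓝 0) := fun x₀ => by
    have : Continuous fun x : Icc (0 : ℝ) 1 => B * √|(x₀ : ℝ) - x| := by fun_prop
    simpa using this.tendsto x₀
  refine ArzelaAscoli.isCompact_of_equicontinuous S ?_ ?_
  -- The Hölder bound passes to pointwise limits and forces continuity, so the set is compact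
  -- already for pointwise convergence.
  · have himg : ContinuousMap.toFun '' S = (Set.univ.pi fun _ => Icc (-B) B) ∩
        {g | ∀ x y : Icc (0 : ℝ) 1, |g x - g y| ≤ B * √|(x : ℝ) - y|} := by
      ext g
      constructor
      · rintro ⟨f, hf, rfl⟩
        exact ⟨fun x _ => abs_le.1 (hf.1 x), hf.2⟩
      · rintro ⟨h1, h2⟩
        refine ⟨⟨g, ?_⟩, ⟨fun x => abs_le.2 (h1 x trivial), h2⟩, rfl⟩
        rw [continuous_iff_continuousAt]
        intro x₀
        rw [ContinuousAt, tendsto_iff_norm_sub_tendsto_zero]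
        refine squeeze_zero (fun _ => norm_nonneg _) (fun x => ?_) (hmod x₀)
        rw [Real.norm_eq_abs, abs_sub_comm]
        exact h2 x₀ x
    rw [himg]
    refine (isCompact_univ_pi fun _ => isCompact_Icc).inter_right ?_
    simp only [ofPred_forall]
    exact isClosed_iInter fun x => isClosed_iInter fun y =>
      isClosed_le (by fun_prop) continuous_const
  · intro x₀
    rw [Metric.equicontinuousAt_iff_right]
    intro ε hε
    filter_upwards [(hmod x₀).eventually_lt_const hε] with x hx f
    rw [Real.dist_eq]
    exact (f.2.2 x₀ x).trans_lt hx

open Filter in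
/-- The eigenvalue problem on a connected metric graph has discrete spectrum. -/
theorem isSpectral [Fintype V] [Nonempty E] (hG : G.Connected) {l : E → ℝ} (hl : ∀ e, 0 < l e)
    {r : EdgeFun E} (hr : ∀ e x, 0 < r e x) :
    Pencil.IsSpectral (energyForm G (constEdge l⁻¹)) (massForm G (constEdge l * r)) := by
  have ha : ∀ e x, 0 < (constEdge l * r) e x := fun e x => mul_pos (hl e) (hr e x)
  have ha' : ∀ e x, 0 ≤ (constEdge l * r) e x := fun e x => (ha e x).le
  obtain ⟨K, hK, hpoin⟩ := exists_poincare hG hl ha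
  have h11 : oneTest G ≠ 0 := fun h => by
    have h' : valFun (oneTest G) = 0 := by rw [h, map_zero]
    have := congrArg (fun f => lineExt (f (Classical.arbitrary E)) 0) h'
    exact one_ne_zero this
  have hsolve : ∀ f : EdgeFun E, weightForm (constEdge l * r) f 1 = 0 → ∃ u : testSpace G, ∀ h,
      energyForm G (constEdge l⁻¹) u h = weightForm (constEdge l * r) f (valFun h) := by
    intro f hf
    rw [weightForm_mul_left] at hf
    obtain ⟨u, hu⟩ := exists_solvesPoisson hG hl hf
    exact ⟨u, fun h => by rw [hu.weak hl, ← weightForm_mul_left]⟩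
  have hsymmD : ∀ x y, energyForm G (constEdge l⁻¹) x y = energyForm G (constEdge l⁻¹) y x :=
    fun x y => weightForm_symm _ _ _
  refine Pencil.IsSpectral.of_compact _ _ hsymmD (fun x y => weightForm_symm _ _ _)
    (energyForm_nonneg (constEdge_inv_pos hl)) (fun x hx => massForm_pos ha hx) (oneTest G) h11
    (fun h => by simp [energyForm_apply]) K (fun u hu => (hpoin u hu).1)
    (fun f hf => hsolve (valFun f) hf) ?_
  intro C u v hu0 hv0 huC hv
  set a := constEdge l * r with hadef
  set B := (K + ∑ e, √(l e)) * √C with hB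
  have hcompact : IsCompact (Set.univ.pi fun _ : E => {f : C(Icc (0 : ℝ) 1, ℝ) |
      (∀ x, |f x| ≤ B) ∧ ∀ x y, |f x - f y| ≤ B * √|(x : ℝ) - y|}) :=
    isCompact_univ_pi fun _ => isCompact_holder B
  have hsum : 0 ≤ ∑ e, √(l e) := by positivity
  have hmem : ∀ n, valFun (u n) ∈ (Set.univ.pi fun _ : E => {f : C(Icc (0 : ℝ) 1, ℝ) |
      (∀ x, |f x| ≤ B) ∧ ∀ x y, |f x - f y| ≤ B * √|(x : ℝ) - y|}) := by
    intro n e _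
    have hsq := Real.sqrt_le_sqrt (huC n)
    constructor
    · intro x
      refine ((hpoin (u n) (hu0 n)).2 e x).trans ?_
      exact mul_le_mul (by linarith) hsq (Real.sqrt_nonneg _) (by positivity)
    · intro x y
      have h1 := abs_sub_le_sqrt_energy hl (u n) e x.2 y.2
      rw [lineExt_of_mem _ x.2, lineExt_of_mem _ y.2] at h1
      refine h1.trans (mul_le_mul_of_nonneg_right ?_ (Real.sqrt_nonneg _))
      refine mul_le_mul ?_ hsq (Real.sqrt_nonneg _) (by positivity)
      have := Finset.single_le_sum (fun e _ => Real.sqrt_nonneg (l e)) (Finset.mem_univ e)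
      linarith
  -- The uniform limit `f` need not be in the test space, but the Poisson problem accepts any
  -- continuous source. The limit of `v` is the mean-zero solution with source `f`.
  obtain ⟨f, -, φ, hφ, hlim⟩ := hcompact.tendsto_subseq hmem
  set A := weightForm a 1 1 with hA
  have hA0 : 0 ≤ A := weightForm_nonneg ha' _
  have hdist : ∀ n, weightForm a (valFun (u (φ n)) - f) (valFun (u (φ n)) - f) ≤
      dist (valFun (u (φ n))) f ^ 2 * A := fun n => by
    refine weightForm_le_of_sq_le ha' fun e x => ?_
    rw [← sq_abs]
    refine pow_le_pow_left₀ (abs_nonneg _) ?_ 2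
    calc |(valFun (u (φ n)) - f) e x| = dist (valFun (u (φ n)) e x) (f e x) := by
          rw [Real.dist_eq]; rfl
      _ ≤ dist (valFun (u (φ n)) e) (f e) := ContinuousMap.dist_apply_le_dist x
      _ ≤ _ := dist_le_pi_dist _ _ _
  have hd0 : Tendsto (fun n => dist (valFun (u (φ n))) f ^ 2 * A) atTop (𝓝 0) := by
    have := ((tendsto_iff_dist_tendsto_zero.1 hlim).pow 2).mul_const A
    simpa using this
  have hW0 : Tendsto (fun n => weightForm a (valFun (u (φ n)) - f) (valFun (u (φ n)) - f)) atTop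
      (𝓝 0) := squeeze_zero (fun n => weightForm_nonneg ha' _) hdist hd0
  have hcs : ∀ p q : EdgeFun E, weightForm a p q ^ 2 ≤ weightForm a p p * weightForm a q q :=
    Pencil.sq_le (weightForm_symm a) (weightForm_nonneg ha')
  have hf0 : weightForm a f 1 = 0 := by
    have h1 : Tendsto (fun _ : ℕ => weightForm a f 1 ^ 2) atTop (𝓝 0) := by
      refine squeeze_zero (fun _ => sq_nonneg _) (fun n => ?_) (by simpa using hW0.mul_const A)
      have h2 := hcs (valFun (u (φ n)) - f) 1
      have h3 : weightForm a (valFun (u (φ n))) 1 = 0 := hu0 (φ n)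
      rw [map_sub, LinearMap.sub_apply, h3, zero_sub, neg_sq] at h2
      simpa using h2
    exact pow_eq_zero_iff two_ne_zero |>.1 (tendsto_nhds_unique h1 tendsto_const_nhds).symm
  obtain ⟨w₀, hw₀⟩ := hsolve f hf0
  have h1pos : 0 < massForm G a (oneTest G) (oneTest G) := massForm_pos ha h11
  set w := w₀ - (massForm G a w₀ (oneTest G) / massForm G a (oneTest G) (oneTest G)) • oneTest G
    with hw
  have hwm : massForm G a w (oneTest G) = 0 := by
    rw [hw]
    simp only [map_sub, map_smul, LinearMap.sub_apply, LinearMap.smul_apply, smul_eq_mul]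
    field_simp
    ring
  have hwD : ∀ h, energyForm G (constEdge l⁻¹) w h = weightForm a f (valFun h) := fun h => by
    rw [← hw₀, hw]
    simp [energyForm_apply]
  refine ⟨w, φ, hφ, ?_⟩
  -- From `M z z ≤ K D z z` and `(D z z)² ≤ ‖u - f‖² M z z` (norm with weight `a`) one gets `M z z ≤
  -- K² ‖u - f‖²`.
  refine squeeze_zero (g := fun n => K ^ 2 * (dist (valFun (u (φ n))) f ^ 2 * A))
    (fun n => weightForm_nonneg ha' _) (fun n => ?_) (by simpa using hd0.const_mul (K ^ 2))
  set z := v (φ n) - w with hz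
  have hzm : massForm G a z (oneTest G) = 0 := by
    rw [hz, map_sub, LinearMap.sub_apply, hv0, hwm, sub_zero]
  have hzD : energyForm G (constEdge l⁻¹) z z = weightForm a (valFun (u (φ n)) - f) (valFun z) := by
    rw [hz, map_sub (energyForm G (constEdge l⁻¹)), LinearMap.sub_apply, hv, hwD, massForm_apply,
      map_sub (weightForm a), LinearMap.sub_apply]
  have hz1 := (hpoin z hzm).1
  have hz2 := hcs (valFun (u (φ n)) - f) (valFun z)
  rw [← hzD, ← massForm_apply] at hz2
  have hzz : 0 ≤ massForm G a z z := weightForm_nonneg ha' _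
  have hDz : 0 ≤ energyForm G (constEdge l⁻¹) z z := energyForm_nonneg (constEdge_inv_pos hl) z
  have hdn := hdist n
  rcases hzz.eq_or_lt with h0 | h0
  · rw [← h0]; positivity
  · have h3 : massForm G a z z ^ 2 ≤ K ^ 2 * energyForm G (constEdge l⁻¹) z z ^ 2 := by
      rw [← mul_pow]; exact pow_le_pow_left₀ hzz hz1 2
    have h4 : massForm G a z z * massForm G a z z ≤
        (K ^ 2 * weightForm a (valFun (u (φ n)) - f) (valFun (u (φ n)) - f)) *
          massForm G a z z := by
      have := mul_le_mul_of_nonneg_left hz2 (sq_nonneg K)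
      nlinarith
    exact (le_of_mul_le_mul_right h4 h0).trans (mul_le_mul_of_nonneg_left hdn (sq_nonneg K))

end QuantumGraph

/-! ### Classical and weak eigenvalue problems. -/

namespace QuantumGraph

open Set

theorem IsDerivOf.derivWithin_eq {p f : C(Icc (0 : ℝ) 1, ℝ)} (h : IsDerivOf p f) {x : ℝ}
    (hx : x ∈ Icc (0 : ℝ) 1) : derivWithin (lineExt f) (Icc 0 1) x = lineExt p x :=
  (h.hasDerivWithinAt hx).derivWithin (uniqueDiffOn_Icc zero_lt_one x hx)

theorem IsDerivOf.contDiffOn_one {p f : C(Icc (0 : ℝ) 1, ℝ)} (h : IsDerivOf p f) :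
    ContDiffOn ℝ 1 (lineExt f) (Icc 0 1) := by
  rw [show (1 : WithTop ℕ∞) = 0 + 1 from rfl,
    contDiffOn_succ_iff_derivWithin (uniqueDiffOn_Icc zero_lt_one)]
  refine ⟨fun x hx => (h.hasDerivWithinAt hx).differentiableWithinAt, by simp, ?_⟩
  rw [contDiffOn_zero]
  exact (continuous_lineExt p).continuousOn.congr fun x hx => h.derivWithin_eq hx

theorem IsDerivOf.contDiffOn_two {p q f : C(Icc (0 : ℝ) 1, ℝ)} (h : IsDerivOf p f)
    (h' : IsDerivOf q p) : ContDiffOn ℝ 2 (lineExt f) (Icc 0 1) := by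
  rw [show (2 : WithTop ℕ∞) = 1 + 1 from rfl,
    contDiffOn_succ_iff_derivWithin (uniqueDiffOn_Icc zero_lt_one)]
  exact ⟨fun x hx => (h.hasDerivWithinAt hx).differentiableWithinAt, by simp,
    h'.contDiffOn_one.congr fun x hx => h.derivWithin_eq hx⟩

theorem IsDerivOf.iteratedDerivWithin_two {p q f : C(Icc (0 : ℝ) 1, ℝ)} (h : IsDerivOf p f)
    (h' : IsDerivOf q p) {x : ℝ} (hx : x ∈ Icc (0 : ℝ) 1) :
    iteratedDerivWithin 2 (lineExt f) (Icc 0 1) x = lineExt q x := by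
  rw [iteratedDerivWithin_succ, ← h'.derivWithin_eq hx]
  refine derivWithin_congr (fun y hy => ?_) ?_
  · rw [iteratedDerivWithin_one, h.derivWithin_eq hy]
  · rw [iteratedDerivWithin_one, h.derivWithin_eq hx]

variable {V E : Type*} {G : DiscreteGraph V E} [Fintype E] {g : E → ℝ} {ρ : E → ℝ → ℝ}

theorem outwardFlux_eq_vertexFlux (f : E → ℝ → ℝ) (v : V) : outwardFlux G g f v =
    vertexFlux G (fun e => arcDeriv g f e 0) (fun e => arcDeriv g f e 1) v := rfl

/-- The edge lengths of a metric. -/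
noncomputable def edgeLength (g : E → ℝ) : E → ℝ := fun e => √(g e)

omit [Fintype E] in
theorem edgeLength_pos (hg : IsMetric g) (e : E) : 0 < edgeLength g e := Real.sqrt_pos.2 (hg e)

omit [Fintype E] in
theorem edgeLength_sq (hg : IsMetric g) (e : E) : edgeLength g e ^ 2 = g e :=
  Real.sq_sqrt (hg e).le

/-- The density as a continuous function on the closed edges. -/
noncomputable def edgeDensity (ρ : E → ℝ → ℝ) : EdgeFun E := fun e => unitRestrict (ρ e)

theorem SolvesEigenproblem.exists_solvesPoisson (hg : IsMetric g)
    (hρ : ∀ e, ContinuousOn (ρ e) (Icc 0 1)) {μ : ℝ} {f : E → ℝ → ℝ}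
    (hf : SolvesEigenproblem G g ρ μ f) : ∃ w : testSpace G,
      (∀ e, ∀ x ∈ Icc (0 : ℝ) 1, lineExt (valFun w e) x = f e x) ∧
      SolvesPoisson (edgeLength g) (μ • (edgeDensity ρ * valFun w)) w := by
  have hu : UniqueDiffOn ℝ (Icc (0 : ℝ) 1) := uniqueDiffOn_Icc zero_lt_one
  have h0 : (0 : ℝ) ∈ Icc (0 : ℝ) 1 := ⟨le_rfl, zero_le_one⟩
  have h1 : (1 : ℝ) ∈ Icc (0 : ℝ) 1 := ⟨zero_le_one, le_rfl⟩
  set p : E → ℝ → ℝ := fun e => derivWithin (f e) (Icc 0 1) with hp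
  have hpc : ∀ e, ContDiffOn ℝ 1 (p e) (Icc 0 1) := fun e =>
    (hf.regular e).derivWithin hu (by norm_num)
  have hfc : ∀ e, ContinuousOn (f e) (Icc 0 1) := fun e => (hf.regular e).continuousOn
  have hpc' : ∀ e, ContinuousOn (p e) (Icc 0 1) := fun e => (hpc e).continuousOn
  have hval : ∀ e, ∀ x ∈ Icc (0 : ℝ) 1, lineExt (unitRestrict (f e)) x = f e x := fun e x hx =>
    lineExt_unitRestrict (hfc e) hx
  have hder : ∀ e, ∀ x ∈ Icc (0 : ℝ) 1, lineExt (unitRestrict (p e)) x = p e x := fun e x hx =>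
    lineExt_unitRestrict (hpc' e) hx
  obtain ⟨a, ha⟩ := hf.continuous_at_vertices
  refine ⟨⟨(fun e => unitRestrict (f e), fun e => unitRestrict (p e)), fun e x hx => ?_, a,
    fun e => ⟨?_, ?_⟩⟩, hval, fun e x hx => ?_, fun v => ?_⟩
  · have hx' := Ioo_subset_Icc_self hx
    rw [hder e x hx']
    refine HasDerivAt.congr_of_eventuallyEq ?_ (lineExt_eventuallyEq (hfc e) hx)
    exact (((hf.regular e).differentiableOn (by norm_num)) x hx').hasDerivWithinAt.hasDerivAt
      (Icc_mem_nhds hx.1 hx.2)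
  · rw [hval e 0 h0]; exact (ha e).1
  · rw [hval e 1 h1]; exact (ha e).2
  · have hx' := Ioo_subset_Icc_self hx
    refine HasDerivAt.congr_of_eventuallyEq ?_ (lineExt_eventuallyEq (hpc' e) hx)
    have h2 := (((hpc e).differentiableOn (by norm_num)) x hx').hasDerivWithinAt.hasDerivAt
      (Icc_mem_nhds hx.1 hx.2)
    convert h2 using 1
    have h3 := hf.equation e x hx
    rw [laplacian, iteratedDerivWithin_succ, iteratedDerivWithin_one] at h3
    change -((g e)⁻¹ * derivWithin (p e) (Icc 0 1) x) = _ at h3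
    have hg' := (hg e).ne'
    change -(edgeLength g e ^ 2) * (μ * (lineExt (unitRestrict (ρ e)) x *
      lineExt (unitRestrict (f e)) x)) = _
    rw [hval e x hx', lineExt_unitRestrict (hρ e) hx', edgeLength_sq hg]
    have h5 : derivWithin (p e) (Icc 0 1) x = -(g e * (μ * ρ e x * f e x)) := by
      rw [← h3]
      field_simp
    rw [h5]; ring
  · have h2 := hf.neumann v
    rw [outwardFlux_eq_vertexFlux] at h2
    refine Eq.trans ?_ h2
    congr 1
    · ext e
      change _ * lineExt (unitRestrict (p e)) 0 = _
      rw [hder e 0 h0]; rfl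
    · ext e
      change _ * lineExt (unitRestrict (p e)) 1 = _
      rw [hder e 1 h1]; rfl

theorem SolvesPoisson.solvesEigenproblem (hg : IsMetric g)
    (hρ : ∀ e, ContinuousOn (ρ e) (Icc 0 1)) {μ : ℝ} {w : testSpace G}
    (hw : SolvesPoisson (edgeLength g) (μ • (edgeDensity ρ * valFun w)) w) :
    SolvesEigenproblem G g ρ μ (fun e => lineExt (valFun w e)) where
  regular e := (isDerivOf w e).contDiffOn_two (hw.equation e)
  equation e x hx := by
    have hx' := Ioo_subset_Icc_self hx
    rw [laplacian, (isDerivOf w e).iteratedDerivWithin_two (hw.equation e) hx']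
    change -((g e)⁻¹ * (-(edgeLength g e ^ 2) * (μ * (lineExt (unitRestrict (ρ e)) x *
      lineExt (valFun w e) x)))) = _
    rw [lineExt_unitRestrict (hρ e) hx', edgeLength_sq hg]
    have hg' := (hg e).ne'
    field_simp
  continuous_at_vertices := exists_vertexValues w
  neumann v := by
    rw [outwardFlux_eq_vertexFlux]
    refine Eq.trans ?_ (hw.flux v)
    congr 1
    · ext e
      rw [arcDeriv, (isDerivOf w e).derivWithin_eq ⟨le_rfl, zero_le_one⟩]; rfl
    · ext e
      rw [arcDeriv, (isDerivOf w e).derivWithin_eq ⟨zero_le_one, le_rfl⟩]; rfl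

variable (G) in
/-- The Dirichlet energy form of a metric. -/
noncomputable def dirichletForm (g : E → ℝ) : LinearMap.BilinForm ℝ (testSpace G) :=
  energyForm G (constEdge (edgeLength g)⁻¹)

variable (G) in
/-- The `L²` form of a metric and a density. -/
noncomputable def densityForm (g : E → ℝ) (ρ : E → ℝ → ℝ) : LinearMap.BilinForm ℝ (testSpace G) :=
  massForm G (constEdge (edgeLength g) * edgeDensity ρ)

/-- The classical and the weak formulation of the eigenvalue problem agree. -/
theorem solvesPoisson_iff_mem_eigenspace [Fintype V] (hG : G.Connected) (hg : IsMetric g) {μ : ℝ}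
    {w : testSpace G} :
    SolvesPoisson (edgeLength g) (μ • (edgeDensity ρ * valFun w)) w ↔
      w ∈ Pencil.eigenspace (dirichletForm G g) (densityForm G g ρ) μ := by
  have key : ∀ h : testSpace G,
      weightForm (constEdge (edgeLength g)) (μ • (edgeDensity ρ * valFun w)) (valFun h) =
        μ * densityForm G g ρ w h := fun h => by
    rw [map_smul, LinearMap.smul_apply, smul_eq_mul, densityForm, massForm_apply,
      weightForm_mul_left]
  rw [Pencil.mem_eigenspace]
  constructor
  · intro hw h
    rw [← key, dirichletForm, hw.weak (edgeLength_pos hg)]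
  · intro hw
    refine SolvesPoisson.of_weak hG (edgeLength_pos hg) fun h => ?_
    rw [key, ← hw]; rfl

theorem isSpectral_pencil [Fintype V] [Nonempty E] (hG : G.Connected) (hg : IsMetric g)
    (hρ : ∀ e, ContinuousOn (ρ e) (Icc 0 1)) (hpos : ∀ e, ∀ x ∈ Icc (0 : ℝ) 1, 0 < ρ e x) :
    Pencil.IsSpectral (dirichletForm G g) (densityForm G g ρ) :=
  isSpectral hG (edgeLength_pos hg) fun e x => by
    rw [edgeDensity, unitRestrict_apply (hρ e)]
    exact hpos e x x.2

variable (G) in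
/-- Restriction to the closed edges. -/
noncomputable def edgeValues : testSpace G →ₗ[ℝ] (E × Icc (0 : ℝ) 1 → ℝ) where
  toFun w p := valFun w p.1 p.2
  map_add' w w' := by ext; simp
  map_smul' a w := by ext; simp

omit [Fintype E] in
theorem edgeValues_injective : Function.Injective (edgeValues G) := by
  intro w w' h
  refine valFun_injective (funext fun e => ContinuousMap.ext fun x => ?_)
  exact congrFun h (e, x)

/-- Solutions correspond to elements of the weak eigenspaces, and independence is measured by the
values on the closed edges, which determine a test function. -/
theorem eigenvalue_eq_pencil [Fintype V] (hG : G.Connected) (hg : IsMetric g)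
    (hρ : ∀ e, ContinuousOn (ρ e) (Icc 0 1)) (k : ℕ) :
    eigenvalue G k g ρ = Pencil.eigenvalue (dirichletForm G g) (densityForm G g ρ) k := by
  rw [eigenvalue, Pencil.eigenvalue]
  congr 1
  ext c
  constructor
  · rintro ⟨f, hli, hf⟩
    choose μ hμ hs using hf
    choose w hw hwP using fun i => (hs i).exists_solvesPoisson hg hρ
    refine ⟨w, LinearIndependent.of_comp (edgeValues G) ?_,
      fun i => ⟨μ i, hμ i, (solvesPoisson_iff_mem_eigenspace hG hg).1 (hwP i)⟩⟩
    convert hli using 1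
    ext i p
    rw [← hw i p.1 p.2 p.2.2, lineExt_of_mem _ p.2.2]
    rfl
  · rintro ⟨w, hli, hw⟩
    refine ⟨fun i e => lineExt (valFun (w i) e), ?_, fun i => ?_⟩
    · have := hli.map' (edgeValues G) (LinearMap.ker_eq_bot.2 edgeValues_injective)
      have heq : (fun (i : Fin (k + 1)) (p : E × Icc (0 : ℝ) 1) =>
          lineExt (valFun (w i) p.1) p.2) = edgeValues G ∘ w := by
        ext i p
        exact lineExt_of_mem _ p.2.2
      rw [heq]
      exact this
    · obtain ⟨μ, hμ, hm⟩ := hw i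
      exact ⟨μ, hμ,
        ((solvesPoisson_iff_mem_eigenspace hG hg).2 hm).solvesEigenproblem hg hρ⟩

theorem isEigenvalue_of_mem_eigenspace [Fintype V] (hG : G.Connected) (hg : IsMetric g)
    (hρ : ∀ e, ContinuousOn (ρ e) (Icc 0 1)) {μ : ℝ} {w : testSpace G}
    (hw : w ∈ Pencil.eigenspace (dirichletForm G g) (densityForm G g ρ) μ) (h0 : w ≠ 0) :
    IsEigenvalue G g ρ μ := by
  refine ⟨_, ((solvesPoisson_iff_mem_eigenspace hG hg).2 hw).solvesEigenproblem hg hρ, ?_⟩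
  by_contra hne
  refine h0 (valFun_injective ?_)
  rw [map_zero]
  ext e x
  by_contra hx
  refine hne ⟨e, x, x.2, ?_⟩
  exact (lineExt_of_mem _ x.2).trans_ne hx

end QuantumGraph

/-! ### Smooth families give form perturbations. -/

namespace QuantumGraph

open Set

/-- A function of class `C¹` in `(t, x)` on a closed strip is differentiable in `t`, uniformly in
`x`. -/
theorem exists_hasDerivAt_unitRestrict {δ : ℝ} (hδ : 0 < δ) {F : ℝ → ℝ → ℝ}
    (hF : ContDiffOn ℝ 1 (fun p : ℝ × ℝ => F p.1 p.2) (Ioo (-δ) δ ×ˢ Icc (0 : ℝ) 1)) :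
    ∃ σ : C(Icc (0 : ℝ) 1, ℝ), HasDerivAt (fun t => unitRestrict (F t)) σ 0 := by
  set S : Set (ℝ × ℝ) := Ioo (-δ) δ ×ˢ Icc (0 : ℝ) 1 with hS
  have hSu : UniqueDiffOn ℝ S := (uniqueDiffOn_Ioo _ _).prod (uniqueDiffOn_Icc zero_lt_one)
  -- The partial derivative in `t`, taken within the strip because smoothness at `x = 0` and `x = 1`
  -- is one-sided.
  set Φ : ℝ × ℝ → ℝ := fun p =>
    fderivWithin ℝ (fun p : ℝ × ℝ => F p.1 p.2) S p (1, 0) with hΦ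
  have hΦc : ContinuousOn Φ S :=
    (hF.continuousOn_fderivWithin hSu le_rfl).clm_apply continuousOn_const
  have hFc : ∀ t ∈ Ioo (-δ) δ, ContinuousOn (F t) (Icc 0 1) := fun t ht =>
    hF.continuousOn.comp (f := fun x : ℝ => (t, x)) (by fun_prop) fun x hx => ⟨ht, hx⟩
  have h0 : (0 : ℝ) ∈ Ioo (-δ) δ := ⟨by linarith, hδ⟩
  have hσc : ContinuousOn (fun x => Φ (0, x)) (Icc 0 1) :=
    hΦc.comp (f := fun x : ℝ => ((0 : ℝ), x)) (by fun_prop) fun x hx => ⟨h0, hx⟩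
  have hder : ∀ t ∈ Ioo (-δ) δ, ∀ x ∈ Icc (0 : ℝ) 1,
      HasDerivAt (fun s => F s x) (Φ (t, x)) t := by
    intro t ht x hx
    have h1 := (hF.differentiableOn one_ne_zero (t, x) ⟨ht, hx⟩).hasFDerivWithinAt
    have h2 : HasDerivWithinAt (fun s : ℝ => (s, x)) (1, 0) (Ioo (-δ) δ) t :=
      ((hasDerivAt_id t).prodMk (hasDerivAt_const t x)).hasDerivWithinAt
    have h3 : MapsTo (fun s : ℝ => (s, x)) (Ioo (-δ) δ) S := fun s hs => ⟨hs, hx⟩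
    exact (h1.comp_hasDerivWithinAt t h2 h3).hasDerivAt (Ioo_mem_nhds ht.1 ht.2)
  refine ⟨unitRestrict fun x => Φ (0, x), ?_⟩
  rw [hasDerivAt_iff_isLittleO, Asymptotics.isLittleO_iff]
  intro ε hε
  have hK : IsCompact (Icc (-(δ / 2)) (δ / 2) ×ˢ Icc (0 : ℝ) 1) := isCompact_Icc.prod isCompact_Icc
  have hKS : Icc (-(δ / 2)) (δ / 2) ×ˢ Icc (0 : ℝ) 1 ⊆ S :=
    prod_mono (fun t ht => ⟨by linarith [ht.1], by linarith [ht.2]⟩) Subset.rfl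
  have huc := Metric.uniformContinuousOn_iff.1
    (hK.uniformContinuousOn_of_continuous (hΦc.mono hKS)) ε hε
  obtain ⟨η, hη, hη'⟩ := huc
  set r := min η (δ / 2) with hr
  have hrpos : 0 < r := lt_min hη (by linarith)
  have hΦr : ∀ t ∈ Ioo (-r) r, ∀ x ∈ Icc (0 : ℝ) 1, ‖Φ (t, x) - Φ (0, x)‖ ≤ ε := by
    intro t ht x hx
    have htr : |t| < r := abs_lt.2 ht
    have ht2 : |t| ≤ δ / 2 := htr.le.trans (min_le_right _ _)
    have := hη' (t, x) ⟨abs_le.1 ht2, hx⟩ (0, x) ⟨⟨by linarith, by linarith⟩, hx⟩ (by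
      rw [Prod.dist_eq, dist_self, Real.dist_eq, sub_zero, max_eq_left (abs_nonneg t)]
      exact htr.trans_le (min_le_left _ _))
    rw [← dist_eq_norm]; exact this.le
  filter_upwards [Ioo_mem_nhds (show -r < 0 by linarith) hrpos] with t ht
  have hsub : Ioo (-r) r ⊆ Ioo (-δ) δ := fun s hs =>
    ⟨by linarith [hs.1, min_le_right η (δ / 2)], by linarith [hs.2, min_le_right η (δ / 2)]⟩
  rw [ContinuousMap.norm_le _ (by positivity)]
  intro x
  -- Mean value inequality for `F s x - s Φ(0, x)`, whose derivative is at most `ε` uniformly in `x`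
  -- by uniform continuity of `Φ`.
  have hmv := (convex_Ioo (-r) r).norm_image_sub_le_of_norm_hasDerivWithin_le
    (f := fun s => F s x - s * Φ (0, x)) (f' := fun s => Φ (s, x) - Φ (0, x)) (C := ε)
    (fun s hs => by
      have := (hder s (hsub hs) x x.2).sub ((hasDerivAt_id s).mul_const (Φ (0, x)))
      rw [one_mul] at this
      exact this.hasDerivWithinAt)
    (fun s hs => hΦr s hs x x.2) (show (0 : ℝ) ∈ Ioo (-r) r from ⟨by linarith, hrpos⟩) ht
  have heq : (unitRestrict (F t) - unitRestrict (F 0) - (t - 0) • unitRestrict fun x => Φ (0, x)) x =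
      F t x - t * Φ (0, x) - (F 0 x - 0 * Φ (0, x)) := by
    simp only [ContinuousMap.sub_apply, ContinuousMap.smul_apply, smul_eq_mul]
    rw [unitRestrict_apply (hFc t (hsub ht)), unitRestrict_apply (hFc 0 h0),
      unitRestrict_apply hσc]
    ring
  rw [heq]
  exact hmv

variable {V E : Type*} {G : DiscreteGraph V E} [Fintype E]

theorem exists_pos_le [Nonempty E] {a : EdgeFun E} (ha : ∀ e x, 0 < a e x) :
    ∃ m > 0, ∀ e x, m ≤ a e x := by
  have h : ∀ e, ∃ x, ∀ y, a e x ≤ a e y := fun e => by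
    obtain ⟨x, -, hx⟩ := isCompact_univ.exists_isMinOn
      (Set.univ_nonempty (α := Icc (0 : ℝ) 1)) (a e).continuous.continuousOn
    exact ⟨x, fun y => hx (mem_univ y)⟩
  choose x hx using h
  obtain ⟨e₀, he⟩ := Finite.exists_min fun e => a e (x e)
  exact ⟨a e₀ (x e₀), ha _ _, fun e y => (he e).trans (hx e y)⟩

theorem abs_apply_le_norm (a : EdgeFun E) (e : E) (x : Icc (0 : ℝ) 1) : |a e x| ≤ ‖a‖ :=
  ((a e).norm_coe_le_norm x).trans (norm_le_pi_norm a e)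

/-- A differentiable family of weights gives a first-order expansion of the forms, with error small
relative to the unperturbed form. -/
theorem weightForm_expand [Nonempty E] {a : ℝ → EdgeFun E} {a' : EdgeFun E}
    (h : HasDerivAt a a' 0) (ha : ∀ e x, 0 < a 0 e x) :
    (∃ C, ∀ f, |weightForm a' f f| ≤ C * weightForm (a 0) f f) ∧
    ∀ ε > 0, ∀ᶠ t in 𝓝 (0 : ℝ), ∀ f,
      |weightForm (a t) f f - weightForm (a 0) f f - t * weightForm a' f f| ≤
        ε * |t| * weightForm (a 0) f f := by
  -- A positive lower bound for the weight turns supremum-norm estimates into bounds relative to its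
  -- form.
  obtain ⟨m, hm, hma⟩ := exists_pos_le ha
  have key : ∀ (b : EdgeFun E) (K : ℝ), 0 ≤ K → ‖b‖ ≤ K * m → ∀ f,
      |weightForm b f f| ≤ K * weightForm (a 0) f f := by
    intro b K hK hb f
    rw [← weightForm_smul]
    refine abs_weightForm_le (fun e x => ?_) f
    exact ((abs_apply_le_norm b e x).trans hb).trans (mul_le_mul_of_nonneg_left (hma e x) hK)
  refine ⟨⟨‖a'‖ / m, key a' _ (by positivity) (by field_simp; exact le_rfl)⟩, fun ε hε => ?_⟩
  have h1 := (hasDerivAt_iff_isLittleO.1 h).def (mul_pos hε hm)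
  filter_upwards [h1] with t ht f
  rw [sub_zero, Real.norm_eq_abs] at ht
  have := key (a t - a 0 - t • a') (ε * |t|) (by positivity) (by linarith) f
  rwa [weightForm_sub, weightForm_sub, weightForm_smul] at this

theorem hasDerivAt_weightForm_one [Nonempty E] {a : ℝ → EdgeFun E} {a' : EdgeFun E}
    (h : HasDerivAt a a' 0) (ha : ∀ e x, 0 < a 0 e x) :
    HasDerivAt (fun t => weightForm (a t) 1 1) (weightForm a' 1 1) 0 := by
  rw [hasDerivAt_iff_isLittleO, Asymptotics.isLittleO_iff]
  intro ε hε
  have hA : 0 ≤ weightForm (a 0) 1 1 := weightForm_nonneg (fun e x => (ha e x).le) _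
  filter_upwards [(weightForm_expand h ha).2 (ε / (weightForm (a 0) 1 1 + 1)) (by positivity)]
    with t ht
  have h1 := ht 1
  rw [sub_zero, smul_eq_mul, Real.norm_eq_abs, Real.norm_eq_abs]
  refine h1.trans ?_
  calc _ = ε * |t| * (weightForm (a 0) 1 1 / (weightForm (a 0) 1 1 + 1)) := by ring
    _ ≤ ε * |t| * 1 := by
      refine mul_le_mul_of_nonneg_left ?_ (by positivity)
      rw [div_le_one (by positivity)]; linarith
    _ = _ := by ring

omit [Fintype E] in
theorem hasDerivAt_constEdge {l : ℝ → E → ℝ} {l' : E → ℝ} {t : ℝ}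
    (h : ∀ e, HasDerivAt (fun t => l t e) (l' e) t) :
    HasDerivAt (fun t => constEdge (l t)) (constEdge l') t := by
  have hc : ∀ l : E → ℝ, constEdge l = fun e => l e • (1 : C(Icc (0 : ℝ) 1, ℝ)) := fun l => by
    ext e x
    simp [constEdge]
  simp only [hc]
  exact hasDerivAt_pi.2 fun e => (h e).smul_const (1 : C(Icc (0 : ℝ) 1, ℝ))

omit [Fintype E] in
theorem edgeDensity_unitDensity : edgeDensity (unitDensity : E → ℝ → ℝ) = 1 := by
  ext e x
  exact unitRestrict_apply (f := unitDensity e) continuousOn_const x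

theorem totalMass_eq_weightForm {g : E → ℝ} {ρ : E → ℝ → ℝ}
    (hρ : ∀ e, ContinuousOn (ρ e) (Icc 0 1)) :
    totalMass g ρ = weightForm (constEdge (edgeLength g) * edgeDensity ρ) 1 1 := by
  rw [totalMass, weightForm_apply]
  refine Finset.sum_congr rfl fun e _ => ?_
  rw [← intervalIntegral.integral_const_mul]
  refine intervalIntegral.integral_congr fun x hx => ?_
  rw [uIcc_of_le zero_le_one] at hx
  simp only [Pi.mul_apply, lineExt_mul, lineExt_constEdge, Pi.one_apply, lineExt_one, mul_one,
    edgeDensity]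
  rw [lineExt_unitRestrict (hρ e) hx]; rfl

theorem totalMass_unitDensity (g : E → ℝ) : totalMass g unitDensity = totalLength g := by
  simp [totalMass, totalLength, unitDensity]

section Perturbation

variable [Fintype V] [Nonempty E] (hG : G.Connected) {g : E → ℝ} (hg : IsMetric g)
  {gt : ℝ → E → ℝ} {ρt : ℝ → E → ℝ → ℝ} (hg0 : gt 0 = g) (hρ0 : edgeDensity (ρt 0) = 1)
  {l' : E → ℝ} {σ : EdgeFun E} (hl' : ∀ e, HasDerivAt (fun t => √(gt t e)) (l' e) 0)
  (hσ : HasDerivAt (fun t => edgeDensity (ρt t)) σ 0)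
  (hev : ∀ᶠ t in 𝓝 (0 : ℝ), IsMetric (gt t) ∧ (∀ e, ContinuousOn (ρt t e) (Icc 0 1)) ∧
    ∀ e, ∀ x ∈ Icc (0 : ℝ) 1, 0 < ρt t e x)
include hg hg0 hρ0 hl' hσ

omit [Fintype V] [Nonempty E] hg in
theorem hasDerivAt_massWeight :
    HasDerivAt (fun t => constEdge (edgeLength (gt t)) * edgeDensity (ρt t))
      (constEdge l' + constEdge (edgeLength g) * σ) 0 := by
  have h := (hasDerivAt_constEdge (l := fun t => edgeLength (gt t)) hl').mul hσ
  rw [hρ0, mul_one, hg0] at h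
  exact h

include hev

include hG in
/-- The forms of a differentiable family of metrics and densities through `(g, 1)`. -/
theorem isPerturbation : Pencil.IsPerturbation (dirichletForm G g) (densityForm G g unitDensity)
    (energyForm G (constEdge fun e => -l' e / edgeLength g e ^ 2))
    (massForm G (constEdge l' + constEdge (edgeLength g) * σ))
    (fun t => dirichletForm G (gt t)) (fun t => densityForm G (gt t) (ρt t)) := by
  have hb : HasDerivAt (fun t => constEdge (edgeLength (gt t))⁻¹)
      (constEdge fun e => -l' e / edgeLength g e ^ 2) 0 := by
    refine hasDerivAt_constEdge (l := fun t => (edgeLength (gt t))⁻¹) fun e => ?_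
    have h := (hl' e).inv (by rw [hg0]; exact (edgeLength_pos hg e).ne')
    rw [hg0] at h
    exact h
  have ha := hasDerivAt_massWeight hg0 hρ0 hl' hσ
  have hb0 : ∀ e x, 0 < (fun t => constEdge (edgeLength (gt t))⁻¹) 0 e x := fun e x => by
    change 0 < constEdge (edgeLength (gt 0))⁻¹ e x
    rw [hg0]
    exact constEdge_inv_pos (edgeLength_pos hg) e x
  have ha0 : ∀ e x, 0 < (fun t => constEdge (edgeLength (gt t)) * edgeDensity (ρt t)) 0 e x := by
    intro e x
    change 0 < (constEdge (edgeLength (gt 0)) * edgeDensity (ρt 0)) e x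
    rw [hg0, hρ0, mul_one]
    exact edgeLength_pos hg e
  have hD : dirichletForm G g = energyForm G ((fun t => constEdge (edgeLength (gt t))⁻¹) 0) := by
    simp only [hg0]; rfl
  have hM : densityForm G g unitDensity =
      massForm G ((fun t => constEdge (edgeLength (gt t)) * edgeDensity (ρt t)) 0) := by
    simp only [hg0, hρ0]
    rw [densityForm, edgeDensity_unitDensity]
  obtain ⟨⟨C, hC⟩, hexp⟩ := weightForm_expand hb hb0
  obtain ⟨⟨C', hC'⟩, hexp'⟩ := weightForm_expand ha ha0
  rw [hD, hM]
  exact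
    { symmD' := fun x y => weightForm_symm _ _ _
      symmM' := fun x y => weightForm_symm _ _ _
      boundD' := ⟨C, fun x => hC _⟩
      boundM' := ⟨C', fun x => hC' _⟩
      expandD := fun ε hε => (hexp ε hε).mono fun t ht x => ht _
      expandM := fun ε hε => (hexp' ε hε).mono fun t ht x => ht _
      spectral := hev.mono fun t ht => isSpectral_pencil hG ht.1 ht.2.1 ht.2.2 }

/-- At density one the mass equals the length, so a change of lengths counts twice and a change of
density once. -/
theorem hasDerivAt_normalisation :
    HasDerivAt (fun t => totalLength (gt t) * totalMass (gt t) (ρt t))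
      (totalLength g * (2 * ∑ e, l' e + weightForm (constEdge (edgeLength g) * σ) 1 1)) 0 := by
  have ha := hasDerivAt_massWeight hg0 hρ0 hl' hσ
  have ha0 : ∀ e x, 0 < (fun t => constEdge (edgeLength (gt t)) * edgeDensity (ρt t)) 0 e x := by
    intro e x
    change 0 < (constEdge (edgeLength (gt 0)) * edgeDensity (ρt 0)) e x
    rw [hg0, hρ0, mul_one]
    exact edgeLength_pos hg e
  have h1 := hasDerivAt_weightForm_one ha ha0
  have h2 : HasDerivAt (fun t => totalMass (gt t) (ρt t))
      (weightForm (constEdge l' + constEdge (edgeLength g) * σ) 1 1) 0 :=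
    h1.congr_of_eventuallyEq (hev.mono fun t ht => totalMass_eq_weightForm ht.2.1)
  have h3 : HasDerivAt (fun t => totalLength (gt t)) (∑ e, l' e) 0 :=
    HasDerivAt.fun_sum fun e _ => hl' e
  have h4 : totalMass (gt 0) (ρt 0) = totalLength g := by
    rw [totalMass_eq_weightForm hev.self_of_nhds.2.1, hρ0, hg0, ← totalMass_unitDensity,
      totalMass_eq_weightForm (ρ := unitDensity) fun e => continuousOn_const,
      edgeDensity_unitDensity]
  have h5 : weightForm (constEdge l') 1 1 = ∑ e, l' e := by
    rw [weightForm_apply]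
    simp [lineExt_constEdge, lineExt_one]
  have h6 := h3.mul h2
  rw [h4, hg0, weightForm_add, h5] at h6
  exact h6.congr_deriv (by ring)

end Perturbation

end QuantumGraph

/-! ### Energy densities and squares of eigenfunctions. -/

namespace QuantumGraph

open Set

variable {V E : Type*} {G : DiscreteGraph V E} [Fintype E] {g : E → ℝ}

theorem densityForm_unitDensity (g : E → ℝ) :
    densityForm G g unitDensity = massForm G (constEdge (edgeLength g)) := by
  rw [densityForm, edgeDensity_unitDensity, mul_one]

/-- The energy density `|f'|² + l f²` of a function, with the derivative taken with respect to arc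
length. -/
noncomputable def energyDensity (g : E → ℝ) (l : ℝ) (y : testSpace G) : EdgeFun E :=
  constEdge (fun e => (edgeLength g e)⁻¹ ^ 2) * (derivFun y * derivFun y) +
    l • (valFun y * valFun y)

variable (G g) in
/-- The eigenspace of the unweighted eigenvalue problem. -/
noncomputable abbrev unitEigenspace (l : ℝ) : Submodule ℝ (testSpace G) :=
  Pencil.eigenspace (dirichletForm G g) (densityForm G g unitDensity) l

/-- The energy density of an eigenfunction is constant along each edge. -/
theorem energyDensity_eq [Fintype V] (hG : G.Connected) (hg : IsMetric g) {l : ℝ}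
    {y : testSpace G} (hy : y ∈ unitEigenspace G g l) (e : E) (x : Icc (0 : ℝ) 1) :
    energyDensity g l y e x = energyDensity g l y e 0 := by
  have hP := (solvesPoisson_iff_mem_eigenspace hG hg).2 hy
  have hder : IsDerivOf 0 (energyDensity g l y e) := by
    intro s hs
    have h1 := hP.equation e s hs
    have h2 := isDerivOf y e s hs
    rw [edgeDensity_unitDensity, one_mul] at h1
    have h3 := ((h1.mul h1).const_mul ((edgeLength g e)⁻¹ ^ 2)).add ((h2.mul h2).const_mul l)
    have hl := (edgeLength_pos hg e).ne'
    refine (h3.congr_deriv ?_)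
    simp only [lineExt_smul, Pi.smul_apply, lineExt_zero]
    field_simp
    ring
  have h0 : (0 : ℝ) ∈ Icc (0 : ℝ) 1 := ⟨le_rfl, zero_le_one⟩
  have h4 := hder.integral_eq h0 x.2 x.2.1
  simp only [lineExt_zero, intervalIntegral.integral_zero] at h4
  rw [lineExt_of_mem _ x.2, lineExt_of_mem _ h0] at h4
  exact sub_eq_zero.1 h4.symm

omit [Fintype E] in
theorem energyDensity_zero (g : E → ℝ) (l : ℝ) (y : testSpace G) (e : E) :
    energyDensity g l y e 0 =
      (edgeLength g e)⁻¹ ^ 2 * (derivFun y e 0) ^ 2 + l * (valFun y e 0) ^ 2 := by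
  simp only [energyDensity, Pi.add_apply, Pi.mul_apply, Pi.smul_apply, ContinuousMap.add_apply,
    ContinuousMap.mul_apply, ContinuousMap.smul_apply, constEdge, ContinuousMap.const_apply,
    smul_eq_mul]
  ring

/-- The edge integrals collapse because the energy density is constant on edges. Taking for `m` the
derivatives of the lengths, this is, up to sign, the metric part of the first variation. -/
theorem sum_mul_energyDensity [Fintype V] (hG : G.Connected) (hg : IsMetric g) {l : ℝ}
    {y : testSpace G} (hy : y ∈ unitEigenspace G g l) (m : E → ℝ) :
    weightForm (constEdge fun e => m e / edgeLength g e ^ 2) (derivFun y) (derivFun y) +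
      l * weightForm (constEdge m) (valFun y) (valFun y) =
      ∑ e, m e * energyDensity g l y e 0 := by
  rw [weightForm_apply, weightForm_apply, Finset.mul_sum, ← Finset.sum_add_distrib]
  refine Finset.sum_congr rfl fun e _ => ?_
  rw [← intervalIntegral.integral_const_mul, ← intervalIntegral.integral_add
    (Continuous.intervalIntegrable (by fun_prop) _ _)
    (Continuous.intervalIntegrable (by fun_prop) _ _)]
  have : ∀ x ∈ uIcc (0 : ℝ) 1,
      lineExt (constEdge (fun e => m e / edgeLength g e ^ 2) e) x * lineExt (derivFun y e) x *
        lineExt (derivFun y e) x + l * (lineExt (constEdge m e) x * lineExt (valFun y e) x *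
        lineExt (valFun y e) x) = m e * energyDensity g l y e 0 := fun x hx => by
    rw [uIcc_of_le zero_le_one] at hx
    rw [← energyDensity_eq hG hg hy e ⟨x, hx⟩, ← lineExt_of_mem _ hx]
    simp only [energyDensity, Pi.add_apply, Pi.mul_apply, Pi.smul_apply, lineExt_add, lineExt_mul,
      lineExt_smul, lineExt_constEdge, inv_pow]
    ring
  rw [intervalIntegral.integral_congr this]
  simp

/-- Zero Cauchy data at the start of an edge means zero energy density, hence `l y² = 0` along the
edge. The finitely many Cauchy data therefore determine `y`. -/
theorem finiteDimensional_unitEigenspace [Fintype V] (hG : G.Connected) (hg : IsMetric g) {l : ℝ}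
    (hl : 0 < l) : FiniteDimensional ℝ (unitEigenspace G g l) := by
  let L : unitEigenspace G g l →ₗ[ℝ] (E → ℝ) × (E → ℝ) :=
    { toFun := fun y => (fun e => valFun (y : testSpace G) e 0, fun e => derivFun (y : testSpace G) e 0)
      map_add' := fun x y => by ext <;> simp
      map_smul' := fun a x => by ext <;> simp }
  refine Module.Finite.of_injective L ?_
  rintro ⟨a, ha⟩ ⟨b, hb⟩ hab
  have hy : a - b ∈ unitEigenspace G g l := Submodule.sub_mem _ ha hb
  obtain ⟨y, hyab⟩ : ∃ y, y = a - b := ⟨_, rfl⟩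
  rw [← hyab] at hy
  have h2 : ∀ e, valFun y e 0 = 0 := fun e => by
    rw [hyab, map_sub]
    exact sub_eq_zero.2 (congrFun (congrArg Prod.fst hab) e)
  have h3 : ∀ e, derivFun y e 0 = 0 := fun e => by
    rw [hyab, map_sub]
    exact sub_eq_zero.2 (congrFun (congrArg Prod.snd hab) e)
  have h4 : valFun y = 0 := by
    ext e x
    have h5 := energyDensity_eq hG hg hy e x
    rw [energyDensity_zero, h2, h3] at h5
    simp only [energyDensity, Pi.add_apply, Pi.mul_apply, Pi.smul_apply, ContinuousMap.add_apply,
      ContinuousMap.mul_apply, ContinuousMap.smul_apply, constEdge, ContinuousMap.const_apply,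
      smul_eq_mul] at h5
    have h6 : l * (valFun y e x * valFun y e x) = 0 := by
      have e1 : 0 ≤ l * (valFun y e x * valFun y e x) := mul_nonneg hl.le (mul_self_nonneg _)
      have e2 : 0 ≤ (edgeLength g e)⁻¹ ^ 2 * (derivFun y e x * derivFun y e x) :=
        mul_nonneg (sq_nonneg _) (mul_self_nonneg _)
      linarith
    exact mul_self_eq_zero.1 ((mul_eq_zero.1 h6).resolve_left hl.ne')
  have h0 : y = 0 := valFun_injective (h4.trans (map_zero _).symm)
  exact Subtype.ext (sub_eq_zero.1 (hyab.symm.trans h0))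

/-- Weak form of `-(y²)'' = 4 l y² - 2 (|y'|² + l y²)`, obtained by testing the equation of `y`
against `y h`. -/
theorem dirichletForm_mulTest_self (hg : IsMetric g) {l : ℝ} {y : testSpace G}
    (hy : y ∈ unitEigenspace G g l) (h : testSpace G) :
    dirichletForm G g (mulTest y y) h =
      4 * l * weightForm (constEdge (edgeLength g)) (valFun y * valFun y) (valFun h) -
        2 * weightForm (constEdge (edgeLength g)) (energyDensity g l y) (valFun h) := by
  have h1 := Pencil.mem_eigenspace.1 hy (mulTest y h)
  rw [densityForm_unitDensity, massForm_apply, dirichletForm, energyForm_apply, valFun_mulTest,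
    derivFun_mulTest, map_add, ← weightForm_mul_mid, ← weightForm_mul_mid, ← weightForm_mul_mid]
    at h1
  have h2 : weightForm (constEdge (edgeLength g)) (energyDensity g l y) (valFun h) =
      weightForm (constEdge (edgeLength g)⁻¹) (derivFun y * derivFun y) (valFun h) +
        l * weightForm (constEdge (edgeLength g)) (valFun y * valFun y) (valFun h) := by
    rw [energyDensity, map_add, LinearMap.add_apply, map_smul, LinearMap.smul_apply, smul_eq_mul,
      ← weightForm_mul_left]
    congr 4
    ext e x
    have := (edgeLength_pos hg e).ne'
    simp only [Pi.mul_apply, ContinuousMap.mul_apply, constEdge, ContinuousMap.const_apply,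
      Pi.inv_apply]
    field_simp
  have h3 : dirichletForm G g (mulTest y y) h =
      2 * weightForm (constEdge (edgeLength g)⁻¹) (valFun y * derivFun y) (derivFun h) := by
    rw [dirichletForm, energyForm_apply, derivFun_mulTest, map_add, LinearMap.add_apply,
      mul_comm (derivFun y)]
    ring
  rw [h2, h3]
  linarith

/-- If the weighted energy densities of some eigenfunctions add up to the same constant on all
edges, and four times the eigenvalue is not an eigenvalue, then their squares add up to a
constant. -/
theorem sum_sq_eq_const [Fintype V] (hG : G.Connected) (hg : IsMetric g) {l : ℝ} {ι : Type*}
    [Fintype ι] (c : ι → ℝ) (y : ι → testSpace G) (hy : ∀ i, y i ∈ unitEigenspace G g l) {κ : ℝ}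
    (hκ : ∀ e, ∑ i, c i * energyDensity g l (y i) e 0 = 2 * l * κ)
    (h4 : ¬IsEigenvalue G g unitDensity (4 * l)) :
    ∑ i, c i • (valFun (y i) * valFun (y i)) = κ • (1 : EdgeFun E) := by
  -- By the identity for `y²` and `hκ`, the source is `4 l ∑ c y² - 4 l κ = 4 l v`, so `v` lies in
  -- the eigenspace of `4 l`.
  set v : testSpace G := ∑ i, c i • mulTest (y i) (y i) - κ • oneTest G with hv
  have hval : valFun v = ∑ i, c i • (valFun (y i) * valFun (y i)) - κ • (1 : EdgeFun E) := by
    rw [hv, map_sub, map_smul, map_sum, valFun_oneTest]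
    simp only [map_smul, valFun_mulTest]
  have hen : ∑ i, c i • energyDensity g l (y i) = (2 * l * κ) • (1 : EdgeFun E) := by
    ext e x
    simp only [Finset.sum_apply, Pi.smul_apply, ContinuousMap.coe_sum, ContinuousMap.smul_apply,
      smul_eq_mul, Pi.one_apply, ContinuousMap.one_apply, mul_one]
    rw [← hκ e]
    exact Finset.sum_congr rfl fun i _ => by rw [energyDensity_eq hG hg (hy i)]
  have hmem : v ∈ unitEigenspace G g (4 * l) := by
    rw [Pencil.mem_eigenspace]
    intro h
    have h1 : dirichletForm G g (oneTest G) h = 0 := by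
      simp [dirichletForm, energyForm_apply]
    have h2 : ∑ i, c i * weightForm (constEdge (edgeLength g)) (energyDensity g l (y i)) (valFun h) =
        (2 * l * κ) * weightForm (constEdge (edgeLength g)) 1 (valFun h) := by
      have := congrArg (fun f => weightForm (constEdge (edgeLength g)) f (valFun h)) hen
      simpa only [map_sum, map_smul, LinearMap.sum_apply, LinearMap.smul_apply, smul_eq_mul]
        using this
    rw [densityForm_unitDensity, massForm_apply, hval]
    rw [hv, map_sub (dirichletForm G g), LinearMap.sub_apply, map_smul (dirichletForm G g),
      LinearMap.smul_apply, h1, smul_zero, sub_zero]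
    simp only [map_sum, map_smul, map_sub, LinearMap.sum_apply, LinearMap.sub_apply,
      LinearMap.smul_apply, smul_eq_mul, dirichletForm_mulTest_self hg (hy _), mul_sub,
      Finset.sum_sub_distrib, Finset.mul_sum]
    have h3 : ∑ i, c i * (2 * weightForm (constEdge (edgeLength g)) (energyDensity g l (y i))
        (valFun h)) = 4 * l * (κ * weightForm (constEdge (edgeLength g)) 1 (valFun h)) := by
      have e1 : ∀ i, c i * (2 * weightForm (constEdge (edgeLength g)) (energyDensity g l (y i))
        (valFun h)) = 2 * (c i * weightForm (constEdge (edgeLength g)) (energyDensity g l (y i))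
        (valFun h)) := fun i => by ring
      rw [Finset.sum_congr rfl fun i _ => e1 i, ← Finset.mul_sum, h2]
      ring
    rw [h3]
    congr 1
    exact Finset.sum_congr rfl fun i _ => by ring
  by_contra hne
  refine h4 (isEigenvalue_of_mem_eigenspace hG hg (fun e => continuousOn_const) hmem fun h0 => ?_)
  rw [h0, map_zero] at hval
  exact hne (sub_eq_zero.1 hval.symm)

end QuantumGraph

/-! ### Convex separation. -/

section Convexity

open Set

/-- In a finite-dimensional space the convex hull of a compact set is compact. -/
theorem IsCompact.convexHull_of_finiteDimensional {F : Type*} [NormedAddCommGroup F]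
    [NormedSpace ℝ F] [FiniteDimensional ℝ F] {s : Set F} (hs : IsCompact s) :
    IsCompact (convexHull ℝ s) := by
  -- Carathéodory: `N` points suffice, so the hull is a continuous image of a compact set.
  set N := Module.finrank ℝ F + 1 with hN
  have key : convexHull ℝ s = (fun p : (Fin N → ℝ) × (Fin N → F) => ∑ i, p.1 i • p.2 i) ''
      (stdSimplex ℝ (Fin N) ×ˢ univ.pi fun _ => s) := by
    refine Subset.antisymm (fun x hx => ?_) ?_
    · rw [convexHull_eq_union] at hx
      simp only [mem_iUnion] at hx
      obtain ⟨t, hts, hind, hxt⟩ := hx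
      have hne : t.Nonempty := by
        rw [← Finset.coe_nonempty, ← convexHull_nonempty_iff (𝕜 := ℝ)]
        exact ⟨x, hxt⟩
      have : Nonempty t := hne.to_subtype
      have hcard : Fintype.card t ≤ Fintype.card (Fin N) := by
        rw [Fintype.card_fin]
        exact hind.card_le_finrank_succ.trans (Nat.succ_le_succ (Submodule.finrank_le _))
      obtain ⟨φ⟩ := Function.Embedding.nonempty_of_card_le hcard
      -- Fewer than `N` points are padded by repetition.
      have hsurj : Function.Surjective (Function.invFun φ) := Function.invFun_surjective φ.injective
      set f : Fin N → F := fun i => ((Function.invFun φ i : t) : F) with hf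
      have hrange : range f = t := by
        have := hsurj.range_comp (Subtype.val : t → F)
        rwa [Subtype.range_coe] at this
      have himg : Fintype.linearCombination ℝ f '' stdSimplex ℝ (Fin N) = convexHull ℝ (t : Set F) := by
        rw [← convexHull_rangle_single_eq_stdSimplex, LinearMap.image_convexHull, ← range_comp,
          ← hrange]
        congr 2
        ext i
        simp [Fintype.linearCombination_apply_single]
      rw [← himg] at hxt
      obtain ⟨w, hw, hwx⟩ := hxt
      exact ⟨(w, f), ⟨hw, fun i _ => hts (Function.invFun φ i).2⟩, hwx⟩
    · rintro _ ⟨⟨w, f⟩, ⟨hw, hf⟩, rfl⟩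
      exact (convex_convexHull ℝ s).sum_mem (fun i _ => hw.1 i) hw.2
        fun i _ => subset_convexHull ℝ s (hf i trivial)
  rw [key]
  exact ((isCompact_stdSimplex ℝ (Fin N)).prod (isCompact_univ_pi fun _ => hs)).image
    (by fun_prop)

/-- An alternative for a finite family of homogeneous quadratic functions: either a positive
combination of their values vanishes, or some linear combination of them is positive. -/
theorem exists_sum_eq_zero_or_exists_forall_le {E : Type*} [Fintype E] {n : ℕ}
    {q : (Fin n → ℝ) → E → ℝ} {N : (Fin n → ℝ) → ℝ} (hq : Continuous q) (hN : Continuous N)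
    (hqs : ∀ (a : ℝ) x, q (a • x) = a ^ 2 • q x) (hNs : ∀ (a : ℝ) x, N (a • x) = a ^ 2 * N x)
    (hpos : ∀ x, x ≠ 0 → 0 < N x) :
    (∃ (ι : Type) (_ : Fintype ι) (c : ι → ℝ) (x : ι → Fin n → ℝ), (∀ i, 0 ≤ c i) ∧
      (∀ i, x i ≠ 0) ∧ ∑ i, c i • q (x i) = 0 ∧ ∑ i, c i * N (x i) = 1) ∨
    ∃ (m : E → ℝ) (κ : ℝ), 0 < κ ∧ ∀ x, κ * N x ≤ ∑ e, m e * q x e := by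
  -- Dividing by `N` makes the quotients homogeneous of degree zero, so the unit sphere captures all
  -- of them.
  set S : Set (E → ℝ) := (fun x => (N x)⁻¹ • q x) '' Metric.sphere (0 : Fin n → ℝ) 1 with hS
  have hne : ∀ x ∈ Metric.sphere (0 : Fin n → ℝ) 1, x ≠ 0 := fun x hx h => by
    simp [h] at hx
  have hSc : IsCompact S := (isCompact_sphere _ _).image_of_continuousOn
    ((hN.continuousOn.inv₀ fun x hx => (hpos x (hne x hx)).ne').smul hq.continuousOn)
  by_cases h0 : (0 : E → ℝ) ∈ convexHull ℝ S
  · left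
    obtain ⟨ι, _, w, z, hw0, hw1, hz, hsum⟩ := mem_convexHull_iff_exists_fintype.1 h0
    choose x hx hxz using hz
    refine ⟨ι, inferInstance, fun i => w i * (N (x i))⁻¹, x,
      fun i => mul_nonneg (hw0 i) (inv_nonneg.2 (hpos _ (hne _ (hx i))).le),
      fun i => hne _ (hx i), ?_, ?_⟩
    · rw [← hsum]
      exact Finset.sum_congr rfl fun i _ => by rw [← hxz, smul_smul]
    · rw [← hw1]
      refine Finset.sum_congr rfl fun i _ => ?_
      rw [mul_assoc, inv_mul_cancel₀ (hpos _ (hne _ (hx i))).ne', mul_one]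
  · right
    -- Strict separation of `0` from the closed hull; `m` lists the coefficients of the functional
    -- `f`, and `u` serves as `κ`.
    obtain ⟨f, u, hfu, hu⟩ := geometric_hahn_banach_point_closed (convex_convexHull ℝ S)
      hSc.convexHull_of_finiteDimensional.isClosed h0
    rw [map_zero] at hfu
    classical
    refine ⟨fun e => f fun j => if e = j then 1 else 0, u, hfu, fun x => ?_⟩
    have hf : ∀ v : E → ℝ, ∑ e, f (fun j => if e = j then 1 else 0) * v e = f v := fun v => by
      have := LinearMap.pi_apply_eq_sum_univ (f : (E → ℝ) →ₗ[ℝ] ℝ) v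
      simp only [ContinuousLinearMap.coe_coe, smul_eq_mul] at this
      rw [this]
      exact Finset.sum_congr rfl fun e _ => mul_comm _ _
    rw [hf]
    by_cases hx : x = 0
    · have h1 := hNs 0 x
      have h2 := hqs 0 x
      rw [zero_smul, zero_pow two_ne_zero, zero_mul] at h1
      rw [zero_smul, zero_pow two_ne_zero, zero_smul] at h2
      rw [hx, h1, h2, map_zero, mul_zero]
    · have hxn : ‖x‖ ≠ 0 := norm_ne_zero_iff.2 hx
      have hmem : ‖x‖⁻¹ • x ∈ Metric.sphere (0 : Fin n → ℝ) 1 := by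
        rw [mem_sphere_zero_iff_norm, norm_smul, norm_inv, norm_norm, inv_mul_cancel₀ hxn]
      have h1 := (hu _ (subset_convexHull ℝ S ⟨_, hmem, rfl⟩)).le
      have hNx := hpos x hx
      simp only [hqs, hNs, smul_smul, map_smul, smul_eq_mul] at h1
      have h2 : (‖x‖⁻¹ ^ 2 * N x)⁻¹ * ‖x‖⁻¹ ^ 2 * f (q x) = f (q x) / N x := by
        field_simp
      rw [h2, le_div_iff₀ hNx] at h1
      exact h1

end Convexity

/-! ### Error terms of order `o(t)`. -/

namespace QuantumGraph

open Set

theorem leUpToLittleO_of_forall {φ : ℝ → ℝ} {a : ℝ}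
    (h : ∀ ε > 0, ∀ᶠ t in 𝓝 (0 : ℝ), φ t ≤ a + ε * |t|) : LeUpToLittleO φ a := by
  refine ⟨fun t => max (φ t - a) 0, ?_, .of_forall fun t => by linarith [le_max_left (φ t - a) 0]⟩
  rw [Asymptotics.isLittleO_iff]
  intro ε hε
  filter_upwards [h ε hε] with t ht
  rw [Real.norm_eq_abs, abs_of_nonneg (le_max_right _ _), Real.norm_eq_abs]
  exact max_le (by linarith) (by positivity)

theorem geUpToLittleO_of_forall {φ : ℝ → ℝ} {a : ℝ}
    (h : ∀ ε > 0, ∀ᶠ t in 𝓝 (0 : ℝ), a - ε * |t| ≤ φ t) : GeUpToLittleO φ a := by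
  obtain ⟨r, hr, hle⟩ := leUpToLittleO_of_forall (φ := fun t => -φ t) (a := -a)
    fun ε hε => (h ε hε).mono fun t ht => by linarith
  exact ⟨fun t => -r t, hr.neg_left, hle.mono fun t ht => by linarith⟩

/-- A first-order upper bound for a quotient gives one for the numerator. -/
theorem mul_le_of_le_div {φ P : ℝ → ℝ} {F κ : ℝ} {p : ℝ → Prop} (hP : ContinuousAt P 0)
    (hP0 : 0 < P 0)
    (h : ∀ ε > 0, ∀ᶠ t in 𝓝 (0 : ℝ), p t → φ t ≤ F / P t + κ * t + ε * |t|) {ε : ℝ} (hε : 0 < ε) :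
    ∀ᶠ t in 𝓝 (0 : ℝ), p t → φ t * P t ≤ F + κ * t * P t + ε * |t| := by
  filter_upwards [h (ε / (2 * P 0)) (by positivity), hP.eventually_lt_const
    (show P 0 < 2 * P 0 by linarith), hP.eventually_const_lt hP0] with t ht h1 h2 hpt
  have h3 := mul_le_mul_of_nonneg_right (ht hpt) h2.le
  have h4 : ε / (2 * P 0) * |t| * P t ≤ ε / (2 * P 0) * |t| * (2 * P 0) :=
    mul_le_mul_of_nonneg_left h1.le (by positivity)
  have h5 : ε / (2 * P 0) * |t| * (2 * P 0) = ε * |t| := by field_simp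
  have h6 : F / P t * P t = F := div_mul_cancel₀ _ h2.ne'
  rw [add_mul, add_mul, h6] at h3
  linarith

theorem le_mul_of_div_le {φ P : ℝ → ℝ} {F κ : ℝ} {p : ℝ → Prop} (hP : ContinuousAt P 0)
    (hP0 : 0 < P 0)
    (h : ∀ ε > 0, ∀ᶠ t in 𝓝 (0 : ℝ), p t → F / P t + κ * t - ε * |t| ≤ φ t) {ε : ℝ} (hε : 0 < ε) :
    ∀ᶠ t in 𝓝 (0 : ℝ), p t → F + κ * t * P t - ε * |t| ≤ φ t * P t := by
  have := mul_le_of_le_div (φ := fun t => -φ t) (F := -F) (κ := -κ) (p := p) hP hP0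
    (fun ε hε => (h ε hε).mono fun t ht hpt => by
      have := ht hpt
      rw [neg_div]
      linarith) hε
  exact this.mono fun t ht hpt => by linarith [ht hpt]

end QuantumGraph

/-! ### First variation and the separation alternative. -/

namespace QuantumGraph

open Set

theorem not_geUpToLittleO {φ P : ℝ → ℝ} {F κ : ℝ} (hP : ContinuousAt P 0) (hP0 : 0 < P 0)
    (hκ : 0 < κ) (h : ∀ ε > 0, ∀ᶠ t in 𝓝 (0 : ℝ), t ≤ 0 → φ t ≤ F + κ * t * P t + ε * |t|) :
    ¬GeUpToLittleO φ F := by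
  rintro ⟨r, hr, hle⟩
  -- For small `t < 0` the upper bound is `F - (1/2 - 1/8) κ P(0) |t|`, while `r` lowers `F` by at
  -- most `κ P(0) |t| / 8`.
  have hε : 0 < κ * P 0 / 8 := by positivity
  have hev := (h _ hε).and ((hr.def hε).and (hle.and
    (hP.eventually_const_lt (show P 0 / 2 < P 0 by linarith))))
  obtain ⟨t, ⟨h1, h2, h3, h4⟩, ht⟩ :=
    ((hev.filter_mono nhdsWithin_le_nhds).and (self_mem_nhdsWithin (s := Iio (0 : ℝ)))).exists
  have ht' : t < 0 := ht
  have h5 := h1 ht'.le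
  rw [Real.norm_eq_abs, Real.norm_eq_abs] at h2
  have h6 := (abs_le.1 h2).1
  rw [abs_of_neg ht'] at h5 h6
  have h7 : κ * t * P t ≤ κ * t * (P 0 / 2) :=
    mul_le_mul_of_nonpos_left h4.le (mul_nonpos_of_nonneg_of_nonpos hκ.le ht'.le)
  have h8 : 0 < κ * P 0 * -t := mul_pos (by positivity) (by linarith)
  nlinarith

theorem not_leUpToLittleO {φ P : ℝ → ℝ} {F κ : ℝ} (hP : ContinuousAt P 0) (hP0 : 0 < P 0)
    (hκ : 0 < κ) (h : ∀ ε > 0, ∀ᶠ t in 𝓝 (0 : ℝ), 0 ≤ t → F + κ * t * P t - ε * |t| ≤ φ t) :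
    ¬LeUpToLittleO φ F := by
  rintro ⟨r, hr, hle⟩
  have hε : 0 < κ * P 0 / 8 := by positivity
  have hev := (h _ hε).and ((hr.def hε).and (hle.and
    (hP.eventually_const_lt (show P 0 / 2 < P 0 by linarith))))
  obtain ⟨t, ⟨h1, h2, h3, h4⟩, ht⟩ :=
    ((hev.filter_mono nhdsWithin_le_nhds).and (self_mem_nhdsWithin (s := Ioi (0 : ℝ)))).exists
  have ht' : 0 < t := ht
  have h5 := h1 ht'.le
  rw [Real.norm_eq_abs, Real.norm_eq_abs] at h2
  have h6 := (abs_le.1 h2).2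
  rw [abs_of_pos ht'] at h5 h6
  have h7 : κ * t * (P 0 / 2) ≤ κ * t * P t :=
    mul_le_mul_of_nonneg_left h4.le (by positivity)
  have h8 : 0 < κ * P 0 * t := mul_pos (by positivity) ht'
  nlinarith

theorem exists_linear_parametrisation {X : Type*} [AddCommGroup X] [Module ℝ X]
    (S : Submodule ℝ X) [FiniteDimensional ℝ S] :
    ∃ (n : ℕ) (Φ : (Fin n → ℝ) →ₗ[ℝ] X), (∀ x, x ≠ 0 → Φ x ≠ 0) ∧ (∀ x, Φ x ∈ S) ∧
      ∀ y ∈ S, ∃ x, Φ x = y := by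
  let b := Module.finBasis ℝ S
  exact ⟨_, S.subtype ∘ₗ b.equivFun.symm.toLinearMap,
    fun x hx h => hx (b.equivFun.symm.map_eq_zero_iff.1 (Subtype.ext h)),
    fun x => (b.equivFun.symm x).2, fun y hy => ⟨b.equivFun ⟨y, hy⟩, by simp⟩⟩

variable {V E : Type*} {G : DiscreteGraph V E} [Fintype E] {g : E → ℝ}

theorem totalLength_pos [Nonempty E] (hg : IsMetric g) : 0 < totalLength g :=
  Finset.sum_pos (fun e _ => edgeLength_pos hg e) Finset.univ_nonempty

theorem densityForm_unitDensity_pos (hg : IsMetric g) {y : testSpace G} (hy : y ≠ 0) :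
    0 < densityForm G g unitDensity y y := by
  rw [densityForm_unitDensity]
  exact massForm_pos (constEdge_pos (edgeLength_pos hg)) hy

/-- Equipartition: the two halves of the energy agree since `D y y = l M y y`. It explains the
constant `2 l / L` for combinations of total mass one. -/
theorem sum_edgeLength_mul_energyDensity [Fintype V] (hG : G.Connected) (hg : IsMetric g) {l : ℝ}
    {y : testSpace G} (hy : y ∈ unitEigenspace G g l) :
    ∑ e, edgeLength g e * energyDensity g l y e 0 = 2 * l * densityForm G g unitDensity y y := by
  rw [← sum_mul_energyDensity hG hg hy]
  have h1 := Pencil.mem_eigenspace.1 hy y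
  have h2 : (constEdge fun e => edgeLength g e / edgeLength g e ^ 2) =
      constEdge (edgeLength g)⁻¹ := by
    congr 1
    ext e
    have := (edgeLength_pos hg e).ne'
    rw [Pi.inv_apply]
    field_simp
  have h3 : weightForm (constEdge (edgeLength g)⁻¹) (derivFun y) (derivFun y) =
    dirichletForm G g y y := rfl
  rw [h2, h3, h1, densityForm_unitDensity, massForm_apply]
  ring

/-- The first variation of the Rayleigh quotient at an eigenfunction. -/
theorem variation_apply [Fintype V] (hG : G.Connected) (hg : IsMetric g) {l : ℝ}
    {y : testSpace G} (hy : y ∈ unitEigenspace G g l) (l' : E → ℝ) (b : EdgeFun E) (c' : ℝ) :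
    (energyForm G (constEdge fun e => -l' e / edgeLength g e ^ 2) - l • massForm G (constEdge l' + b)
      - c' • densityForm G g unitDensity) y y =
      -(∑ e, l' e * energyDensity g l y e 0) - l * weightForm b (valFun y) (valFun y) -
        c' * densityForm G g unitDensity y y := by
  have h1 := sum_mul_energyDensity hG hg hy fun e => -l' e
  have h2 : (constEdge fun e => -l' e) = (-1 : ℝ) • constEdge l' := by
    ext e x
    simp [constEdge]
  rw [h2, weightForm_smul] at h1
  simp only [LinearMap.sub_apply, LinearMap.smul_apply, smul_eq_mul, energyForm_apply,
    massForm_apply, weightForm_add]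
  simp only [neg_mul, Finset.sum_neg_distrib] at h1
  linarith

/-- Constants make `0` an eigenvalue, so `4 l = 0` is excluded. -/
theorem pos_of_not_isEigenvalue [Fintype V] (hG : G.Connected) (hg : IsMetric g) [Nonempty E] {l : ℝ}
    (hl : 0 ≤ l) (h4 : ¬IsEigenvalue G g unitDensity (4 * l)) : 0 < l := by
  refine lt_of_le_of_ne hl fun h0 => h4 ?_
  rw [← h0, mul_zero]
  refine isEigenvalue_of_mem_eigenspace hG hg (fun e => continuousOn_const) (w := oneTest G) ?_ ?_
  · rw [Pencil.mem_eigenspace]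
    intro h
    simp [dirichletForm, energyForm_apply]
  · intro h
    have := congrArg valFun h
    rw [valFun_oneTest, map_zero] at this
    exact one_ne_zero this

/-- Either the excess energy densities of the eigenfunctions have a vanishing positive combination,
or a linear functional is positive on all of them. -/
theorem exists_energyDensity_combination [Fintype V] [Nonempty E] (hG : G.Connected)
    (hg : IsMetric g) {l : ℝ} (hl : 0 < l) :
    (∃ (ι : Type) (_ : Fintype ι) (c : ι → ℝ) (y : ι → testSpace G), (∀ i, 0 ≤ c i) ∧
      (∀ i, y i ∈ unitEigenspace G g l) ∧ (∀ i, y i ≠ 0) ∧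
      (∀ e, ∑ i, c i * energyDensity g l (y i) e 0 = 2 * l * (totalLength g)⁻¹) ∧
      ∑ i, c i * densityForm G g unitDensity (y i) (y i) = 1) ∨
    ∃ (m : E → ℝ) (κ : ℝ), 0 < κ ∧ ∀ y ∈ unitEigenspace G g l,
      κ * densityForm G g unitDensity y y ≤ ∑ e, m e * (energyDensity g l y e 0 -
        2 * l * (totalLength g)⁻¹ * densityForm G g unitDensity y y) := by
  have := finiteDimensional_unitEigenspace hG hg hl
  obtain ⟨n, Φ, hΦ0, hΦ, hsurj⟩ := exists_linear_parametrisation (unitEigenspace G g l)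
  have hen : ∀ e, Continuous fun x => energyDensity g l (Φ x) e 0 := fun e => by
    let f₁ : (Fin n → ℝ) →ₗ[ℝ] ℝ :=
      { toFun := fun x => valFun (Φ x) e 0
        map_add' := fun x y => by simp
        map_smul' := fun a x => by simp }
    let f₂ : (Fin n → ℝ) →ₗ[ℝ] ℝ :=
      { toFun := fun x => derivFun (Φ x) e 0
        map_add' := fun x y => by simp
        map_smul' := fun a x => by simp }
    have h₁ : Continuous fun x => valFun (Φ x) e 0 := f₁.continuous_of_finiteDimensional
    have h₂ : Continuous fun x => derivFun (Φ x) e 0 := f₂.continuous_of_finiteDimensional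
    simp only [energyDensity_zero]
    fun_prop
  have hM : Continuous fun x => densityForm G g unitDensity (Φ x) (Φ x) := by
    -- Equipartition expresses the mass through the finitely many energy densities, which are
    -- visibly continuous in `x`.
    have : ∀ x, densityForm G g unitDensity (Φ x) (Φ x) =
        (2 * l)⁻¹ * ∑ e, edgeLength g e * energyDensity g l (Φ x) e 0 := fun x => by
      rw [sum_edgeLength_mul_energyDensity hG hg (hΦ x)]
      field_simp
    simp only [this]
    fun_prop
  have hsM : ∀ (a : ℝ) x, densityForm G g unitDensity (Φ (a • x)) (Φ (a • x)) =
      a ^ 2 * densityForm G g unitDensity (Φ x) (Φ x) := fun a x => by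
    simp only [map_smul, LinearMap.smul_apply, smul_eq_mul]
    ring
  rcases exists_sum_eq_zero_or_exists_forall_le
    (q := fun x e => energyDensity g l (Φ x) e 0 -
        2 * l * (totalLength g)⁻¹ * densityForm G g unitDensity (Φ x) (Φ x))
    (N := fun x => densityForm G g unitDensity (Φ x) (Φ x)) (by fun_prop) hM
    (fun a x => by
      ext e
      rw [hsM]
      simp only [energyDensity_zero, map_smul, Pi.smul_apply, ContinuousMap.smul_apply, smul_eq_mul]
      ring) hsM (fun x hx => densityForm_unitDensity_pos hg (hΦ0 x hx)) with
    ⟨ι, _, c, x, hc, hx, h0, h1⟩ | ⟨m, κ, hκ, h⟩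
  · refine Or.inl ⟨ι, inferInstance, c, fun i => Φ (x i), hc, fun i => hΦ _,
      fun i => hΦ0 _ (hx i), fun e => ?_, h1⟩
    have h2 := congrFun h0 e
    simp only [Finset.sum_apply, Pi.smul_apply, smul_eq_mul, mul_sub, Finset.sum_sub_distrib,
      Pi.zero_apply] at h2
    have h3 : ∑ i, 2 * l * (totalLength g)⁻¹ *
        (c i * densityForm G g unitDensity (Φ (x i)) (Φ (x i))) = 2 * l * (totalLength g)⁻¹ := by
      rw [← Finset.mul_sum, h1, mul_one]
    exact (sub_eq_zero.1 h2).trans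
      (Eq.trans (Finset.sum_congr rfl fun i _ => by ring) h3)
  · refine Or.inr ⟨m, κ, hκ, fun y hy => ?_⟩
    obtain ⟨x, rfl⟩ := hsurj y hy
    exact h x

section Family

variable [Fintype V] [Nonempty E] (hG : G.Connected) (hg : IsMetric g)
  {gt : ℝ → E → ℝ} {ρt : ℝ → E → ℝ → ℝ} (hg0 : gt 0 = g) (hρ0 : edgeDensity (ρt 0) = 1)
  {l' : E → ℝ} {σ : EdgeFun E} (hl' : ∀ e, HasDerivAt (fun t => √(gt t e)) (l' e) 0)
  (hσ : HasDerivAt (fun t => edgeDensity (ρt t)) σ 0)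
  (hev : ∀ᶠ t in 𝓝 (0 : ℝ), IsMetric (gt t) ∧ (∀ e, ContinuousOn (ρt t e) (Icc 0 1)) ∧
    ∀ e, ∀ x ∈ Icc (0 : ℝ) 1, 0 < ρt t e x)
include hg hg0 hρ0 hl' hσ hev

omit [Fintype V] [Nonempty E] hg hl' hσ in
theorem normalisation_zero :
    totalLength (gt 0) * totalMass (gt 0) (ρt 0) = totalLength g ^ 2 := by
  rw [totalMass_eq_weightForm hev.self_of_nhds.2.1, hρ0, hg0, sq, ← totalMass_unitDensity,
    totalMass_eq_weightForm (ρ := unitDensity) fun e => continuousOn_const,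
    edgeDensity_unitDensity]

-- The comparison curve is the eigenvalue whose normalisation stays at `l L²`, tilted by `κ t`. A
-- slope `κ > 0` detects growth to be refuted at an extremal metric; `κ = 0` is used for the final
-- bound.
omit [Fintype V] in
theorem hasDerivAt_comparison (l κ : ℝ) :
    HasDerivAt (fun t => l * totalLength g ^ 2 / (totalLength (gt t) * totalMass (gt t) (ρt t)) +
      κ * t) (κ - l * (totalLength g)⁻¹ *
        (2 * ∑ e, l' e + weightForm (constEdge (edgeLength g) * σ) 1 1)) 0 := by
  have h1 := hasDerivAt_normalisation hg hg0 hρ0 hl' hσ hev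
  have h2 := normalisation_zero hg0 hρ0 hev
  have hL := (totalLength_pos hg).ne'
  have h3 := ((h1.fun_inv (by rw [h2]; positivity)).const_mul (l * totalLength g ^ 2)).add
    ((hasDerivAt_id (0 : ℝ)).const_mul κ)
  refine (h3.congr_deriv ?_)
  rw [h2]
  field_simp
  ring

include hG

theorem normalised_le {k : ℕ} {F κ : ℝ} {p : ℝ → Prop}
    (h : ∀ ε > 0, ∀ᶠ t in 𝓝 (0 : ℝ), p t →
      Pencil.eigenvalue (dirichletForm G (gt t)) (densityForm G (gt t) (ρt t)) k ≤
        F / (totalLength (gt t) * totalMass (gt t) (ρt t)) + κ * t + ε * |t|) {ε : ℝ} (hε : 0 < ε) :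
    ∀ᶠ t in 𝓝 (0 : ℝ), p t → normalisedEigenvalueWithDensity G k (gt t) (ρt t) ≤
      F + κ * t * (totalLength (gt t) * totalMass (gt t) (ρt t)) + ε * |t| := by
  have h1 := hasDerivAt_normalisation hg hg0 hρ0 hl' hσ hev
  have h2 := normalisation_zero hg0 hρ0 hev
  have hL := totalLength_pos hg
  filter_upwards [mul_le_of_le_div h1.continuousAt (by rw [h2]; positivity) h hε, hev]
    with t ht ht' hpt
  rw [normalisedEigenvalueWithDensity, eigenvalue_eq_pencil hG ht'.1 ht'.2.1, mul_assoc]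
  exact ht hpt

theorem le_normalised {k : ℕ} {F κ : ℝ} {p : ℝ → Prop}
    (h : ∀ ε > 0, ∀ᶠ t in 𝓝 (0 : ℝ), p t →
      F / (totalLength (gt t) * totalMass (gt t) (ρt t)) + κ * t - ε * |t| ≤
      Pencil.eigenvalue (dirichletForm G (gt t)) (densityForm G (gt t) (ρt t)) k) {ε : ℝ}
    (hε : 0 < ε) :
    ∀ᶠ t in 𝓝 (0 : ℝ), p t → F + κ * t * (totalLength (gt t) * totalMass (gt t) (ρt t)) - ε * |t| ≤
      normalisedEigenvalueWithDensity G k (gt t) (ρt t) := by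
  have h1 := hasDerivAt_normalisation hg hg0 hρ0 hl' hσ hev
  have h2 := normalisation_zero hg0 hρ0 hev
  have hL := totalLength_pos hg
  filter_upwards [le_mul_of_div_le h1.continuousAt (by rw [h2]; positivity) h hε, hev]
    with t ht ht' hpt
  rw [normalisedEigenvalueWithDensity, eigenvalue_eq_pencil hG ht'.1 ht'.2.1,
    mul_assoc (Pencil.eigenvalue _ _ _)]
  exact ht hpt

end Family

end QuantumGraph

/-! ### From extremal metrics to extremal pairs. -/

namespace QuantumGraph

open Set

variable {V E : Type*} {G : DiscreteGraph V E} [Fintype E] [Fintype V] [Nonempty E] {g : E → ℝ}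

omit [Fintype V] [Nonempty E] in
theorem normalisedEigenvalueWithDensity_unitDensity (G : DiscreteGraph V E) (k : ℕ) (g : E → ℝ) :
    normalisedEigenvalueWithDensity G k g unitDensity = normalisedEigenvalue G k g := by
  rw [normalisedEigenvalueWithDensity, normalisedEigenvalue, totalMass_unitDensity, mul_assoc, sq]

theorem hasDerivAt_sqrt_sq_sub {a m : ℝ} (ha : 0 < a) :
    HasDerivAt (fun t => √((a - t * m) ^ 2)) (-m) 0 := by
  have h1 : HasDerivAt (fun t => a - t * m) (-m) 0 := by
    have := ((hasDerivAt_id (0 : ℝ)).mul_const m).const_sub a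
    simpa using this
  refine h1.congr_of_eventuallyEq ?_
  have h2 : ∀ᶠ t in 𝓝 (0 : ℝ), 0 < a - t * m :=
    h1.continuousAt.eventually_const_lt (by simpa using ha)
  exact h2.mono fun t ht => Real.sqrt_sq ht.le

/-- At an extremal metric some positive combination of the energy densities of eigenfunctions is
constant on the whole graph. -/
theorem exists_combination_of_isExtremalMetric (hG : G.Connected) (hg : IsMetric g) {k : ℕ} {l : ℝ}
    (hlk : l = Pencil.eigenvalue (dirichletForm G g) (densityForm G g unitDensity) k) (hl : 0 < l)
    (hne : (Pencil.levels (dirichletForm G g) (densityForm G g unitDensity) k).Nonempty)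
    (hext : IsExtremalMetric (normalisedEigenvalue G k) g) :
    ∃ (ι : Type) (_ : Fintype ι) (c : ι → ℝ) (y : ι → testSpace G), (∀ i, 0 ≤ c i) ∧
      (∀ i, y i ∈ unitEigenspace G g l) ∧ (∀ i, y i ≠ 0) ∧
      (∀ e, ∑ i, c i * energyDensity g l (y i) e 0 = 2 * l * (totalLength g)⁻¹) ∧
      ∑ i, c i * densityForm G g unitDensity (y i) (y i) = 1 := by
  refine (exists_energyDensity_combination hG hg hl).resolve_right ?_
  rintro ⟨m, κ, hκ, hm⟩
  -- Lengths move linearly with velocity `-m`. The sign makes the first variation contribute `+∑ m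
  -- e` times the energy density, and squaring makes the family smooth in `t`.
  set gt : ℝ → E → ℝ := fun t e => (edgeLength g e - t * m e) ^ 2 with hgt
  have hg0 : gt 0 = g := by
    ext e
    simp [hgt, edgeLength_sq hg]
  have hmet : ∀ᶠ t in 𝓝 (0 : ℝ), IsMetric (gt t) := by
    refine Filter.eventually_all.2 fun e => ?_
    have : ContinuousAt (fun t => edgeLength g e - t * m e) 0 := by fun_prop
    exact (this.eventually_const_lt (by simpa using edgeLength_pos hg e)).mono
      fun t ht => pow_pos ht 2
  obtain ⟨δ, hδ, hδm⟩ := Metric.eventually_nhds_iff_ball.1 hmet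
  rw [Real.ball_eq_Ioo, zero_sub, zero_add] at hδm
  have hfam : IsSmoothMetricFamily δ gt g :=
    { pos := hδ
      isMetric := hδm
      smooth := by
        refine ContDiff.contDiffOn (contDiff_pi.2 fun e => ?_)
        fun_prop
      initial := hg0 }
  have hl' : ∀ e, HasDerivAt (fun t => √(gt t e)) (-m e) 0 := fun e =>
    hasDerivAt_sqrt_sq_sub (edgeLength_pos hg e)
  have hρ0 : edgeDensity ((fun _ => unitDensity : ℝ → E → ℝ → ℝ) 0) = 1 := edgeDensity_unitDensity
  have hσ : HasDerivAt (fun t => edgeDensity ((fun _ => unitDensity : ℝ → E → ℝ → ℝ) t)) 0 0 :=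
    hasDerivAt_const _ _
  have hev : ∀ᶠ t in 𝓝 (0 : ℝ), IsMetric (gt t) ∧
      (∀ e, ContinuousOn ((fun _ => unitDensity : ℝ → E → ℝ → ℝ) t e) (Icc 0 1)) ∧
      ∀ e, ∀ x ∈ Icc (0 : ℝ) 1, 0 < (fun _ => unitDensity : ℝ → E → ℝ → ℝ) t e x :=
    hmet.mono fun t ht => ⟨ht, fun e => continuousOn_const, fun e x _ => one_pos⟩
  have hs : Pencil.IsSpectral (dirichletForm G g) (densityForm G g unitDensity) :=
    isSpectral_pencil hG hg (fun e => continuousOn_const) fun e x _ => one_pos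
  have hp := isPerturbation hG hg hg0 hρ0 hl' hσ hev
  have hL := totalLength_pos hg
  have hc := hasDerivAt_comparison hg hg0 hρ0 hl' hσ hev l κ
  have hP0 := normalisation_zero hg0 hρ0 hev
  have hPc := (hasDerivAt_normalisation hg hg0 hρ0 hl' hσ hev).continuousAt
  have hPpos : 0 < totalLength (gt 0) * totalMass (gt 0) ((fun _ => unitDensity : ℝ → E → ℝ → ℝ) 0) := by
    rw [hP0]; positivity
  have hcl : l * totalLength g ^ 2 / (totalLength (gt 0) * totalMass (gt 0) unitDensity) + κ * 0 =
      Pencil.eigenvalue (dirichletForm G g) (densityForm G g unitDensity) k := by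
    rw [hP0, ← hlk]
    field_simp
    ring
  have hfd : FiniteDimensional ℝ (Pencil.eigenspace (dirichletForm G g)
      (densityForm G g unitDensity)
      (Pencil.eigenvalue (dirichletForm G g) (densityForm G g unitDensity) k)) :=
    finiteDimensional_unitEigenspace hG hg (hlk ▸ hl)
  -- Separation says that the normalised variation is at least `κ` on the whole eigenspace, so no
  -- gap around the eigenvalue is needed for either one-sided estimate.
  have hB : ∀ y ∈ Pencil.eigenspace (dirichletForm G g) (densityForm G g unitDensity)
      (Pencil.eigenvalue (dirichletForm G g) (densityForm G g unitDensity) k),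
      0 ≤ (energyForm G (constEdge fun e => -(-m e) / edgeLength g e ^ 2) -
        Pencil.eigenvalue (dirichletForm G g) (densityForm G g unitDensity) k •
          massForm G (constEdge (fun e => -m e) + constEdge (edgeLength g) * 0) -
        (κ - l * (totalLength g)⁻¹ * (2 * ∑ e, -m e +
          weightForm (constEdge (edgeLength g) * 0) 1 1)) • densityForm G g unitDensity) y y := by
    rw [← hlk]
    intro y hy
    rw [variation_apply hG hg hy]
    have h1 := hm y hy
    have h2 : ∀ f : EdgeFun E, weightForm (constEdge (edgeLength g) * 0) f f = 0 := fun f => by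
      rw [weightForm_mul_left, zero_mul, map_zero, LinearMap.zero_apply]
    rw [h2, h2]
    simp only [mul_sub, Finset.sum_sub_distrib, neg_mul, Finset.sum_neg_distrib,
      ← Finset.sum_mul] at h1 ⊢
    linarith
  have hF : normalisedEigenvalue G k g = l * totalLength g ^ 2 := by
    rw [normalisedEigenvalue, eigenvalue_eq_pencil hG hg (ρ := unitDensity) fun e => continuousOn_const, ← hlk]
  -- The normalised eigenvalue rises linearly for `t > 0` and, in `hge`, falls linearly for `t < 0`;
  -- this refutes both alternatives.
  have hle : ¬LeUpToLittleO (fun t => normalisedEigenvalue G k (gt t))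
      (normalisedEigenvalue G k g) := by
    simp only [← normalisedEigenvalueWithDensity_unitDensity]
    rw [normalisedEigenvalueWithDensity_unitDensity, hF]
    refine not_leUpToLittleO hPc hPpos hκ fun ε hε =>
      le_normalised hG hg hg0 hρ0 hl' hσ hev (fun ε hε => ?_) hε
    filter_upwards [hp.le_eigenvalue_of_forall hs hc hcl hne hε] with t ht h0
    exact ht fun y hy => mul_nonneg h0 (hB y hy)
  have hge : ¬GeUpToLittleO (fun t => normalisedEigenvalue G k (gt t))
      (normalisedEigenvalue G k g) := by
    simp only [← normalisedEigenvalueWithDensity_unitDensity]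
    rw [normalisedEigenvalueWithDensity_unitDensity, hF]
    refine not_geUpToLittleO hPc hPpos hκ fun ε hε =>
      normalised_le hG hg hg0 hρ0 hl' hσ hev (fun ε hε => ?_) hε
    filter_upwards [hp.eigenvalue_le_of_forall hs hc hcl hne hε] with t ht h0
    exact ht fun y hy => mul_nonpos_of_nonpos_of_nonneg h0 (hB y hy)
  exact (hext δ gt hfam).elim hle hge

omit [Fintype V] [Nonempty E] in
/-- The analytic data of a smooth family of metrics and densities through `(g, 1)`. -/
theorem exists_derivatives_of_family (hg : IsMetric g) {δ δ' : ℝ} {gt : ℝ → E → ℝ}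
    {ρt : ℝ → E → ℝ → ℝ} (hgt : IsSmoothMetricFamily δ gt g)
    (hρt : IsSmoothDensityFamily δ' ρt unitDensity) :
    edgeDensity (ρt 0) = 1 ∧ (∃ l' : E → ℝ, ∀ e, HasDerivAt (fun t => √(gt t e)) (l' e) 0) ∧
      (∃ σ, HasDerivAt (fun t => edgeDensity (ρt t)) σ 0) ∧
      ∀ᶠ t in 𝓝 (0 : ℝ), IsMetric (gt t) ∧ (∀ e, ContinuousOn (ρt t e) (Icc 0 1)) ∧
        ∀ e, ∀ x ∈ Icc (0 : ℝ) 1, 0 < ρt t e x := by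
  have hcont : ∀ t ∈ Ioo (-δ') δ', ∀ e, ContinuousOn (ρt t e) (Icc 0 1) := fun t ht e =>
    (hρt.smooth e).continuousOn.comp (f := fun x : ℝ => (t, x)) (by fun_prop)
      fun x hx => ⟨ht, hx⟩
  have h0 : (0 : ℝ) ∈ Ioo (-δ') δ' := ⟨by linarith [hρt.pos], hρt.pos⟩
  have h0δ : Ioo (-δ) δ ∈ 𝓝 (0 : ℝ) := Ioo_mem_nhds (by linarith [hgt.pos]) hgt.pos
  refine ⟨?_, ?_, ?_, ?_⟩
  · ext e x
    rw [edgeDensity, unitRestrict_apply (hcont 0 h0 e), hρt.initial e x x.2]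
    rfl
  · have hd : DifferentiableAt ℝ gt 0 :=
      ((hgt.smooth.contDiffAt h0δ).differentiableAt (by simp))
    refine ⟨_, fun e => ((hasDerivAt_pi.1 hd.hasDerivAt e).sqrt ?_)⟩
    rw [hgt.initial]
    exact (hg e).ne'
  · choose σ hσ using fun e => exists_hasDerivAt_unitRestrict hρt.pos (F := fun t => ρt t e)
      ((hρt.smooth e).of_le (by simp))
    exact ⟨σ, hasDerivAt_pi.2 hσ⟩
  · filter_upwards [h0δ, Ioo_mem_nhds h0.1 h0.2] with t h1 h2
    exact ⟨hgt.isMetric t h1, hcont t h2, hρt.density_pos t h2⟩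

theorem exists_nonpos_and_nonneg {ι : Type*} [Fintype ι] {c b : ι → ℝ} (hc : ∀ i, 0 ≤ c i)
    (hne : ∃ i, c i ≠ 0) (h : ∑ i, c i * b i = 0) : (∃ i, b i ≤ 0) ∧ ∃ i, 0 ≤ b i := by
  have key : ∀ b : ι → ℝ, ∑ i, c i * b i = 0 → ∃ i, b i ≤ 0 := by
    intro b hb
    by_contra! hpos
    obtain ⟨i, hi⟩ := hne
    have := (Finset.sum_eq_zero_iff_of_nonneg fun i _ => mul_nonneg (hc i) (hpos i).le).1 hb i
      (Finset.mem_univ i)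
    exact (mul_pos (lt_of_le_of_ne (hc i) hi.symm) (hpos i)).ne' this
  refine ⟨key b h, ?_⟩
  obtain ⟨i, hi⟩ := key (fun i => -b i) (by simp [h])
  exact ⟨i, by linarith⟩

/-- Under the spectral assumptions, extremality among metrics implies extremality among pairs of a
metric and a density. -/
theorem isExtremalPair_of_isExtremalMetric {V E : Type*} [Fintype V] [Fintype E] [Nonempty E]
    (G : DiscreteGraph V E) (hG : G.Connected) (k : ℕ)
    (g : E → ℝ) (hg : IsMetric g)
    (hext : IsExtremalMetric (normalisedEigenvalue G k) g)
    (h4 : ¬ IsEigenvalue G g unitDensity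
      (4 * eigenvalue G k g unitDensity))
    (hsep : (1 ≤ k ∧ eigenvalue G (k - 1) g unitDensity <
        eigenvalue G k g unitDensity) ∨
      eigenvalue G k g unitDensity <
        eigenvalue G (k + 1) g unitDensity) :
    IsExtremalPair (normalisedEigenvalueWithDensity G k) g
      unitDensity := by
  have hs : Pencil.IsSpectral (dirichletForm G g) (densityForm G g unitDensity) :=
    isSpectral_pencil hG hg (fun e => continuousOn_const) fun e x _ => one_pos
  simp only [eigenvalue_eq_pencil hG hg (ρ := unitDensity) fun e => continuousOn_const] at h4 hsep
  obtain ⟨l, hlk⟩ : ∃ l, l = Pencil.eigenvalue (dirichletForm G g) (densityForm G g unitDensity) k :=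
    ⟨_, rfl⟩
  rw [← hlk] at h4
  have hl : 0 < l := pos_of_not_isEigenvalue hG hg (hlk ▸ hs.eigenvalue_nonneg k) h4
  -- If there were no levels, the infimum would be `0` by convention, against `0 < l`.
  have hne : (Pencil.levels (dirichletForm G g) (densityForm G g unitDensity) k).Nonempty := by
    by_contra h
    rw [not_nonempty_iff_eq_empty] at h
    rw [Pencil.eigenvalue, h, Real.sInf_empty] at hlk
    exact hl.ne' hlk
  obtain ⟨ι, _, c, y, hc, hy, hy0, hen, hmass⟩ :=
    exists_combination_of_isExtremalMetric hG hg hlk hl hne hext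
  intro δ gt ρt hgt hρt
  obtain ⟨hρ0, ⟨l', hl'⟩, ⟨σ, hσ⟩, hev⟩ := exists_derivatives_of_family hg hgt hρt
  have hg0 := hgt.initial
  have hp := isPerturbation hG hg hg0 hρ0 hl' hσ hev
  have hder := hasDerivAt_comparison hg hg0 hρ0 hl' hσ hev l 0
  have hP0 := normalisation_zero hg0 hρ0 hev
  have hL := totalLength_pos hg
  have hcl : l * totalLength g ^ 2 / (totalLength (gt 0) * totalMass (gt 0) (ρt 0)) + 0 * 0 =
      Pencil.eigenvalue (dirichletForm G g) (densityForm G g unitDensity) k := by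
    rw [hP0, ← hlk]
    field_simp
    ring
  have hF : normalisedEigenvalueWithDensity G k g unitDensity = l * totalLength g ^ 2 := by
    rw [normalisedEigenvalueWithDensity_unitDensity, normalisedEigenvalue,
      eigenvalue_eq_pencil hG hg (ρ := unitDensity) fun e => continuousOn_const, ← hlk]
  -- The weighted first variations cancel: constant energy density handles the lengths, `∑ c y² = 1
  -- / L` the density, and total mass one the normalisation. One is thus nonpositive and one
  -- nonnegative.
  obtain ⟨⟨i, hi⟩, j, hj⟩ := exists_nonpos_and_nonneg (c := c) (b := fun i =>
    (energyForm G (constEdge fun e => -l' e / edgeLength g e ^ 2) -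
      l • massForm G (constEdge l' + constEdge (edgeLength g) * σ) -
      (0 - l * (totalLength g)⁻¹ * (2 * ∑ e, l' e + weightForm (constEdge (edgeLength g) * σ) 1 1))
        • densityForm G g unitDensity) (y i) (y i)) hc
    (by
      by_contra! h
      simp [h] at hmass) (by
    have h1 := sum_sq_eq_const hG hg c y hy hen h4
    have h2 : ∑ i, c i * weightForm (constEdge (edgeLength g) * σ) (valFun (y i)) (valFun (y i)) =
        (totalLength g)⁻¹ * weightForm (constEdge (edgeLength g) * σ) 1 1 := by
      have h3 := congrArg (fun f => weightForm (constEdge (edgeLength g) * σ) f 1) h1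
      simp only [map_sum, map_smul, LinearMap.sum_apply, LinearMap.smul_apply, smul_eq_mul] at h3
      rw [← h3]
      exact Finset.sum_congr rfl fun i _ => by rw [weightForm_mul_mid, mul_one]
    have h4 : ∑ i, c i * ∑ e, l' e * energyDensity g l (y i) e 0 =
        (∑ e, l' e) * (2 * l * (totalLength g)⁻¹) := by
      simp only [Finset.mul_sum, Finset.sum_mul]
      rw [Finset.sum_comm]
      refine Finset.sum_congr rfl fun e _ => ?_
      rw [← hen e, Finset.mul_sum]
      exact Finset.sum_congr rfl fun i _ => by ring
    calc _ = -(∑ i, c i * ∑ e, l' e * energyDensity g l (y i) e 0) -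
        l * (∑ i, c i * weightForm (constEdge (edgeLength g) * σ) (valFun (y i)) (valFun (y i))) +
        l * (totalLength g)⁻¹ * (2 * ∑ e, l' e + weightForm (constEdge (edgeLength g) * σ) 1 1) *
          ∑ i, c i * densityForm G g unitDensity (y i) (y i) := by
          rw [Finset.mul_sum _ _ l, Finset.mul_sum _ (fun i => c i * densityForm G g unitDensity _ _),
            ← Finset.sum_neg_distrib, ← Finset.sum_sub_distrib, ← Finset.sum_add_distrib]
          refine Finset.sum_congr rfl fun i _ => ?_
          rw [variation_apply hG hg (hy i)]
          ring
      _ = 0 := by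
          rw [h4, h2, hmass]
          ring)
  have hy' := hlk ▸ hy
  -- With a gap below, `y i` gives the upper bound for `t ≥ 0` and `y j` for `t ≤ 0`. With a gap
  -- above, lower bounds hold with the roles exchanged.
  rcases hsep with ⟨hk, hlt⟩ | hlt
  · refine Or.inl (leUpToLittleO_of_forall fun ε hε => ?_)
    have h1 := normalised_le hG hg hg0 hρ0 hl' hσ hev (p := fun _ => True) (k := k)
      (F := l * totalLength g ^ 2) (κ := 0) (fun ε hε => by
        filter_upwards [hp.eigenvalue_le_of_lt hs hder hcl hne hε hk hlt (hy' i) (hy0 i),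
          hp.eigenvalue_le_of_lt hs hder hcl hne hε hk hlt (hy' j) (hy0 j)] with t h1 h2 _
        rcases le_total 0 t with ht | ht
        · exact h1 (hlk ▸ mul_nonpos_of_nonneg_of_nonpos ht hi)
        · exact h2 (hlk ▸ mul_nonpos_of_nonpos_of_nonneg ht hj)) hε
    filter_upwards [h1] with t ht
    have := ht trivial
    rw [hF]
    linarith
  · refine Or.inr (geUpToLittleO_of_forall fun ε hε => ?_)
    have h1 := le_normalised hG hg hg0 hρ0 hl' hσ hev (p := fun _ => True) (k := k)
      (F := l * totalLength g ^ 2) (κ := 0) (fun ε hε => by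
        filter_upwards [hp.le_eigenvalue_of_lt hs hder hcl hne hε hlt (hy' i) (hy0 i),
          hp.le_eigenvalue_of_lt hs hder hcl hne hε hlt (hy' j) (hy0 j)] with t h1 h2 _
        rcases le_total 0 t with ht | ht
        · exact h2 (hlk ▸ mul_nonneg ht hj)
        · exact h1 (hlk ▸ mul_nonneg_of_nonpos_of_nonpos ht hi)) hε
    filter_upwards [h1] with t ht
    have := ht trivial
    rw [hF]
    linarith

end QuantumGraph

theorem corollary4p2 {V E : Type*} [Fintype V] [Fintype E] [Nonempty E]
    (G : QuantumGraph.DiscreteGraph V E) (hG : G.Connected) (k : ℕ)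
    (g : E → ℝ) (hg : QuantumGraph.IsMetric g)
    (hext : QuantumGraph.IsExtremalMetric (QuantumGraph.normalisedEigenvalue G k) g)
    (h4 : ¬ QuantumGraph.IsEigenvalue G g QuantumGraph.unitDensity
      (4 * QuantumGraph.eigenvalue G k g QuantumGraph.unitDensity))
    (hsep : (1 ≤ k ∧ QuantumGraph.eigenvalue G (k - 1) g QuantumGraph.unitDensity <
        QuantumGraph.eigenvalue G k g QuantumGraph.unitDensity) ∨
      QuantumGraph.eigenvalue G k g QuantumGraph.unitDensity <
        QuantumGraph.eigenvalue G (k + 1) g QuantumGraph.unitDensity) :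
    QuantumGraph.IsExtremalPair (QuantumGraph.normalisedEigenvalueWithDensity G k) g
      QuantumGraph.unitDensity :=
  QuantumGraph.isExtremalPair_of_isExtremalMetric G hG k g hg hext h4 hsep
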